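/- Let $d\ge 2$ be an integer and $\rho=\frac{d-1}{2}$. On $\mathbb R^{d+1}$ put $[x,y]=x^0y^0-x^1y^1-\dots-x^dy^d$, and let $\mathbb H^d=\{x\in\mathbb R^{d+1}:\ [x,x]=1,\ x^0>0\}$ be the hyperbolic space, with the Riemannian metric induced by the Minkowski metric and the corresponding volume measure $dx$. Let $d\omega$ be the surface measure of the unit sphere $\mathbb S^{d-1}\subset\mathbb R^d$ and $\omega_{d-1}$ its total mass. For $\lambda>0$ let $$c(\lambda)=\frac{2^{2\rho-1}\Gamma(\rho+\frac12)}{\pi^{1/2}}\frac{\Gamma(i\lambda)}{\Gamma(\rho+i\lambda)},\qquad h_{\lambda,\omega}(x)=[x,(1,\omega)]^{i\lambda-\rho}\quad(x\in\mathbb H^d,\ \omega\in\mathbb S^{d-1}),$$ and define the Fourier extension operator $$E_\lambda f(x)=|c(\lambda)|^{-1}\frac{1}{\omega_{d-1}}\int_{\mathbb S^{d-1}}f(\omega)\,\overline{h_{\lambda,\omega}(x)}\,d\omega,\qquad x\in\mathbb H^d .$$ Write $\|E_\lambda\|_{L^p\to L^q}\in[0,\infty]$ for the supremum of $\|E_\lambda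 f\|_{L^q(\mathbb H^d)}$ over all complex-valued $f\in L^p(\mathbb S^{d-1})$ with $\|f\|_{L^p(\mathbb S^{d-1})}\le1$. (i) For every $\lambda>0$ and all $p,q\in[1,\infty]$ with $p<2$ or $q\le2$, the operator $E_\lambda$ is not bounded from $L^p(\mathbb S^{d-1})$ to $L^q(\mathbb H^d)$: there is no finite $C$ such that $\|E_\lambda f\|_{L^q(\mathbb H^d)}\le C\|f\|_{L^p(\mathbb S^{d-1})}$ for all $f\in L^p(\mathbb S^{d-1})$. (ii) There is a constant $c_d>0$, depending only on $d$, such that for all $\lambda>1$, all $p\in[2,\infty]$ and all $q\in(2,\infty]$, $$\|E_\lambda\|_{L^p\to L^q}\ \ge\ c_d\left((q-2)^{-1/2}\lambda^{\frac{\rho}{p}-\frac{\rho}{q}}+\lambda^{\rho-\frac dq}\right),$$ where $1/\infty=0$ and $(q-2)^{-1/2}=0$ if $q=\infty$. -/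

import Mathlib

open MeasureTheory
open scoped ENNReal

namespace HyperbolicExtension

noncomputable section

/-- The Euclidean space `ℝ^d`. -/
abbrev Space (d : ℕ) : Type := EuclideanSpace ℝ (Fin d)

/-- The space `ℝ^(d+1)`, a point being written `(x⁰, (x¹, …, x^d))`. -/
abbrev Minkowski (d : ℕ) : Type := ℝ × Space d

/-- The Minkowski form `[x,y] = x⁰ y⁰ - x¹ y¹ - ⋯ - x^d y^d`. -/
def mink {d : ℕ} (x y : Minkowski d) : ℝ :=
  x.1 * y.1 - ∑ i : Fin d, x.2 i * y.2 i

/-- The hyperbolic space: the upper sheet of the hyperboloid `[x,x] = 1`. -/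
def hyperboloid (d : ℕ) : Set (Minkowski d) :=
  {x | mink x x = 1 ∧ 0 < x.1}

/-- The global parametrization `y ↦ (√(1+|y|²), y)` of the hyperboloid. -/
def param (d : ℕ) (y : Space d) : Minkowski d :=
  (Real.sqrt (1 + ‖y‖ ^ 2), y)

theorem param_mem (d : ℕ) (y : Space d) : param d y ∈ hyperboloid d := by
  have h : (0 : ℝ) < 1 + ‖y‖ ^ 2 := by positivity
  refine ⟨?_, Real.sqrt_pos.2 h⟩
  have h2 : ∑ i : Fin d, y i * y i = ‖y‖ ^ 2 := by
    rw [EuclideanSpace.real_norm_sq_eq]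
    exact Finset.sum_congr rfl fun i _ => (pow_two _).symm
  simp only [mink, param, h2, Real.mul_self_sqrt h.le]
  ring

/-- The same parametrization, with values in the hyperbolic space. It is a bijection. -/
def toHyperboloid (d : ℕ) (y : Space d) : hyperboloid d :=
  ⟨param d y, param_mem d y⟩

/-- The Riemannian metric of the hyperbolic space in the coordinates `y`:
`g_ij = -[∂_i X, ∂_j X]`, where `X` is the parametrization. (The Minkowski form is negative
definite on the tangent spaces of the hyperboloid, hence the sign.) -/
def metricMatrix (d : ℕ) (y : Space d) : Matrix (Fin d) (Fin d) ℝ :=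
  Matrix.of fun i j =>
    -mink (fderiv ℝ (param d) y (EuclideanSpace.single i 1))
      (fderiv ℝ (param d) y (EuclideanSpace.single j 1))

/-- The Riemannian volume measure `dx` of the hyperbolic space, `√(det g) dy` in the
coordinates `y`. -/
def hypMeasure (d : ℕ) : Measure (hyperboloid d) :=
  Measure.map (toHyperboloid d)
    ((volume : Measure (Space d)).withDensity
      fun y => ENNReal.ofReal (Real.sqrt (metricMatrix d y).det))

/-- The unit sphere `S^(d-1)` of `ℝ^d`. -/
abbrev USphere (d : ℕ) : Type := Metric.sphere (0 : Space d) 1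

/-- The (unnormalized) surface measure `dω` on `S^(d-1)`. -/
def sphereMeasure (d : ℕ) : Measure (USphere d) :=
  (volume : Measure (Space d)).toSphere

/-- `ρ = (d-1)/2`. -/
def rho (d : ℕ) : ℝ := ((d : ℝ) - 1) / 2

/-- `b(ω) = (1, ω)`. -/
def lightRay {d : ℕ} (w : USphere d) : Minkowski d := (1, (w : Space d))

/-- The hyperbolic plane wave `h_{λ,ω}(x) = [x, b(ω)]^(iλ - ρ)`; the base is a positive real. -/
def planeWave (d : ℕ) (lam : ℝ) (w : USphere d) (x : hyperboloid d) : ℂ :=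
  ((mink (x : Minkowski d) (lightRay w) : ℝ) : ℂ) ^ (Complex.I * (lam : ℂ) - (rho d : ℂ))

/-- The Harish-Chandra function
`c(λ) = 2^(2ρ-1) Γ(ρ+1/2) π^(-1/2) Γ(iλ) / Γ(ρ+iλ)`. -/
def harishChandra (d : ℕ) (lam : ℝ) : ℂ :=
  (((2 : ℝ) ^ (2 * rho d - 1) * Real.Gamma (rho d + 1 / 2) / Real.sqrt Real.pi : ℝ) : ℂ) *
    (Complex.Gamma (Complex.I * (lam : ℂ)) /
      Complex.Gamma ((rho d : ℂ) + Complex.I * (lam : ℂ)))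

/-- The Fourier extension operator
`[E_λ f](x) = |c(λ)|⁻¹ ω_{d-1}⁻¹ ∫ f(ω) conj (h_{λ,ω}(x)) dω`,
with `ω_{d-1}` the area of the sphere. -/
def extension (d : ℕ) (lam : ℝ) (f : USphere d → ℂ) (x : hyperboloid d) : ℂ :=
  ((‖harishChandra d lam‖⁻¹ * ((sphereMeasure d).real Set.univ)⁻¹ : ℝ) : ℂ) *
    ∫ w, f w * (starRingEnd ℂ) (planeWave d lam w x) ∂(sphereMeasure d)

/-- `E_λ` is bounded from `L^p(S^(d-1))` to `L^q(ℍ^d)`. -/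
def IsBoundedExtension (d : ℕ) (lam : ℝ) (p q : ℝ≥0∞) : Prop :=
  ∃ C : NNReal, ∀ f : USphere d → ℂ, MemLp f p (sphereMeasure d) →
    eLpNorm (extension d lam f) q (hypMeasure d) ≤ C * eLpNorm f p (sphereMeasure d)

/-- The operator norm of `E_λ` from `L^p(S^(d-1))` to `L^q(ℍ^d)`, an element of `[0,∞]`. -/
def extensionNorm (d : ℕ) (lam : ℝ) (p q : ℝ≥0∞) : ℝ≥0∞ :=
  ⨆ (f : USphere d → ℂ) (_ : MemLp f p (sphereMeasure d))
    (_ : eLpNorm f p (sphereMeasure d) ≤ 1),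
    eLpNorm (extension d lam f) q (hypMeasure d)

end

end HyperbolicExtension

/-!
Write `d = n + 1`, `ρ = n / 2`, `s = ρ + iλ`, and let `b(ω) = (1, ω)`. In geodesic polar coordinates
`x = (cosh r, sinh r θ)` the volume of the hyperbolic space is `sinh^n r dr dθ`
(`lintegral_hypMeasure_polar`) and `[x, b(ω)] = cosh r - sinh r ⟪θ, ω⟫`. So `|E_λ f(x)|` is
`(ω_{d-1} |c(λ)|)⁻¹` times the modulus of `∫ f(ω) exp(-s log [x, b(ω)]) dω` (`norm_extension`), and
`|c(λ)|⁻¹` is comparable to `λ^ρ` for `λ ≥ 1` (`exists_harishChandra_bounds`). Four families of test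
functions give the result.

* *The constant `1` near the origin.* On a ball of radius `δ / λ` the integrand is close to `1`,
  hence `|E_λ 1|` is at least a multiple of `λ^ρ` there. This gives the term `λ^(ρ - d/q)`
  (`exists_le_extensionNorm_ball`).

* *Caps, for `p < 2`.* If `f` is the indicator function of a cap of radius `δ e^(-R)`, the integrand
  does not oscillate at the distance `r ∈ [R - 1, R]` over the cap. This region has measure
  comparable to `1`, and `|E_λ f|` is of size `e^(ρ R) e^(-n R)` on it, while `‖f‖_p` is of size
  `e^(-n R / p)`. The quotient grows like `e^(n R (1/p - 1/2))`
  (`not_isBoundedExtension_of_lt_two`).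

* *The constant `1` far from the origin.* `E_λ 1` is a multiple of the spherical function, which is
  `e^(-s r) ψ(r)` with `ψ` an integral over the polar angle (`zonalIntegral`). The substitution
  `tan (φ / 2) = e^(-r) v` shows that `ψ'(r)` differs from a multiple of `e^(2iλr)`, given by a beta
  integral, by an error of size `|s|² e^(-r)` (`norm_zonal_deriv_sub_le`). Working with `ψ'` instead
  of `ψ` makes the limiting integral absolutely convergent. Over half a period the
  plane wave changes its sign, so `|ψ|` cannot be small both at `r` and at `r + π / (2λ)`
  (`le_norm_zonalIntegral_sub`), once `r ≥ R` with `R` of size `1 + log λ`. Therefore `|E_λ 1|` is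
  of size `e^(-ρ r)` on a large set of radii, and its `q`-th power has an integral at least of size
  `∫_R^∞ e^(-ρ (q-2) r) dr`. The latter is infinite for `q ≤ 2`
  (`not_isBoundedExtension_of_le_two`), and equal to `e^(-ρ (q-2) R) / (ρ (q-2))` for `q > 2`. If
  `(q-2) log λ` is bounded, the exponential and `λ^(ρ/p - ρ/q)` are harmless, and the term
  `(q-2)^(-1/q) λ^(ρ/p - ρ/q)` follows (`exists_le_extensionNorm_one`).

* *Wave packets, for large `(q-2) log λ`.* In the gnomonic chart `v ↦ (1, v) / √(1 + |v|²)` let `f`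
  be the Gaussian `e^(-λ|v|²)` divided by the density of the surface measure; then `‖f‖_p` is at most
  a multiple of `λ^(-ρ/p)`. In a cone over a cap of radius `λ^(-1/2)` and as long as a fixed power of
  `e^r` is small compared to `λ`, the phase is quadratic up to a small error, and an explicit
  complex Gaussian integral yields `|E_λ f| ≥ c e^(-ρ r)`
  (`exists_le_norm_extension_wavePacket`). Integrating over `1 ≤ r ≤ 1 + 1 / (q-2)` gives the same
  term (`exists_le_extensionNorm_wavePacket`).

Finally `(q-2)^(-1/q)` is at least a constant times `(q-2)^(-1/2)` (`exp_neg_one_mul_rpow_le`).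
-/

open MeasureTheory
open scoped ENNReal

namespace HyperbolicExtension

/-! ### Polar coordinates on the hyperbolic space -/

/-- Polar coordinates in `ℝ^(n+1)`. -/
theorem lintegral_polar {n : ℕ} (F : Space (n + 1) → ℝ≥0∞) (hF : Measurable F) :
    ∫⁻ x, F x = ∫⁻ θ, (∫⁻ r in Set.Ioi (0 : ℝ),
      ENNReal.ofReal (r ^ n) * F (r • (θ : Space (n + 1)))) ∂(sphereMeasure (n + 1)) := by
  have hmp := (volume : Measure (Space (n + 1))).measurePreserving_homeomorphUnitSphereProd
  have hdim : Module.finrank ℝ (Space (n + 1)) - 1 = n := by simp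
  rw [hdim] at hmp
  have h1 : ∫⁻ x, F x = ∫⁻ x in ({0}ᶜ : Set (Space (n + 1))), F x := by
    rw [restrict_compl_singleton]
  rw [h1, ← lintegral_subtype_comap (measurableSet_singleton _).compl]
  have h2 := hmp.lintegral_comp_emb (Homeomorph.measurableEmbedding _)
    (fun p : USphere (n + 1) × Set.Ioi (0 : ℝ) => F ((p.2 : ℝ) • (p.1 : Space (n + 1))))
  have h3 : ∀ x : ({0}ᶜ : Set (Space (n + 1))),
      F ((((homeomorphUnitSphereProd (Space (n + 1)) x).2 : ℝ)) •
        (((homeomorphUnitSphereProd (Space (n + 1)) x).1 : Space (n + 1)))) = F x := by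
    intro x
    congr 1
    have hx : ‖(x : Space (n + 1))‖ ≠ 0 := norm_ne_zero_iff.2 x.2
    simp [smul_smul, hx]
  simp only [h3] at h2
  rw [h2]
  have hm : Measurable fun p : USphere (n + 1) × Set.Ioi (0 : ℝ) =>
      F ((p.2 : ℝ) • (p.1 : Space (n + 1))) := hF.comp (by fun_prop)
  rw [lintegral_prod _ hm.aemeasurable]
  refine lintegral_congr fun θ => ?_
  rw [Measure.volumeIoiPow]
  refine (lintegral_withDensity_eq_lintegral_mul _ (by fun_prop)
    (hF.comp (by fun_prop : Measurable fun r : Set.Ioi (0 : ℝ) =>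
      (r : ℝ) • (θ : Space (n + 1))))).trans ?_
  exact lintegral_subtype_comap measurableSet_Ioi
    (fun r : ℝ => ENNReal.ofReal (r ^ n) * F (r • (θ : Space (n + 1))))

theorem hasFDerivAt_param {d : ℕ} (y : Space d) :
    HasFDerivAt (param d)
      (((Real.sqrt (1 + ‖y‖ ^ 2))⁻¹ • innerSL ℝ y).prod (ContinuousLinearMap.id ℝ (Space d))) y := by
  have h : (0 : ℝ) < 1 + ‖y‖ ^ 2 := by positivity
  have h1 : HasFDerivAt (fun y : Space d => 1 + ‖y‖ ^ 2) ((2 : ℝ) • innerSL ℝ y) y := by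
    have h0 := (hasStrictFDerivAt_norm_sq y).hasFDerivAt.const_add 1
    rwa [← Nat.cast_smul_eq_nsmul ℝ] at h0
  have h2 := h1.sqrt h.ne'
  have h3 := h2.prodMk (hasFDerivAt_id y)
  convert! h3 using 2
  rw [smul_smul]
  congr 1
  field_simp

/-- The metric is `1 - y yᵀ / (1 + |y|²)` in the coordinates `y`, a perturbation of the identity of
rank one. -/
theorem det_metricMatrix {d : ℕ} (y : Space d) :
    (metricMatrix d y).det = (1 + ‖y‖ ^ 2)⁻¹ := by
  have h : (0 : ℝ) < 1 + ‖y‖ ^ 2 := by positivity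
  have h2 : ∑ i : Fin d, y i * y i = ‖y‖ ^ 2 := by
    rw [EuclideanSpace.real_norm_sq_eq]
    exact Finset.sum_congr rfl fun i _ => (pow_two _).symm
  have h1 : metricMatrix d y = 1 + Matrix.replicateCol Unit (fun i => -(1 + ‖y‖ ^ 2)⁻¹ * y i) *
      Matrix.replicateRow Unit (fun i => y i) := by
    ext i j
    have hs : (Real.sqrt (1 + ‖y‖ ^ 2))⁻¹ * (Real.sqrt (1 + ‖y‖ ^ 2))⁻¹ = (1 + ‖y‖ ^ 2)⁻¹ := by
      rw [← mul_inv, Real.mul_self_sqrt h.le]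
    simp only [metricMatrix, (hasFDerivAt_param y).fderiv, mink, Matrix.of_apply]
    simp [EuclideanSpace.inner_single_right, Matrix.mul_apply, Matrix.one_apply]
    rw [← hs]
    simp only [eq_comm (a := j)]
    ring
  rw [h1, Matrix.det_one_add_replicateCol_mul_replicateRow]
  simp only [dotProduct]
  have : ∑ i : Fin d, y i * (-(1 + ‖y‖ ^ 2)⁻¹ * y i) = -(1 + ‖y‖ ^ 2)⁻¹ * ‖y‖ ^ 2 := by
    rw [← h2, Finset.mul_sum]
    exact Finset.sum_congr rfl fun i _ => by ring
  rw [this]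
  field_simp
  ring

theorem continuous_toHyperboloid (d : ℕ) : Continuous (toHyperboloid d) := by
  unfold toHyperboloid param
  fun_prop

theorem lintegral_hypMeasure {d : ℕ} (H : hyperboloid d → ℝ≥0∞) (hH : Measurable H) :
    ∫⁻ x, H x ∂(hypMeasure d) =
      ∫⁻ y : Space d, ENNReal.ofReal (Real.sqrt (1 + ‖y‖ ^ 2))⁻¹ * H (toHyperboloid d y) := by
  have hc := (continuous_toHyperboloid d).measurable
  rw [hypMeasure, lintegral_map hH hc]
  simp only [det_metricMatrix, Real.sqrt_inv]
  exact lintegral_withDensity_eq_lintegral_mul _ (by fun_prop) (hH.comp hc)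

/-- The point at distance `r` from the origin `(1, 0)` in the direction `θ`, i.e.
`(cosh r, sinh r θ)`. -/
noncomputable def polarPoint {d : ℕ} (r : ℝ) (θ : USphere d) : hyperboloid d :=
  toHyperboloid d (Real.sinh r • (θ : Space d))

theorem norm_usphere {d : ℕ} (θ : USphere d) : ‖(θ : Space d)‖ = 1 := by
  simp

theorem sqrt_one_add_sinh_sq (r : ℝ) : Real.sqrt (1 + Real.sinh r ^ 2) = Real.cosh r := by
  rw [add_comm, ← Real.cosh_sq, Real.sqrt_sq (Real.cosh_pos r).le]

theorem mink_polarPoint {d : ℕ} (r : ℝ) (θ w : USphere d) :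
    mink (polarPoint r θ : Minkowski d) (lightRay w) =
      Real.cosh r - Real.sinh r * inner ℝ (θ : Space d) (w : Space d) := by
  have h : ‖Real.sinh r • (θ : Space d)‖ ^ 2 = Real.sinh r ^ 2 := by
    rw [norm_smul, norm_usphere, mul_one, Real.norm_eq_abs, sq_abs]
  simp only [mink, polarPoint, toHyperboloid, param, lightRay, h, sqrt_one_add_sinh_sq]
  rw [PiLp.inner_apply, Finset.mul_sum]
  simp only [mul_one, PiLp.smul_apply, smul_eq_mul, RCLike.inner_apply, conj_trivial]
  congr 1
  exact Finset.sum_congr rfl fun i _ => by ring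

/-- Integration over the hyperbolic space in geodesic polar coordinates. -/
theorem lintegral_hypMeasure_polar {n : ℕ} (H : hyperboloid (n + 1) → ℝ≥0∞) (hH : Measurable H) :
    ∫⁻ x, H x ∂(hypMeasure (n + 1)) = ∫⁻ θ, (∫⁻ r in Set.Ioi (0 : ℝ),
      ENNReal.ofReal (Real.sinh r ^ n) * H (polarPoint r θ)) ∂(sphereMeasure (n + 1)) := by
  have hc := (continuous_toHyperboloid (n + 1)).measurable
  rw [lintegral_hypMeasure H hH]
  refine (lintegral_polar _ ((by fun_prop : Measurable fun y : Space (n + 1) =>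
    ENNReal.ofReal (Real.sqrt (1 + ‖y‖ ^ 2))⁻¹).mul (hH.comp hc))).trans ?_
  simp only [Pi.mul_apply, Function.comp_apply]
  refine lintegral_congr fun θ => ?_
  have himg : Real.sinh '' Set.Ioi 0 = Set.Ioi 0 := by
    ext s
    constructor
    · rintro ⟨r, hr, rfl⟩
      exact Real.sinh_pos_iff.2 hr
    · intro hs
      exact ⟨Real.arsinh s, Real.arsinh_pos_iff.2 hs, Real.sinh_arsinh s⟩
  conv_lhs => rw [← himg]
  rw [lintegral_image_eq_lintegral_abs_deriv_mul measurableSet_Ioi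
    (fun r _ => (Real.hasDerivAt_sinh r).hasDerivWithinAt) Real.sinh_injective.injOn]
  refine setLIntegral_congr_fun measurableSet_Ioi fun r hr => ?_
  have hr0 : 0 < Real.sinh r := Real.sinh_pos_iff.2 hr
  have h : ‖Real.sinh r • (θ : Space (n + 1))‖ ^ 2 = Real.sinh r ^ 2 := by
    rw [norm_smul, norm_usphere, mul_one, Real.norm_eq_abs, sq_abs]
  simp only [h, sqrt_one_add_sinh_sq, polarPoint]
  have hcosh := Real.cosh_pos r
  rw [← mul_assoc, ← mul_assoc, ← ENNReal.ofReal_mul (abs_nonneg _),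
    ← ENNReal.ofReal_mul (by positivity), abs_of_pos hcosh]
  congr 2
  field_simp

/-! ### The gnomonic chart of the upper half-sphere -/

/-- The vector `(a, w)` of `ℝ^(n+1) = ℝ × ℝ^n`. -/
noncomputable def consVec {n : ℕ} (a : ℝ) (w : Space n) : Space (n + 1) :=
  WithLp.toLp 2 (Fin.cons a w.ofLp)

theorem inner_consVec {n : ℕ} (a b : ℝ) (v w : Space n) :
    inner ℝ (consVec a v) (consVec b w) = a * b + inner ℝ v w := by
  simp [consVec, PiLp.inner_apply, Fin.sum_univ_succ, mul_comm]

theorem norm_consVec_sq {n : ℕ} (a : ℝ) (w : Space n) :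
    ‖consVec a w‖ ^ 2 = a ^ 2 + ‖w‖ ^ 2 := by
  rw [← real_inner_self_eq_norm_sq, inner_consVec, real_inner_self_eq_norm_sq, sq a]

theorem norm_consVec {n : ℕ} (a : ℝ) (w : Space n) :
    ‖consVec a w‖ = Real.sqrt (a ^ 2 + ‖w‖ ^ 2) := by
  rw [← norm_consVec_sq, Real.sqrt_sq (norm_nonneg _)]

theorem consVec_smul {n : ℕ} (t a : ℝ) (w : Space n) :
    t • consVec a w = consVec (t * a) (t • w) := by
  ext i
  refine Fin.cases ?_ (fun j => ?_) i <;> simp [consVec]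

theorem consVec_apply_zero {n : ℕ} (a : ℝ) (w : Space n) : consVec a w 0 = a := by
  simp [consVec]

theorem measurable_consVec {n : ℕ} : Measurable fun p : ℝ × Space n => consVec p.1 p.2 := by
  refine (WithLp.measurable_toLp 2 _).comp (measurable_pi_lambda _ fun i => ?_)
  refine Fin.cases ?_ (fun j => ?_) i
  · simpa using measurable_fst
  · simp only [Fin.cons_succ]
    fun_prop

/-- Fubini's theorem in `ℝ^(n+1) = ℝ × ℝ^n`. -/
theorem lintegral_consVec {n : ℕ} (F : Space (n + 1) → ℝ≥0∞) (hF : Measurable F) :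
    ∫⁻ x, F x = ∫⁻ a : ℝ, ∫⁻ w : Space n, F (consVec a w) := by
  have h1 := (PiLp.volume_preserving_toLp (Fin (n + 1))).lintegral_comp hF
  have h2 := (volume_preserving_piFinSuccAbove (fun _ : Fin (n + 1) => ℝ) 0).symm.lintegral_comp
    (hF.comp (WithLp.measurable_toLp 2 (Fin (n + 1) → ℝ)))
  simp only [Function.comp_apply] at h2
  rw [← h1, ← h2]
  have hm : Measurable fun p : ℝ × (Fin n → ℝ) =>
      F (WithLp.toLp 2 ((MeasurableEquiv.piFinSuccAbove (fun _ : Fin (n + 1) => ℝ) 0).symm p)) :=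
    hF.comp ((WithLp.measurable_toLp 2 (Fin (n + 1) → ℝ)).comp (MeasurableEquiv.measurable _))
  rw [Measure.volume_eq_prod, lintegral_prod _ hm.aemeasurable]
  refine lintegral_congr fun a => ?_
  have hcm : Measurable fun w : Space n => F (consVec a w) :=
    hF.comp (measurable_consVec.comp (measurable_const.prodMk measurable_id))
  rw [← (PiLp.volume_preserving_toLp (Fin n)).lintegral_comp hcm]
  refine lintegral_congr fun w => ?_
  simp only [consVec, MeasurableEquiv.piFinSuccAbove]
  simp [Fin.insertNthEquiv]

theorem lintegral_comp_smul_pos {n : ℕ} (h : Space n → ℝ≥0∞) (hh : Measurable h) {a : ℝ}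
    (ha : 0 < a) : ∫⁻ w, h w = ENNReal.ofReal (a ^ n) * ∫⁻ v, h (a • v) := by
  have h1 := Measure.map_addHaar_smul (volume : Measure (Space n)) ha.ne'
  have h2 : ∫⁻ v, h (a • v) = ∫⁻ w, h w ∂(Measure.map (a • ·) (volume : Measure (Space n))) :=
    (lintegral_map hh (measurable_const_smul a)).symm
  rw [h2, h1, lintegral_smul_measure, smul_eq_mul, ← mul_assoc, ← ENNReal.ofReal_mul (by positivity)]
  have : a ^ n * |(a ^ Module.finrank ℝ (Space n))⁻¹| = 1 := by
    rw [finrank_euclideanSpace_fin, abs_of_pos (by positivity)]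
    field_simp
  rw [this]; simp

theorem lintegral_Ioo_pow (n : ℕ) {b : ℝ} (hb : 0 < b) :
    ∫⁻ r in Set.Ioo (0 : ℝ) b, ENNReal.ofReal (r ^ n) = ENNReal.ofReal (b ^ (n + 1) / (n + 1)) := by
  rw [setLIntegral_congr Ioo_ae_eq_Ioc, ← ofReal_integral_eq_lintegral_ofReal,
    ← intervalIntegral.integral_of_le hb.le]
  · simp
  · exact (intervalIntegral.intervalIntegrable_pow n).1
  · filter_upwards [ae_restrict_mem measurableSet_Ioc] with y hy
    exact pow_nonneg hy.1.le _

/-- The gnomonic (central) projection `v ↦ (1, v) / √(1 + |v|²)` of `ℝ^n` onto the open upper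
half sphere. -/
noncomputable def gnomonic {n : ℕ} (v : Space n) : USphere (n + 1) :=
  ⟨(Real.sqrt (1 + ‖v‖ ^ 2))⁻¹ • consVec 1 v, by
    have h : (0 : ℝ) < 1 + ‖v‖ ^ 2 := by positivity
    rw [mem_sphere_zero_iff_norm, norm_smul, norm_consVec, norm_inv, Real.norm_eq_abs,
      abs_of_pos (Real.sqrt_pos.2 h), one_pow]
    exact inv_mul_cancel₀ (Real.sqrt_pos.2 h).ne'⟩

theorem gnomonic_coe {n : ℕ} (v : Space n) :
    (gnomonic v : Space (n + 1)) = (Real.sqrt (1 + ‖v‖ ^ 2))⁻¹ • consVec 1 v := rfl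

theorem gnomonic_zero_coord {n : ℕ} (v : Space n) :
    (gnomonic v : Space (n + 1)) 0 = (Real.sqrt (1 + ‖v‖ ^ 2))⁻¹ := by
  simp [gnomonic_coe, consVec_apply_zero]

theorem measurable_gnomonic {n : ℕ} : Measurable (gnomonic : Space n → USphere (n + 1)) := by
  refine Measurable.subtype_mk ?_
  exact (by fun_prop : Measurable fun v : Space n => (Real.sqrt (1 + ‖v‖ ^ 2))⁻¹).smul
    (measurable_consVec.comp (measurable_const.prodMk measurable_id))

/-- The open upper half sphere. -/
def upperHalf (n : ℕ) : Set (USphere (n + 1)) := {w | 0 < (w : Space (n + 1)) 0}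

theorem measurableSet_upperHalf (n : ℕ) : MeasurableSet (upperHalf n) :=
  measurableSet_lt (f := fun _ : USphere (n + 1) => (0 : ℝ))
    (g := fun w : USphere (n + 1) => (w : Space (n + 1)) 0) measurable_const (by fun_prop)

theorem gnomonic_mem_upperHalf {n : ℕ} (v : Space n) : gnomonic v ∈ upperHalf n := by
  have h : (0 : ℝ) < 1 + ‖v‖ ^ 2 := by positivity
  simpa [upperHalf, gnomonic_zero_coord] using h

/-- Up to the factor `1 / (n + 1)`, both sides are the integral of `x ↦ G (x / |x|)` over the upper
half of the unit ball: in polar coordinates, and in the coordinates `(a, v)` with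
`x = (a, a v)`. -/
theorem setLIntegral_upperHalf_coe {n : ℕ} (G : Space (n + 1) → ℝ≥0∞) (hG : Measurable G) :
    ∫⁻ w in upperHalf n, G (w : Space (n + 1)) ∂(sphereMeasure (n + 1)) =
      ∫⁻ v : Space n, ENNReal.ofReal ((Real.sqrt (1 + ‖v‖ ^ 2))⁻¹ ^ (n + 1)) *
        G (gnomonic v : Space (n + 1)) := by
  set S : Set (Space (n + 1)) := {x | 0 < x 0 ∧ ‖x‖ < 1} with hS
  have hSm : MeasurableSet S :=
    (measurableSet_lt (f := fun _ : Space (n + 1) => (0 : ℝ))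
      (g := fun x : Space (n + 1) => x 0) measurable_const (by fun_prop)).inter
      (measurableSet_lt (f := fun x : Space (n + 1) => ‖x‖) (g := fun _ => (1 : ℝ))
        (by fun_prop) measurable_const)
  set F : Space (n + 1) → ℝ≥0∞ := S.indicator fun x => G (‖x‖⁻¹ • x) with hF
  have hFm : Measurable F := (hG.comp (by fun_prop)).indicator hSm
  have hpolar : ∫⁻ x, F x = (∫⁻ w in upperHalf n, G (w : Space (n + 1)) ∂(sphereMeasure (n + 1))) *
      ENNReal.ofReal (1 / ((n : ℝ) + 1)) := by
    have hGm : Measurable fun w : USphere (n + 1) => G (w : Space (n + 1)) :=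
      hG.comp measurable_subtype_coe
    rw [lintegral_polar F hFm, ← lintegral_indicator (measurableSet_upperHalf n),
      ← lintegral_mul_const _ (hGm.indicator (measurableSet_upperHalf n))]
    refine lintegral_congr fun θ => ?_
    have h1 : ∀ r ∈ Set.Ioi (0 : ℝ), ENNReal.ofReal (r ^ n) * F (r • (θ : Space (n + 1))) =
        (upperHalf n).indicator (fun w => G (w : Space (n + 1))) θ *
          (Set.Ioo (0 : ℝ) 1).indicator (fun r => ENNReal.ofReal (r ^ n)) r := by
      intro r hr
      have hr' : (0 : ℝ) < r := hr
      have hn : ‖r • (θ : Space (n + 1))‖ = r := by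
        rw [norm_smul, norm_usphere, mul_one, Real.norm_eq_abs, abs_of_pos hr']
      by_cases h0 : θ ∈ upperHalf n
      · have h0' : 0 < (θ : Space (n + 1)) 0 := h0
        by_cases h1 : r < 1
        · have hmem : r • (θ : Space (n + 1)) ∈ S := by
            refine ⟨?_, by rw [hn]; exact h1⟩
            simpa using mul_pos hr' h0'
          rw [hF, Set.indicator_of_mem hmem, Set.indicator_of_mem h0,
            Set.indicator_of_mem (Set.mem_Ioo.2 ⟨hr', h1⟩), hn, smul_smul,
            inv_mul_cancel₀ hr'.ne', one_smul, mul_comm]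
        · have hmem : r • (θ : Space (n + 1)) ∉ S := fun h => h1 (by rw [← hn]; exact h.2)
          rw [hF, Set.indicator_of_notMem hmem,
            Set.indicator_of_notMem (fun h : r ∈ Set.Ioo (0 : ℝ) 1 => h1 h.2), mul_zero, mul_zero]
      · have hmem : r • (θ : Space (n + 1)) ∉ S := by
          intro h
          have h2 : 0 < r * (θ : Space (n + 1)) 0 := by simpa using h.1
          exact h0 ((pos_iff_pos_of_mul_pos h2).1 hr')
        rw [hF, Set.indicator_of_notMem hmem, Set.indicator_of_notMem h0, mul_zero, zero_mul]
    rw [setLIntegral_congr_fun measurableSet_Ioi h1, lintegral_const_mul _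
      ((by fun_prop : Measurable fun r : ℝ => ENNReal.ofReal (r ^ n)).indicator measurableSet_Ioo),
      setLIntegral_indicator measurableSet_Ioo,
      Set.inter_eq_self_of_subset_left Set.Ioo_subset_Ioi_self, lintegral_Ioo_pow n one_pos, one_pow]
  have hcart : ∫⁻ x, F x = (∫⁻ v : Space n, ENNReal.ofReal ((Real.sqrt (1 + ‖v‖ ^ 2))⁻¹ ^ (n + 1)) *
        G (gnomonic v : Space (n + 1))) * ENNReal.ofReal (1 / ((n : ℝ) + 1)) := by
    rw [lintegral_consVec F hFm]
    have hconsm : ∀ a : ℝ, Measurable fun w : Space n => F (consVec a w) := fun a =>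
      hFm.comp (measurable_consVec.comp (measurable_const.prodMk measurable_id))
    have hneg : ∀ a : ℝ, a ∉ Set.Ioi (0 : ℝ) → ∫⁻ w : Space n, F (consVec a w) = 0 := by
      intro a ha
      have : ∀ w : Space n, F (consVec a w) = 0 := fun w =>
        Set.indicator_of_notMem (fun h => ha (by
          have := h.1
          rwa [consVec_apply_zero] at this)) _
      simp [this]
    rw [← setLIntegral_eq_of_support_subset (s := Set.Ioi (0 : ℝ)) (μ := volume)
      (f := fun a : ℝ => ∫⁻ w : Space n, F (consVec a w))
      (fun a ha => by by_contra h; exact ha (hneg a h))]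
    have hval : ∀ a ∈ Set.Ioi (0 : ℝ), ∫⁻ w : Space n, F (consVec a w) =
        ∫⁻ v : Space n, G (gnomonic v : Space (n + 1)) *
          (Set.Ioo (0 : ℝ) (Real.sqrt (1 + ‖v‖ ^ 2))⁻¹).indicator
            (fun a => ENNReal.ofReal (a ^ n)) a := by
      intro a ha
      have ha' : (0 : ℝ) < a := ha
      have hsm : Measurable fun v : Space n => F (consVec a (a • v)) :=
        (hconsm a).comp (measurable_const_smul a)
      rw [lintegral_comp_smul_pos _ (hconsm a) ha', ← lintegral_const_mul _ hsm]
      refine lintegral_congr fun v => ?_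
      have hpos : (0 : ℝ) < Real.sqrt (1 + ‖v‖ ^ 2) := by positivity
      have hcv : consVec a (a • v) = a • consVec 1 v := by rw [consVec_smul, mul_one]
      have hn : ‖consVec a (a • v)‖ = a * Real.sqrt (1 + ‖v‖ ^ 2) := by
        rw [hcv, norm_smul, norm_consVec, Real.norm_eq_abs, abs_of_pos ha', one_pow]
      by_cases h1 : a < (Real.sqrt (1 + ‖v‖ ^ 2))⁻¹
      · have hmem : consVec a (a • v) ∈ S := by
          refine ⟨by rw [consVec_apply_zero]; exact ha', ?_⟩
          rw [hn]
          exact (lt_inv_mul_iff₀' hpos).1 (by simpa using h1)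
        rw [hF, Set.indicator_of_mem hmem, Set.indicator_of_mem (Set.mem_Ioo.2 ⟨ha', h1⟩), mul_comm, hn, hcv,
          gnomonic_coe, smul_smul]
        congr 3
        field_simp
      · have hmem : consVec a (a • v) ∉ S := by
          intro h
          have h2 := h.2
          rw [hn] at h2
          exact h1 (by simpa using (lt_inv_mul_iff₀' hpos).2 h2)
        rw [hF, Set.indicator_of_notMem hmem, Set.indicator_of_notMem (fun h => h1 h.2), mul_zero,
          mul_zero]
    rw [setLIntegral_congr_fun measurableSet_Ioi hval, lintegral_lintegral_swap]
    · rw [← lintegral_mul_const]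
      · refine lintegral_congr fun v => ?_
        have hpos : (0 : ℝ) < (Real.sqrt (1 + ‖v‖ ^ 2))⁻¹ := by positivity
        rw [lintegral_const_mul _ ((by fun_prop : Measurable fun r : ℝ =>
          ENNReal.ofReal (r ^ n)).indicator measurableSet_Ioo),
          setLIntegral_indicator measurableSet_Ioo,
          Set.inter_eq_self_of_subset_left Set.Ioo_subset_Ioi_self, lintegral_Ioo_pow n hpos,
          div_eq_mul_one_div, ENNReal.ofReal_mul (by positivity)]
        ring
      · exact (by fun_prop : Measurable fun v : Space n =>
          ENNReal.ofReal ((Real.sqrt (1 + ‖v‖ ^ 2))⁻¹ ^ (n + 1))).mul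
          (hG.comp (measurable_subtype_coe.comp measurable_gnomonic))
    · refine Measurable.aemeasurable ?_
      refine Measurable.mul (hG.comp (measurable_subtype_coe.comp
        (measurable_gnomonic.comp measurable_snd))) ?_
      have hset : MeasurableSet {p : ℝ × Space n | 0 < p.1 ∧ p.1 < (Real.sqrt (1 + ‖p.2‖ ^ 2))⁻¹} :=
        (measurableSet_lt (f := fun _ : ℝ × Space n => (0 : ℝ)) (g := fun p => p.1)
          measurable_const (by fun_prop)).inter
          (measurableSet_lt (f := fun p : ℝ × Space n => p.1)
            (g := fun p => (Real.sqrt (1 + ‖p.2‖ ^ 2))⁻¹) (by fun_prop) (by fun_prop))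
      exact (by fun_prop : Measurable fun p : ℝ × Space n =>
        ENNReal.ofReal (p.1 ^ n)).indicator hset
  have hne : ENNReal.ofReal (1 / ((n : ℝ) + 1)) ≠ 0 := by
    rw [Ne, ENNReal.ofReal_eq_zero, not_le]; positivity
  exact (ENNReal.mul_left_inj hne ENNReal.ofReal_ne_top).1 (hpolar.symm.trans hcart)

/-- In the gnomonic chart the surface measure has the density `(1 + |v|²)^(-(n+1)/2)`. -/
theorem restrict_upperHalf_eq_map {n : ℕ} :
    (sphereMeasure (n + 1)).restrict (upperHalf n) =
      Measure.map gnomonic ((volume : Measure (Space n)).withDensity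
        fun v => ENNReal.ofReal ((Real.sqrt (1 + ‖v‖ ^ 2))⁻¹ ^ (n + 1))) := by
  ext s hs
  obtain ⟨t, ht, rfl⟩ := hs
  have h := setLIntegral_upperHalf_coe (t.indicator 1) (measurable_one.indicator ht)
  have h2 : ∀ w : USphere (n + 1), t.indicator (1 : Space (n + 1) → ℝ≥0∞) (w : Space (n + 1)) =
      ((Subtype.val ⁻¹' t : Set (USphere (n + 1))).indicator 1) w := fun w => rfl
  simp only [h2] at h
  rw [lintegral_indicator_one (measurable_subtype_coe ht)] at h
  rw [h, ← lintegral_indicator_one (measurable_subtype_coe ht),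
    lintegral_map (measurable_one.indicator (measurable_subtype_coe ht)) measurable_gnomonic]
  exact (lintegral_withDensity_eq_lintegral_mul _ (by fun_prop)
    ((measurable_one.indicator (measurable_subtype_coe ht)).comp measurable_gnomonic)).symm

theorem setLIntegral_upperHalf {n : ℕ} (g : USphere (n + 1) → ℝ≥0∞) (hg : Measurable g) :
    ∫⁻ w in upperHalf n, g w ∂(sphereMeasure (n + 1)) =
      ∫⁻ v : Space n, ENNReal.ofReal ((Real.sqrt (1 + ‖v‖ ^ 2))⁻¹ ^ (n + 1)) * g (gnomonic v) := by
  rw [restrict_upperHalf_eq_map, lintegral_map hg measurable_gnomonic]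
  exact lintegral_withDensity_eq_lintegral_mul _ (by fun_prop) (hg.comp measurable_gnomonic)

theorem setIntegral_upperHalf {n : ℕ} (g : USphere (n + 1) → ℂ) (hg : Measurable g) :
    ∫ w in upperHalf n, g w ∂(sphereMeasure (n + 1)) =
      ∫ v : Space n, (((Real.sqrt (1 + ‖v‖ ^ 2))⁻¹ ^ (n + 1) : ℝ) : ℂ) * g (gnomonic v) := by
  rw [restrict_upperHalf_eq_map,
    integral_map measurable_gnomonic.aemeasurable hg.aestronglyMeasurable,
    integral_withDensity_eq_integral_toReal_smul (by fun_prop)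
      (Filter.Eventually.of_forall fun _ => ENNReal.ofReal_lt_top)]
  refine integral_congr_ae (Filter.Eventually.of_forall fun v => ?_)
  simp only
  rw [ENNReal.toReal_ofReal (by positivity), Complex.real_smul]

/-! ### Integrals of zonal functions -/

/-- Invariance under the reflection that maps `θ` to `η`. -/
theorem lintegral_comp_inner_eq {m : ℕ} (θ η : Space m) (h : ‖θ‖ = ‖η‖) (Φ : ℝ → ℝ → ℝ≥0∞) :
    ∫⁻ x : Space m, Φ (inner ℝ θ x) ‖x‖ = ∫⁻ x : Space m, Φ (inner ℝ η x) ‖x‖ := by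
  set L : Space m ≃ₗᵢ[ℝ] Space m := (ℝ ∙ (θ - η))ᗮ.reflection with hL
  have hLθ : L θ = η := Submodule.reflection_sub h
  rw [← L.measurePreserving.lintegral_comp_emb L.toHomeomorph.measurableEmbedding
    (fun x => Φ (inner ℝ η x) ‖x‖)]
  refine lintegral_congr fun x => ?_
  rw [L.norm_map, ← hLθ, L.inner_map_map]

/-- Up to the factor `K = 1 / (k + 2)`, both sides are the integral of `x ↦ g (⟪θ, x⟫ / |x|)` over the
unit ball: in polar coordinates, and, with `θ` moved to the first coordinate vector, in the
cylindrical coordinates `x = (a, s η)`, followed by polar coordinates for `(a, s)`. -/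
theorem lintegral_zonal {k : ℕ} (θ : USphere (k + 2)) (g : ℝ → ℝ≥0∞) (hg : Measurable g) :
    ∫⁻ w, g (inner ℝ (θ : Space (k + 2)) (w : Space (k + 2))) ∂(sphereMeasure (k + 2)) =
      sphereMeasure (k + 1) Set.univ *
        ∫⁻ φ in Set.Ioo (0 : ℝ) Real.pi,
          ENNReal.ofReal (Real.sin φ ^ k) * g (Real.cos φ) := by
  set Φ : ℝ → ℝ → ℝ≥0∞ := fun a r => (Set.Iio (1 : ℝ)).indicator (fun r => g (a / r)) r with hΦ
  have hΦm : Measurable fun p : ℝ × ℝ => Φ p.1 p.2 := by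
    have : (fun p : ℝ × ℝ => Φ p.1 p.2) =
        (Prod.snd ⁻¹' (Set.Iio (1 : ℝ))).indicator fun p : ℝ × ℝ => g (p.1 / p.2) := by
      ext p; rfl
    rw [this]
    exact (hg.comp (measurable_fst.div measurable_snd)).indicator (measurable_snd measurableSet_Iio)
  set K : ℝ≥0∞ := ENNReal.ofReal (1 / (((k + 1 : ℕ) : ℝ) + 1)) with hK
  have hgm : Measurable fun w : USphere (k + 2) =>
      g (inner ℝ (θ : Space (k + 2)) (w : Space (k + 2))) := hg.comp (by fun_prop)
  have hpolar : ∫⁻ x : Space (k + 2), Φ (inner ℝ (θ : Space (k + 2)) x) ‖x‖ =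
      (∫⁻ w, g (inner ℝ (θ : Space (k + 2)) (w : Space (k + 2))) ∂(sphereMeasure (k + 2))) * K := by
    rw [lintegral_polar (n := k + 1) (fun x => Φ (inner ℝ (θ : Space (k + 2)) x) ‖x‖)
      (hΦm.comp (by fun_prop : Measurable fun x : Space (k + 2) =>
        (inner ℝ (θ : Space (k + 2)) x, ‖x‖))), ← lintegral_mul_const _ hgm]
    refine lintegral_congr fun w => ?_
    have h1 : ∀ r ∈ Set.Ioi (0 : ℝ), ENNReal.ofReal (r ^ (k + 1)) *
        Φ (inner ℝ (θ : Space (k + 2)) (r • (w : Space (k + 2)))) ‖r • (w : Space (k + 2))‖ =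
        g (inner ℝ (θ : Space (k + 2)) (w : Space (k + 2))) *
          (Set.Iio (1 : ℝ)).indicator (fun r => ENNReal.ofReal (r ^ (k + 1))) r := by
      intro r hr
      have hr' : (0 : ℝ) < r := hr
      rw [norm_smul, norm_usphere, mul_one, Real.norm_eq_abs, abs_of_pos hr', inner_smul_right]
      by_cases h1 : r < 1
      · rw [hΦ, Set.indicator_of_mem (Set.mem_Iio.2 h1)]
        simp only [Set.indicator_of_mem (Set.mem_Iio.2 h1)]
        rw [mul_div_cancel_left₀ _ hr'.ne', mul_comm]
      · rw [hΦ, Set.indicator_of_notMem (fun h => h1 (Set.mem_Iio.1 h))]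
        simp only [Set.indicator_of_notMem (fun h => h1 (Set.mem_Iio.1 h)), mul_zero]
    rw [setLIntegral_congr_fun measurableSet_Ioi h1, lintegral_const_mul _
      ((by fun_prop : Measurable fun r : ℝ => ENNReal.ofReal (r ^ (k + 1))).indicator
        measurableSet_Iio), setLIntegral_indicator measurableSet_Iio, Set.inter_comm,
      Set.Ioi_inter_Iio, lintegral_Ioo_pow (k + 1) one_pos, one_pow]
  set e : Space (k + 2) := consVec 1 0 with he
  have hnorm : ‖(θ : Space (k + 2))‖ = ‖e‖ := by
    rw [norm_usphere, he, norm_consVec]; simp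
  have hcart : ∫⁻ x : Space (k + 2), Φ (inner ℝ (θ : Space (k + 2)) x) ‖x‖ =
      (sphereMeasure (k + 1) Set.univ *
        ∫⁻ φ in Set.Ioo (0 : ℝ) Real.pi,
          ENNReal.ofReal (Real.sin φ ^ k) * g (Real.cos φ)) * K := by
    rw [lintegral_comp_inner_eq _ e hnorm,
      lintegral_consVec (n := k + 1) (fun x => Φ (inner ℝ e x) ‖x‖) (hΦm.comp (by fun_prop :
        Measurable fun x : Space (k + 2) => (inner ℝ e x, ‖x‖)))]
    have h1 : ∀ a : ℝ, ∫⁻ w : Space (k + 1), Φ (inner ℝ e (consVec a w)) ‖consVec a w‖ =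
        sphereMeasure (k + 1) Set.univ * ∫⁻ s : ℝ, (Set.Ioi (0 : ℝ)).indicator
          (fun s => ENNReal.ofReal (s ^ k) * Φ a (Real.sqrt (a ^ 2 + s ^ 2))) s := by
      intro a
      have h2 : ∀ w : Space (k + 1), Φ (inner ℝ e (consVec a w)) ‖consVec a w‖ =
          Φ a (Real.sqrt (a ^ 2 + ‖w‖ ^ 2)) := by
        intro w
        rw [he, inner_consVec, norm_consVec, inner_zero_left, add_zero, one_mul]
      simp only [h2]
      rw [lintegral_polar (fun w : Space (k + 1) => Φ a (Real.sqrt (a ^ 2 + ‖w‖ ^ 2)))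
        (hΦm.comp (by fun_prop : Measurable fun w : Space (k + 1) =>
          (a, Real.sqrt (a ^ 2 + ‖w‖ ^ 2))))]
      simp only [norm_smul, norm_usphere, mul_one, Real.norm_eq_abs, sq_abs]
      rw [lintegral_const, mul_comm, lintegral_indicator measurableSet_Ioi]
    simp only [h1]
    have hm2 : Measurable fun p : ℝ × ℝ => (Set.Ioi (0 : ℝ)).indicator
        (fun s => ENNReal.ofReal (s ^ k) * Φ p.1 (Real.sqrt (p.1 ^ 2 + s ^ 2))) p.2 := by
      have : (fun p : ℝ × ℝ => (Set.Ioi (0 : ℝ)).indicator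
        (fun s => ENNReal.ofReal (s ^ k) * Φ p.1 (Real.sqrt (p.1 ^ 2 + s ^ 2))) p.2) =
          (Prod.snd ⁻¹' (Set.Ioi (0 : ℝ))).indicator fun p : ℝ × ℝ =>
            ENNReal.ofReal (p.2 ^ k) * Φ p.1 (Real.sqrt (p.1 ^ 2 + p.2 ^ 2)) := by
        ext p; rfl
      rw [this]
      refine Measurable.indicator (Measurable.mul (by fun_prop) ?_)
        (measurable_snd measurableSet_Ioi)
      exact hΦm.comp (by fun_prop : Measurable fun p : ℝ × ℝ =>
        (p.1, Real.sqrt (p.1 ^ 2 + p.2 ^ 2)))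
    rw [lintegral_const_mul _ hm2.lintegral_prod_right', mul_assoc]
    congr 1
    -- polar coordinates `a = r cos φ`, `s = r sin φ` in the half plane `s > 0`
    rw [← lintegral_prod _ hm2.aemeasurable, ← Measure.volume_eq_prod,
      ← lintegral_comp_polarCoord_symm]
    have htarget : polarCoord.target = Set.Ioi (0 : ℝ) ×ˢ Set.Ioo (-Real.pi) Real.pi := rfl
    have hpt : ∀ p ∈ polarCoord.target, ENNReal.ofReal p.1 •
        (Set.Ioi (0 : ℝ)).indicator (fun s => ENNReal.ofReal (s ^ k) *
          Φ (polarCoord.symm p).1 (Real.sqrt ((polarCoord.symm p).1 ^ 2 + s ^ 2)))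
            (polarCoord.symm p).2 =
        (Set.Iio (1 : ℝ)).indicator (fun r => ENNReal.ofReal (r ^ (k + 1))) p.1 *
          (Set.Ioo (0 : ℝ) Real.pi).indicator
            (fun φ => ENNReal.ofReal (Real.sin φ ^ k) * g (Real.cos φ)) p.2 := by
      rintro ⟨r, φ⟩ hp
      rw [htarget] at hp
      have hr : (0 : ℝ) < r := hp.1
      have hφ1 : -Real.pi < φ := hp.2.1
      have hφ2 : φ < Real.pi := hp.2.2
      simp only [polarCoord_symm_apply]
      by_cases hφ : 0 < φ
      · have hsin := Real.sin_pos_of_pos_of_lt_pi hφ hφ2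
        rw [Set.indicator_of_mem (Set.mem_Ioi.2 (mul_pos hr hsin)),
          Set.indicator_of_mem (Set.mem_Ioo.2 ⟨hφ, hφ2⟩)]
        have hsq : Real.sqrt ((r * Real.cos φ) ^ 2 + (r * Real.sin φ) ^ 2) = r := by
          rw [mul_pow, mul_pow, ← mul_add, Real.cos_sq_add_sin_sq, mul_one, Real.sqrt_sq hr.le]
        rw [hsq, mul_pow, ENNReal.ofReal_mul (by positivity)]
        by_cases h1 : r < 1
        · rw [hΦ, Set.indicator_of_mem (Set.mem_Iio.2 h1)]
          simp only [Set.indicator_of_mem (Set.mem_Iio.2 h1)]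
          rw [mul_div_cancel_left₀ _ hr.ne', pow_succ', ENNReal.ofReal_mul hr.le, smul_eq_mul]
          ring
        · rw [hΦ, Set.indicator_of_notMem (fun h => h1 (Set.mem_Iio.1 h))]
          simp only [Set.indicator_of_notMem (fun h => h1 (Set.mem_Iio.1 h)), mul_zero, smul_zero,
            zero_mul]
      · have hsin := Real.sin_nonpos_of_nonpos_of_neg_pi_le (not_lt.1 hφ) hφ1.le
        rw [Set.indicator_of_notMem (fun h => absurd (Set.mem_Ioi.1 h)
            (not_lt.2 (mul_nonpos_of_nonneg_of_nonpos hr.le hsin))),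
          Set.indicator_of_notMem (fun h => hφ (Set.mem_Ioo.1 h).1), smul_zero, mul_zero]
    have hgφ : Measurable fun φ : ℝ => ENNReal.ofReal (Real.sin φ ^ k) * g (Real.cos φ) :=
      (by fun_prop : Measurable fun φ : ℝ => ENNReal.ofReal (Real.sin φ ^ k)).mul
        (hg.comp Real.measurable_cos)
    rw [setLIntegral_congr_fun polarCoord.open_target.measurableSet hpt, htarget,
      Measure.volume_eq_prod, ← Measure.prod_restrict, lintegral_prod_mul
        ((by fun_prop : Measurable fun r : ℝ => ENNReal.ofReal (r ^ (k + 1))).indicator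
          measurableSet_Iio).aemeasurable
        (hgφ.indicator measurableSet_Ioo).aemeasurable,
      setLIntegral_indicator measurableSet_Iio, Set.inter_comm,
      Set.Ioi_inter_Iio, lintegral_Ioo_pow (k + 1) one_pos, one_pow,
      setLIntegral_indicator measurableSet_Ioo, Set.inter_eq_self_of_subset_left
        (Set.Ioo_subset_Ioo_left (by linarith [Real.pi_pos])), mul_comm]
  have hne : K ≠ 0 := by
    rw [hK, Ne, ENNReal.ofReal_eq_zero, not_le]; positivity
  exact (ENNReal.mul_left_inj hne ENNReal.ofReal_ne_top).1 (hpolar.symm.trans hcart)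

theorem sphereMeasure_univ_pos (k : ℕ) : 0 < (sphereMeasure (k + 1)).real Set.univ := by
  rw [sphereMeasure, Measure.toSphere_real_apply_univ]
  have : 0 < (volume : Measure (Space (k + 1))).real (Metric.ball 0 1) :=
    ENNReal.toReal_pos (Metric.measure_ball_pos _ _ one_pos).ne' measure_ball_lt_top.ne
  simp only [finrank_euclideanSpace_fin]
  positivity

instance (d : ℕ) : IsFiniteMeasure (sphereMeasure d) := by
  unfold sphereMeasure; infer_instance

/-- The version of `lintegral_zonal` for complex functions: the two sides are integrals with respect
to the same measure on `[-1, 1]`. -/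
theorem integral_zonal {k : ℕ} (θ : USphere (k + 2)) (g : ℝ → ℂ) (hg : Measurable g) :
    ∫ w, g (inner ℝ (θ : Space (k + 2)) (w : Space (k + 2))) ∂(sphereMeasure (k + 2)) =
      ((sphereMeasure (k + 1)).real Set.univ : ℂ) *
        ∫ φ in Set.Ioo (0 : ℝ) Real.pi, ((Real.sin φ ^ k : ℝ) : ℂ) * g (Real.cos φ) := by
  have hin : Measurable fun w : USphere (k + 2) =>
    inner ℝ (θ : Space (k + 2)) (w : Space (k + 2)) := by fun_prop
  have hsin : Measurable fun φ : ℝ => ENNReal.ofReal (Real.sin φ ^ k) := by fun_prop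
  have hmap : Measure.map (fun w : USphere (k + 2) =>
      inner ℝ (θ : Space (k + 2)) (w : Space (k + 2))) (sphereMeasure (k + 2)) =
      sphereMeasure (k + 1) Set.univ • Measure.map Real.cos
        ((volume.restrict (Set.Ioo (0 : ℝ) Real.pi)).withDensity
          fun φ => ENNReal.ofReal (Real.sin φ ^ k)) := by
    refine Measure.ext_of_lintegral _ fun f hf => ?_
    rw [lintegral_map hf hin, lintegral_zonal θ f hf, lintegral_smul_measure,
      lintegral_map hf (by fun_prop), smul_eq_mul]
    congr 1
    exact (lintegral_withDensity_eq_lintegral_mul _ hsin (hf.comp Real.measurable_cos)).symm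
  rw [← integral_map hin.aemeasurable hg.aestronglyMeasurable, hmap, integral_smul_measure,
    integral_map (by fun_prop) hg.aestronglyMeasurable,
    integral_withDensity_eq_integral_toReal_smul hsin
      (Filter.Eventually.of_forall fun _ => ENNReal.ofReal_lt_top), Complex.real_smul]
  congr 1
  refine setIntegral_congr_fun measurableSet_Ioo fun φ hφ => ?_
  have := Real.sin_pos_of_pos_of_lt_pi hφ.1 hφ.2
  rw [ENNReal.toReal_ofReal (by positivity), Complex.real_smul]

/-! ### The size of the Harish-Chandra function -/

theorem norm_Gamma_half_sq (t : ℝ) :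
    ‖Complex.Gamma (1 / 2 + Complex.I * t)‖ ^ 2 = Real.pi / Real.cosh (Real.pi * t) := by
  have h := Complex.Gamma_mul_Gamma_one_sub (1 / 2 + Complex.I * t)
  have h1 : (1 : ℂ) - (1 / 2 + Complex.I * t) = (starRingEnd ℂ) (1 / 2 + Complex.I * t) := by
    simp only [map_add, map_mul, Complex.conj_I, Complex.conj_ofReal, map_div₀, map_one, map_ofNat]
    ring
  have h2 : Complex.sin (Real.pi * (1 / 2 + Complex.I * t)) = (Real.cosh (Real.pi * t) : ℂ) := by
    rw [show (Real.pi : ℂ) * (1 / 2 + Complex.I * t) = (Real.pi * t : ℂ) * Complex.I + Real.pi / 2 by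
      ring, Complex.sin_add_pi_div_two, Complex.cos_mul_I]
    push_cast
    rfl
  rw [h1, Complex.Gamma_conj, Complex.mul_conj, h2] at h
  rw [← Complex.normSq_eq_norm_sq]
  exact_mod_cast h

theorem norm_Gamma_I_mul_sq {t : ℝ} (ht : 0 < t) :
    t * ‖Complex.Gamma (Complex.I * t)‖ ^ 2 = Real.pi / Real.sinh (Real.pi * t) := by
  have h := Complex.Gamma_mul_Gamma_one_sub (Complex.I * t)
  have hne : -(Complex.I * t) ≠ 0 := by simp [ht.ne']
  have h1 : (1 : ℂ) - Complex.I * t = -(Complex.I * t) + 1 := by ring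
  have h3 : -(Complex.I * t) = (starRingEnd ℂ) (Complex.I * t) := by simp
  have h2 : Complex.sin (Real.pi * (Complex.I * t)) = (Real.sinh (Real.pi * t) : ℂ) * Complex.I := by
    rw [show (Real.pi : ℂ) * (Complex.I * t) = (Real.pi * t : ℂ) * Complex.I by ring,
      Complex.sin_mul_I]
    push_cast
    rfl
  rw [h1, Complex.Gamma_add_one _ hne, h3, Complex.Gamma_conj, ← h3, h2] at h
  have hsinh : Real.sinh (Real.pi * t) ≠ 0 :=
    (Real.sinh_pos_iff.2 (mul_pos Real.pi_pos ht)).ne'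
  have h4 := congrArg norm h
  simp only [norm_mul, norm_neg, Complex.norm_I, one_mul, norm_div, mul_one, RCLike.norm_conj,
    Complex.norm_real, Real.norm_eq_abs, abs_of_pos ht, abs_of_pos Real.pi_pos,
    abs_of_pos (Real.sinh_pos_iff.2 (mul_pos Real.pi_pos ht))] at h4
  rw [← h4]; ring

theorem Gamma_I_mul_ne_zero {t : ℝ} (ht : 0 < t) : Complex.Gamma (Complex.I * t) ≠ 0 := by
  refine Complex.Gamma_ne_zero fun m h => ?_
  have := congrArg Complex.im h
  simp [ht.ne'] at this

/-- `|Γ(ρ + it)|` is comparable to `t^ρ |Γ(it)|`. By the recurrence of the Gamma function it suffices to know the ratio at `n = 0` and `n = 1`,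
and the latter is given by the reflection formula. -/
theorem exists_Gamma_ratio_bounds (n : ℕ) : ∃ a b : ℝ, 0 < a ∧ 0 < b ∧ ∀ t : ℝ, 1 ≤ t →
    a * t ^ ((n : ℝ) / 2) * ‖Complex.Gamma (Complex.I * t)‖ ≤
      ‖Complex.Gamma ((n : ℂ) / 2 + Complex.I * t)‖ ∧
    ‖Complex.Gamma ((n : ℂ) / 2 + Complex.I * t)‖ ≤
      b * t ^ ((n : ℝ) / 2) * ‖Complex.Gamma (Complex.I * t)‖ := by
  induction n using Nat.twoStepInduction with
  | zero => exact ⟨1, 1, one_pos, one_pos, fun t _ => by simp⟩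
  | one =>
    refine ⟨1 / 2, 1, by norm_num, one_pos, fun t ht => ?_⟩
    have ht0 : 0 < t := by linarith
    have h1 := norm_Gamma_half_sq t
    have h2 := norm_Gamma_I_mul_sq ht0
    have hx : 3 ≤ Real.pi * t := by nlinarith [Real.pi_gt_three]
    have hs : 0 < Real.sinh (Real.pi * t) := Real.sinh_pos_iff.2 (by linarith)
    have hc : 0 < Real.cosh (Real.pi * t) := Real.cosh_pos _
    have hsc : Real.sinh (Real.pi * t) ≤ Real.cosh (Real.pi * t) := (Real.sinh_lt_cosh _).le
    -- this uses `π t ≥ 3`, that is, the assumption `1 ≤ t`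
    have hcs : Real.cosh (Real.pi * t) ≤ 2 * Real.sinh (Real.pi * t) := by
      rw [Real.cosh_eq, Real.sinh_eq]
      have e1 := Real.add_one_le_exp (Real.pi * t)
      have e2 : Real.exp (-(Real.pi * t)) ≤ 1 := Real.exp_le_one_iff.2 (by linarith)
      linarith
    have hpow : (t ^ (((1 : ℕ) : ℝ) / 2)) ^ 2 = t := by
      rw [← Real.rpow_natCast, ← Real.rpow_mul ht0.le]; norm_num
    have hpow0 : 0 ≤ t ^ (((1 : ℕ) : ℝ) / 2) := Real.rpow_nonneg ht0.le _
    have hcast : (((1 : ℕ) : ℂ) / 2 + Complex.I * t) = 1 / 2 + Complex.I * t := by simp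
    rw [hcast]
    have e : ‖Complex.Gamma (Complex.I * t)‖ ^ 2 * t * Real.sinh (Real.pi * t) = Real.pi := by
      rw [eq_div_iff hs.ne'] at h2; linarith
    have e' : ‖Complex.Gamma (1 / 2 + Complex.I * t)‖ ^ 2 * Real.cosh (Real.pi * t) = Real.pi := by
      rwa [eq_div_iff hc.ne'] at h1
    constructor
    · refine le_of_sq_le_sq ?_ (norm_nonneg _)
      rw [mul_pow, mul_pow, hpow]
      refine le_of_mul_le_mul_right ?_ hc
      rw [e']
      refine le_trans ?_ e.le
      nlinarith [mul_nonneg (sq_nonneg ‖Complex.Gamma (Complex.I * t)‖) ht0.le]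
    · refine le_of_sq_le_sq ?_ (by positivity)
      rw [mul_pow, mul_pow, hpow]
      refine le_of_mul_le_mul_right ?_ hs
      have : ‖Complex.Gamma (1 / 2 + Complex.I * t)‖ ^ 2 * Real.sinh (Real.pi * t) ≤ Real.pi := by
        refine le_trans ?_ e'.le
        gcongr
      linarith
  | more n ih _ =>
    obtain ⟨a, b, ha, hb, h⟩ := ih
    refine ⟨a, ((n : ℝ) / 2 + 1) * b, ha, by positivity, fun t ht => ?_⟩
    have ht0 : 0 < t := by linarith
    obtain ⟨h1, h2⟩ := h t ht
    have hne : (n : ℂ) / 2 + Complex.I * t ≠ 0 := by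
      intro h0
      have := congrArg Complex.im h0
      simp [ht0.ne'] at this
    have hrec : Complex.Gamma (((n + 2 : ℕ) : ℂ) / 2 + Complex.I * t) =
        ((n : ℂ) / 2 + Complex.I * t) * Complex.Gamma ((n : ℂ) / 2 + Complex.I * t) := by
      rw [← Complex.Gamma_add_one _ hne]
      congr 1
      push_cast
      ring
    have hp : t ^ (((n + 2 : ℕ) : ℝ) / 2) = t * t ^ ((n : ℝ) / 2) := by
      rw [show (((n + 2 : ℕ) : ℝ) / 2) = 1 + (n : ℝ) / 2 by push_cast; ring, Real.rpow_add ht0,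
        Real.rpow_one]
    have hlow : t ≤ ‖(n : ℂ) / 2 + Complex.I * t‖ := by
      have := Complex.abs_im_le_norm ((n : ℂ) / 2 + Complex.I * t)
      simpa [abs_of_pos ht0] using this
    have hup : ‖(n : ℂ) / 2 + Complex.I * t‖ ≤ ((n : ℝ) / 2 + 1) * t := by
      have h3 := norm_add_le ((n : ℂ) / 2) (Complex.I * t)
      simp only [norm_div, norm_mul, Complex.norm_I, Complex.norm_real, Complex.norm_natCast,
        Real.norm_eq_abs, abs_of_pos ht0, one_mul, Complex.norm_ofNat] at h3
      have : (0 : ℝ) ≤ n := n.cast_nonneg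
      nlinarith
    rw [hrec, hp, norm_mul]
    constructor
    · calc a * (t * t ^ ((n : ℝ) / 2)) * ‖Complex.Gamma (Complex.I * t)‖
          = t * (a * t ^ ((n : ℝ) / 2) * ‖Complex.Gamma (Complex.I * t)‖) := by ring
        _ ≤ _ := mul_le_mul hlow h1 (by positivity) (norm_nonneg _)
    · calc _ ≤ (((n : ℝ) / 2 + 1) * t) * (b * t ^ ((n : ℝ) / 2) * ‖Complex.Gamma (Complex.I * t)‖) :=
          mul_le_mul hup h2 (norm_nonneg _) (by positivity)
        _ = _ := by ring

theorem rho_succ (n : ℕ) : rho (n + 1) = (n : ℝ) / 2 := by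
  simp [rho]

/-- The positive constant in the definition of the Harish-Chandra function. -/
noncomputable def harishChandraConst (d : ℕ) : ℝ :=
  (2 : ℝ) ^ (2 * rho d - 1) * Real.Gamma (rho d + 1 / 2) / Real.sqrt Real.pi

theorem harishChandraConst_pos (n : ℕ) : 0 < harishChandraConst (n + 1) := by
  unfold harishChandraConst
  rw [rho_succ]
  have : 0 < Real.Gamma ((n : ℝ) / 2 + 1 / 2) := Real.Gamma_pos_of_pos (by positivity)
  have := Real.sqrt_pos.2 Real.pi_pos
  positivity

theorem Gamma_rho_ne_zero (n : ℕ) {t : ℝ} (ht : 0 < t) :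
    Complex.Gamma ((n : ℂ) / 2 + Complex.I * t) ≠ 0 := by
  refine Complex.Gamma_ne_zero fun m h => ?_
  have := congrArg Complex.im h
  simp [ht.ne'] at this

theorem norm_harishChandra (n : ℕ) (t : ℝ) :
    ‖harishChandra (n + 1) t‖ = harishChandraConst (n + 1) *
      (‖Complex.Gamma (Complex.I * t)‖ / ‖Complex.Gamma ((n : ℂ) / 2 + Complex.I * t)‖) := by
  have h := harishChandraConst_pos n
  have h1 : harishChandra (n + 1) t = (harishChandraConst (n + 1) : ℂ) *
      (Complex.Gamma (Complex.I * t) / Complex.Gamma ((n : ℂ) / 2 + Complex.I * t)) := by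
    rw [harishChandra, harishChandraConst, rho_succ]
    push_cast
    rfl
  rw [h1, norm_mul, Complex.norm_real, norm_div, Real.norm_eq_abs, abs_of_pos h]

theorem norm_harishChandra_pos (n : ℕ) {t : ℝ} (ht : 0 < t) : 0 < ‖harishChandra (n + 1) t‖ := by
  rw [norm_harishChandra]
  have := harishChandraConst_pos n
  have := norm_pos_iff.2 (Gamma_I_mul_ne_zero ht)
  have := norm_pos_iff.2 (Gamma_rho_ne_zero n ht)
  positivity

theorem exists_harishChandra_bounds (n : ℕ) : ∃ a b : ℝ, 0 < a ∧ 0 < b ∧ ∀ t : ℝ, 1 ≤ t →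
    a * t ^ ((n : ℝ) / 2) ≤ ‖harishChandra (n + 1) t‖⁻¹ ∧
      ‖harishChandra (n + 1) t‖⁻¹ ≤ b * t ^ ((n : ℝ) / 2) := by
  obtain ⟨a, b, ha, hb, h⟩ := exists_Gamma_ratio_bounds n
  have hK := harishChandraConst_pos n
  refine ⟨(harishChandraConst (n + 1))⁻¹ * a, (harishChandraConst (n + 1))⁻¹ * b,
    by positivity, by positivity, fun t ht => ?_⟩
  have hG := norm_pos_iff.2 (Gamma_I_mul_ne_zero (by linarith : (0 : ℝ) < t))
  obtain ⟨h1, h2⟩ := h t ht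
  rw [norm_harishChandra, mul_inv, inv_div, mul_assoc, mul_assoc]
  exact ⟨mul_le_mul_of_nonneg_left ((le_div_iff₀ hG).2 h1) (by positivity),
    mul_le_mul_of_nonneg_left ((div_le_iff₀ hG).2 h2) (by positivity)⟩

/-! ### The extension operator and its norm -/

theorem toHyperboloid_snd (d : ℕ) (x : hyperboloid d) : toHyperboloid d (x : Minkowski d).2 = x := by
  obtain ⟨⟨a, y⟩, h1, h2⟩ := x
  have h3 : ∑ i : Fin d, y i * y i = ‖y‖ ^ 2 := by
    rw [EuclideanSpace.real_norm_sq_eq]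
    exact Finset.sum_congr rfl fun i _ => (pow_two _).symm
  simp only [mink, h3] at h1
  refine Subtype.ext (Prod.ext ?_ rfl)
  change Real.sqrt (1 + ‖y‖ ^ 2) = a
  rw [show 1 + ‖y‖ ^ 2 = a ^ 2 by linarith, Real.sqrt_sq h2.le]

theorem mink_toHyperboloid {d : ℕ} (y : Space d) (w : USphere d) :
    mink (toHyperboloid d y : Minkowski d) (lightRay w) =
      Real.sqrt (1 + ‖y‖ ^ 2) - inner ℝ y (w : Space d) := by
  simp only [mink, toHyperboloid, param, lightRay]
  rw [PiLp.inner_apply, mul_one]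
  congr 1
  exact Finset.sum_congr rfl fun i _ => by simp [mul_comm]

theorem norm_lt_sqrt_one_add_sq (t : ℝ) : t < Real.sqrt (1 + t ^ 2) :=
  (le_abs_self t).trans_lt (by rw [← Real.sqrt_sq_eq_abs]; exact Real.sqrt_lt_sqrt (by positivity) (by linarith))

theorem abs_inner_usphere_le {d : ℕ} (y : Space d) (w : USphere d) :
    |inner ℝ y (w : Space d)| ≤ ‖y‖ := by
  have := abs_real_inner_le_norm y (w : Space d)
  rwa [norm_usphere, mul_one] at this

theorem mink_lightRay_pos {d : ℕ} (x : hyperboloid d) (w : USphere d) :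
    0 < mink (x : Minkowski d) (lightRay w) := by
  rw [← toHyperboloid_snd d x, mink_toHyperboloid]
  have h1 := norm_lt_sqrt_one_add_sq ‖(x : Minkowski d).2‖
  have h2 := (abs_le.1 (abs_inner_usphere_le (x : Minkowski d).2 w)).2
  linarith

/-- The complex conjugate of the plane wave, `[x, b(ω)]^(-ρ - iλ)`. -/
theorem conj_planeWave {d : ℕ} (lam : ℝ) (w : USphere d) (x : hyperboloid d) :
    (starRingEnd ℂ) (planeWave d lam w x) =
      Complex.exp (-((rho d : ℂ) + Complex.I * lam) *
        (Real.log (mink (x : Minkowski d) (lightRay w)) : ℝ)) := by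
  have h := mink_lightRay_pos x w
  rw [planeWave, Complex.cpow_def_of_ne_zero (by exact_mod_cast h.ne'), ← Complex.ofReal_log h.le,
    ← Complex.exp_conj]
  congr 1
  simp only [map_mul, map_sub, Complex.conj_I, Complex.conj_ofReal]
  ring

theorem measurable_mink_lightRay (d : ℕ) : Measurable fun p : hyperboloid d × USphere d =>
    mink (p.1 : Minkowski d) (lightRay p.2) := by
  unfold mink lightRay
  fun_prop

theorem measurable_conj_planeWave (d : ℕ) (lam : ℝ) :
    Measurable fun p : hyperboloid d × USphere d => (starRingEnd ℂ) (planeWave d lam p.2 p.1) := by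
  simp only [conj_planeWave]
  have := measurable_mink_lightRay d
  fun_prop

theorem measurable_extension (d : ℕ) (lam : ℝ) (f : USphere d → ℂ) (hf : Measurable f) :
    Measurable (extension d lam f) := by
  unfold extension
  refine Measurable.const_mul ?_ _
  have h : StronglyMeasurable fun p : hyperboloid d × USphere d =>
      f p.2 * (starRingEnd ℂ) (planeWave d lam p.2 p.1) :=
    ((hf.comp measurable_snd).mul (measurable_conj_planeWave d lam)).stronglyMeasurable
  exact h.integral_prod_right'.measurable

theorem extension_const_smul (d : ℕ) (lam : ℝ) (f : USphere d → ℂ) (a : ℂ) :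
    extension d lam (a • f) = a • extension d lam f := by
  ext x
  simp only [extension, Pi.smul_apply, smul_eq_mul, mul_assoc]
  rw [integral_const_mul]
  ring

/-- The norm of `E_λ`, a supremum over the unit ball, bounds `E_λ f` for all `f`. -/
theorem eLpNorm_extension_le (d : ℕ) (lam : ℝ) (p q : ℝ≥0∞) (f : USphere d → ℂ)
    (hf : MemLp f p (sphereMeasure d)) {N : ℝ} (hN : 0 < N)
    (hfN : eLpNorm f p (sphereMeasure d) ≤ ENNReal.ofReal N) :
    eLpNorm (extension d lam f) q (hypMeasure d) ≤ ENNReal.ofReal N * extensionNorm d lam p q := by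
  have hNn : ‖((N⁻¹ : ℝ) : ℂ)‖ₑ = ENNReal.ofReal N⁻¹ := by
    rw [← ofReal_norm, Complex.norm_real, Real.norm_eq_abs, abs_of_pos (inv_pos.2 hN)]
  have h1 : eLpNorm (((N⁻¹ : ℝ) : ℂ) • f) p (sphereMeasure d) ≤ 1 := by
    rw [eLpNorm_const_smul, hNn]
    calc _ ≤ ENNReal.ofReal N⁻¹ * ENNReal.ofReal N := by gcongr
      _ = 1 := by rw [← ENNReal.ofReal_mul (inv_pos.2 hN).le, inv_mul_cancel₀ hN.ne', ENNReal.ofReal_one]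
  have h2 : eLpNorm (extension d lam (((N⁻¹ : ℝ) : ℂ) • f)) q (hypMeasure d) ≤
      extensionNorm d lam p q :=
    le_iSup_of_le (((N⁻¹ : ℝ) : ℂ) • f) (le_iSup_of_le (hf.const_smul _) (le_iSup_of_le h1 le_rfl))
  rw [extension_const_smul, eLpNorm_const_smul, hNn] at h2
  calc eLpNorm (extension d lam f) q (hypMeasure d)
      = ENNReal.ofReal N * (ENNReal.ofReal N⁻¹ * eLpNorm (extension d lam f) q (hypMeasure d)) := by
        rw [← mul_assoc, ← ENNReal.ofReal_mul hN.le, mul_inv_cancel₀ hN.ne', ENNReal.ofReal_one, one_mul]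
    _ ≤ _ := by gcongr

/-- The modulus of `E_λ f`, with the conjugate plane wave written as an exponential. -/
theorem norm_extension (n : ℕ) (lam : ℝ) (f : USphere (n + 1) → ℂ) (x : hyperboloid (n + 1)) :
    ‖extension (n + 1) lam f x‖ = ‖harishChandra (n + 1) lam‖⁻¹ *
      ((sphereMeasure (n + 1)).real Set.univ)⁻¹ *
        ‖∫ w, f w * Complex.exp (-((n : ℂ) / 2 + Complex.I * lam) *
          (Real.log (mink (x : Minkowski (n + 1)) (lightRay w)) : ℝ)) ∂(sphereMeasure (n + 1))‖ := by
  have h := sphereMeasure_univ_pos n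
  rw [extension, norm_mul, Complex.norm_real, Real.norm_eq_abs, abs_of_nonneg (by positivity)]
  simp only [conj_planeWave, rho_succ]
  push_cast
  rfl

/-- A pointwise lower bound on a set bounds the `L^q` norm from below, for all `q`
including `∞`. -/
theorem le_eLpNorm_of_le_on {α : Type*} [MeasurableSpace α] {μ : Measure α} {g : α → ℂ} {q : ℝ≥0∞}
    (hq : q ≠ 0) {A : Set α} (hA : MeasurableSet A) (hμ : μ A ≠ 0) {a : ℝ} (ha : 0 ≤ a)
    (h : ∀ x ∈ A, a ≤ ‖g x‖) :
    ENNReal.ofReal a * μ A ^ (1 / q.toReal) ≤ eLpNorm g q μ := by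
  have h1 := eLpNorm_indicator_const' (c := a) hA hμ hq
  rw [← ofReal_norm, Real.norm_eq_abs, abs_of_nonneg ha] at h1
  rw [← h1]
  refine eLpNorm_mono fun x => ?_
  by_cases hx : x ∈ A
  · rw [Set.indicator_of_mem hx, Real.norm_eq_abs, abs_of_nonneg ha]
    exact h x hx
  · rw [Set.indicator_of_notMem hx, norm_zero]
    exact norm_nonneg _

theorem half_le_re_cexp {z : ℂ} (hz : ‖z‖ ≤ 1 / 4) : 1 / 2 ≤ (Complex.exp z).re := by
  have h1 := Complex.norm_exp_sub_one_le (x := z) (by linarith)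
  have h2 := (abs_le.1 (Complex.abs_re_le_norm (Complex.exp z - 1))).1
  simp only [Complex.sub_re, Complex.one_re] at h2
  linarith

/-- An integrand whose exponent is at most `1 / 4` in modulus does not oscillate. -/
theorem half_measure_le_norm_setIntegral_cexp {α : Type*} [MeasurableSpace α] {μ : Measure α}
    {B : Set α} (hB : MeasurableSet B) (hμ : μ B ≠ ⊤) {g : α → ℂ} (hg : Measurable g)
    (h : ∀ w ∈ B, ‖g w‖ ≤ 1 / 4) :
    1 / 2 * μ.real B ≤ ‖∫ w in B, Complex.exp (g w) ∂μ‖ := by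
  have hint : IntegrableOn (fun w => Complex.exp (g w)) B μ := by
    refine Measure.integrableOn_of_bounded hμ (by fun_prop) (M := Real.exp (1 / 4)) ?_
    filter_upwards [ae_restrict_mem hB] with w hw
    rw [Complex.norm_exp]
    exact Real.exp_le_exp.2 ((Complex.re_le_norm _).trans (h w hw))
  calc 1 / 2 * μ.real B = ∫ _ in B, (1 / 2 : ℝ) ∂μ := by
        rw [setIntegral_const, smul_eq_mul, mul_comm]
    _ ≤ ∫ w in B, (Complex.exp (g w)).re ∂μ :=
        setIntegral_mono_on (integrableOn_const hμ) hint.re hB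
          fun w hw => half_le_re_cexp (h w hw)
    _ = (∫ w in B, Complex.exp (g w) ∂μ).re := integral_re hint
    _ ≤ _ := Complex.re_le_norm _

/-! ### The constant function near the origin -/

theorem abs_log_mink_le {d : ℕ} (y : Space d) (hy : ‖y‖ ≤ 1 / 2) (w : USphere d) :
    |Real.log (mink (toHyperboloid d y : Minkowski d) (lightRay w))| ≤ 2 * ‖y‖ := by
  have hpos := mink_lightRay_pos (toHyperboloid d y) w
  have h1 := abs_le.1 (abs_inner_usphere_le y w)
  have h0 := norm_nonneg y
  have h2 : Real.sqrt (1 + ‖y‖ ^ 2) ≤ 1 + ‖y‖ := by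
    rw [Real.sqrt_le_left (by linarith)]; nlinarith
  have h3 : 1 ≤ Real.sqrt (1 + ‖y‖ ^ 2) := Real.one_le_sqrt.2 (by nlinarith)
  rw [mink_toHyperboloid] at hpos ⊢
  set b := Real.sqrt (1 + ‖y‖ ^ 2) - inner ℝ y (w : Space d) with hb
  have hb1 : b ≤ 1 + 2 * ‖y‖ := by linarith [h1.1]
  have hb2 : 1 - ‖y‖ ≤ b := by linarith [h1.2]
  rw [abs_le]
  constructor
  · have h4 := Real.one_sub_inv_le_log_of_pos hpos
    have h5 : b⁻¹ ≤ (1 - ‖y‖)⁻¹ := inv_anti₀ (by linarith) hb2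
    have h6 : (1 - ‖y‖)⁻¹ ≤ 1 + 2 * ‖y‖ := by
      rw [inv_le_iff_one_le_mul₀ (by linarith)]; nlinarith
    linarith
  · linarith [Real.log_le_sub_one_of_pos hpos]

theorem norm_half_add_I_mul_le (n : ℕ) {t : ℝ} (ht : 1 ≤ t) :
    ‖(n : ℂ) / 2 + Complex.I * t‖ ≤ ((n : ℝ) / 2 + 1) * t := by
  have h3 := norm_add_le ((n : ℂ) / 2) (Complex.I * t)
  simp only [norm_div, norm_mul, Complex.norm_I, Complex.norm_real, Complex.norm_natCast,
    Real.norm_eq_abs, abs_of_pos (by linarith : 0 < t), one_mul, Complex.norm_ofNat] at h3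
  have : (0 : ℝ) ≤ n := n.cast_nonneg
  nlinarith

/-- For any exponent at least `1`, a number `κ ≤ 1` is at most `κ ^ (1 / q)`. -/
theorem ofReal_le_ofReal_rpow {κ : ℝ} (h0 : 0 < κ) (h1 : κ ≤ 1) {q : ℝ≥0∞} (hq : 1 ≤ q) :
    ENNReal.ofReal κ ≤ ENNReal.ofReal κ ^ (1 / q.toReal) := by
  rw [ENNReal.ofReal_rpow_of_pos h0]
  refine ENNReal.ofReal_le_ofReal ?_
  have hle : 1 / q.toReal ≤ 1 := by
    rcases eq_or_ne q ⊤ with rfl | hq'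
    · simp
    · have : (1 : ℝ) ≤ q.toReal := by
        have := ENNReal.toReal_mono hq' hq
        simpa using this
      rw [div_le_one (by linarith)]; exact this
  calc κ = κ ^ (1 : ℝ) := (Real.rpow_one _).symm
    _ ≤ _ := Real.rpow_le_rpow_of_exponent_ge h0 h1 hle

theorem eLpNorm_le_of_norm_le_one {d : ℕ} {f : USphere d → ℂ} (hf : ∀ w, ‖f w‖ ≤ 1) {p : ℝ≥0∞}
    (hp : 1 ≤ p) : eLpNorm f p (sphereMeasure d) ≤
      ENNReal.ofReal (1 + (sphereMeasure d).real Set.univ) := by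
  have h1 := eLpNorm_le_of_ae_bound (p := p) (μ := sphereMeasure d)
    (Filter.Eventually.of_forall hf)
  refine h1.trans ?_
  rw [ENNReal.ofReal_one, mul_one]
  have h2 : sphereMeasure d Set.univ ≤ ENNReal.ofReal (1 + (sphereMeasure d).real Set.univ) := by
    rw [← ofReal_measureReal (measure_ne_top _ _)]
    exact ENNReal.ofReal_le_ofReal (by linarith)
  have h3 : (1 : ℝ≥0∞) ≤ ENNReal.ofReal (1 + (sphereMeasure d).real Set.univ) :=
    ENNReal.one_le_ofReal.2 (by linarith [(measureReal_nonneg : 0 ≤ (sphereMeasure d).real Set.univ)])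
  have hle : p.toReal⁻¹ ≤ 1 := by
    rcases eq_or_ne p ⊤ with rfl | hp'
    · simp
    · exact inv_le_one_of_one_le₀ (by simpa using ENNReal.toReal_mono hp' hp)
  calc sphereMeasure d Set.univ ^ p.toReal⁻¹
      ≤ ENNReal.ofReal (1 + (sphereMeasure d).real Set.univ) ^ p.toReal⁻¹ := by gcongr
    _ ≤ ENNReal.ofReal (1 + (sphereMeasure d).real Set.univ) ^ (1 : ℝ) :=
        ENNReal.rpow_le_rpow_of_exponent_le h3 hle
    _ = _ := ENNReal.rpow_one _

theorem memLp_const_sphere (d : ℕ) (p : ℝ≥0∞) :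
    MemLp (fun _ : USphere d => (1 : ℂ)) p (sphereMeasure d) := memLp_const _

theorem measurable_log_mink {d : ℕ} (x : hyperboloid d) : Measurable fun w : USphere d =>
    Real.log (mink (x : Minkowski d) (lightRay w)) :=
  Real.measurable_log.comp ((measurable_mink_lightRay d).comp measurable_prodMk_left)

theorem exists_hypMeasure_ball_ge (n : ℕ) : ∃ κ : ℝ, 0 < κ ∧ ∀ ε : ℝ, 0 < ε → ε ≤ 1 →
    ENNReal.ofReal (κ * ε ^ (n + 1)) ≤
      hypMeasure (n + 1) {x | ‖(x : Minkowski (n + 1)).2‖ ≤ ε} := by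
  have hv : 0 < (volume : Measure (Space (n + 1))).real (Metric.ball 0 1) :=
    ENNReal.toReal_pos (Metric.measure_ball_pos _ _ one_pos).ne' measure_ball_lt_top.ne
  refine ⟨1 / 2 * (volume : Measure (Space (n + 1))).real (Metric.ball 0 1), by positivity,
    fun ε h0 h1 => ?_⟩
  set A : Set (hyperboloid (n + 1)) := {x | ‖(x : Minkowski (n + 1)).2‖ ≤ ε} with hA
  have hAm : MeasurableSet A := measurableSet_le (f := fun x : hyperboloid (n + 1) =>
    ‖(x : Minkowski (n + 1)).2‖) (g := fun _ => ε) (by fun_prop) measurable_const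
  rw [← lintegral_indicator_one hAm, lintegral_hypMeasure _ (measurable_one.indicator hAm)]
  calc ENNReal.ofReal (1 / 2 * (volume : Measure (Space (n + 1))).real (Metric.ball 0 1) *
        ε ^ (n + 1))
      = ENNReal.ofReal (1 / 2) * volume (Metric.closedBall (0 : Space (n + 1)) ε) := by
        rw [Measure.addHaar_closedBall _ _ h0.le, finrank_euclideanSpace_fin,
          ← ofReal_measureReal measure_ball_lt_top.ne, ← ENNReal.ofReal_mul (by positivity),
          ← ENNReal.ofReal_mul (by positivity)]
        congr 1; ring
    _ = ∫⁻ y in Metric.closedBall (0 : Space (n + 1)) ε, ENNReal.ofReal (1 / 2) := by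
        rw [setLIntegral_const]
    _ ≤ ∫⁻ y in Metric.closedBall (0 : Space (n + 1)) ε,
          ENNReal.ofReal (Real.sqrt (1 + ‖y‖ ^ 2))⁻¹ * A.indicator 1 (toHyperboloid (n + 1) y) := by
        refine setLIntegral_mono' Metric.isClosed_closedBall.measurableSet fun y hy => ?_
        have hy' : ‖y‖ ≤ ε := by simpa using hy
        rw [Set.indicator_of_mem (show toHyperboloid (n + 1) y ∈ A from hy'), Pi.one_apply, mul_one]
        refine ENNReal.ofReal_le_ofReal ?_
        rw [one_div]
        refine inv_anti₀ (by positivity) ?_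
        rw [Real.sqrt_le_left (by norm_num)]
        nlinarith [norm_nonneg y]
    _ ≤ _ := setLIntegral_le_lintegral _ _

/-- On the ball of radius `δ / λ` the wave `h_{λ,ω}` is close to `1`, so that `E_λ 1` is as large
as `|c(λ)|⁻¹ ∼ λ^ρ` there. -/
theorem exists_le_extensionNorm_ball (n : ℕ) : ∃ c : ℝ, 0 < c ∧ ∀ lam : ℝ, 1 ≤ lam →
    ∀ p q : ℝ≥0∞, 1 ≤ p → 1 ≤ q →
      ENNReal.ofReal (c * lam ^ ((n : ℝ) / 2 - ((n : ℝ) + 1) * (q⁻¹).toReal)) ≤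
        extensionNorm (n + 1) lam p q := by
  obtain ⟨a, b, ha, hb, hc⟩ := exists_harishChandra_bounds n
  obtain ⟨κ, hκ, hball⟩ := exists_hypMeasure_ball_ge n
  set σ := (sphereMeasure (n + 1)).real Set.univ with hσ
  have hσ0 : 0 < σ := sphereMeasure_univ_pos n
  -- since `|s| ≤ (n / 2 + 1) λ` and `|log [x, b(ω)]| ≤ 2 |x|`, the exponent is at most `1 / 4` for
  -- `|x| ≤ δ / λ`
  set δ : ℝ := 1 / (4 * n + 8) with hδ
  have hδ0 : 0 < δ := by positivity
  have hδ1 : δ ≤ 1 / 8 := by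
    rw [hδ]
    exact one_div_le_one_div_of_le (by norm_num) (by linarith [(n.cast_nonneg : (0 : ℝ) ≤ n)])
  set κ' := min (κ * δ ^ (n + 1)) 1 with hκ'
  have hκ'0 : 0 < κ' := lt_min (by positivity) one_pos
  refine ⟨a / 2 * κ' / (1 + σ), by positivity, fun lam hlam p q hp hq => ?_⟩
  have hlam0 : 0 < lam := by linarith
  have hε0 : 0 < δ / lam := by positivity
  have hε1 : δ / lam ≤ 1 / 8 := (div_le_self hδ0.le hlam).trans hδ1
  set A : Set (hyperboloid (n + 1)) := {x | ‖(x : Minkowski (n + 1)).2‖ ≤ δ / lam} with hA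
  have hAm : MeasurableSet A := measurableSet_le (f := fun x : hyperboloid (n + 1) =>
    ‖(x : Minkowski (n + 1)).2‖) (g := fun _ => δ / lam) (by fun_prop) measurable_const
  have hAμ := hball (δ / lam) hε0 (by linarith)
  have hAne : hypMeasure (n + 1) A ≠ 0 := by
    refine (lt_of_lt_of_le ?_ hAμ).ne'
    rw [ENNReal.ofReal_pos]; positivity
  have hpt : ∀ x ∈ A, a / 2 * lam ^ ((n : ℝ) / 2) ≤ ‖extension (n + 1) lam (fun _ => 1) x‖ := by
    intro x hx
    have hx' : ‖(x : Minkowski (n + 1)).2‖ ≤ δ / lam := hx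
    rw [norm_extension]
    simp only [one_mul]
    have h1 := half_measure_le_norm_setIntegral_cexp (μ := sphereMeasure (n + 1)) (B := Set.univ)
      MeasurableSet.univ (measure_ne_top _ _)
      (g := fun w => -((n : ℂ) / 2 + Complex.I * lam) *
          (Real.log (mink (x : Minkowski (n + 1)) (lightRay w)) : ℝ))
      (by have := measurable_log_mink x; fun_prop) (fun w _ => by
        rw [norm_mul, norm_neg, Complex.norm_real, Real.norm_eq_abs]
        have h2 := abs_log_mink_le (x : Minkowski (n + 1)).2 (by linarith) w
        rw [toHyperboloid_snd] at h2
        calc _ ≤ (((n : ℝ) / 2 + 1) * lam) * (2 * (δ / lam)) :=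
              mul_le_mul (norm_half_add_I_mul_le n hlam) (h2.trans (by linarith)) (abs_nonneg _)
                (by positivity)
          _ = 1 / 4 := by
              rw [hδ]
              field_simp
              ring)
    rw [setIntegral_univ] at h1
    have h3 := (hc lam hlam).1
    calc a / 2 * lam ^ ((n : ℝ) / 2) = (a * lam ^ ((n : ℝ) / 2)) * σ⁻¹ * (1 / 2 * σ) := by
          field_simp
      _ ≤ _ := by gcongr
  have hmain := le_eLpNorm_of_le_on (μ := hypMeasure (n + 1)) (q := q)
    (by rintro rfl; simp at hq) hAm hAne (by positivity) hpt
  have hup := eLpNorm_extension_le (n + 1) lam p q (fun _ => 1) (memLp_const_sphere _ p)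
    (N := 1 + σ) (by positivity) (eLpNorm_le_of_norm_le_one (fun _ => by simp) hp)
  have hpow : ENNReal.ofReal (κ' * lam ^ (-(((n : ℝ) + 1) * (q⁻¹).toReal))) ≤
      hypMeasure (n + 1) A ^ (1 / q.toReal) := by
    have h5 : ENNReal.ofReal (κ' * lam ^ (-((n : ℝ) + 1))) ≤ hypMeasure (n + 1) A := by
      refine le_trans (ENNReal.ofReal_le_ofReal ?_) hAμ
      rw [div_pow, mul_div_assoc', div_eq_mul_inv, Real.rpow_neg hlam0.le, ← Nat.cast_succ,
        Real.rpow_natCast]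
      gcongr
      exact min_le_left _ _
    have h6 : ENNReal.ofReal (κ' * lam ^ (-(((n : ℝ) + 1) * (q⁻¹).toReal))) =
        ENNReal.ofReal κ' * ENNReal.ofReal (lam ^ (-((n : ℝ) + 1))) ^ (1 / q.toReal) := by
      rw [ENNReal.ofReal_mul hκ'0.le, ENNReal.ofReal_rpow_of_pos (by positivity),
        ← Real.rpow_mul hlam0.le, ENNReal.toReal_inv]
      congr 3
      ring
    rw [h6]
    calc _ ≤ ENNReal.ofReal κ' ^ (1 / q.toReal) *
            ENNReal.ofReal (lam ^ (-((n : ℝ) + 1))) ^ (1 / q.toReal) := by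
          gcongr
          exact ofReal_le_ofReal_rpow hκ'0 (min_le_right _ _) hq
      _ = ENNReal.ofReal (κ' * lam ^ (-((n : ℝ) + 1))) ^ (1 / q.toReal) := by
          rw [ENNReal.ofReal_mul hκ'0.le, ENNReal.mul_rpow_of_nonneg _ _ (by positivity)]
      _ ≤ _ := by gcongr
  have hall : ENNReal.ofReal (a / 2 * lam ^ ((n : ℝ) / 2)) *
      ENNReal.ofReal (κ' * lam ^ (-(((n : ℝ) + 1) * (q⁻¹).toReal))) ≤
      ENNReal.ofReal (1 + σ) * extensionNorm (n + 1) lam p q :=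
    (mul_le_mul_right hpow _).trans (hmain.trans hup)
  have h7 : a / 2 * κ' / (1 + σ) * lam ^ ((n : ℝ) / 2 - ((n : ℝ) + 1) * (q⁻¹).toReal) =
      (1 + σ)⁻¹ * ((a / 2 * lam ^ ((n : ℝ) / 2)) *
        (κ' * lam ^ (-(((n : ℝ) + 1) * (q⁻¹).toReal)))) := by
    rw [sub_eq_add_neg, Real.rpow_add hlam0]
    field_simp
  rw [h7, ENNReal.ofReal_mul (by positivity), ENNReal.ofReal_mul (by positivity)]
  calc _ ≤ ENNReal.ofReal (1 + σ)⁻¹ * (ENNReal.ofReal (1 + σ) * extensionNorm (n + 1) lam p q) := by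
        gcongr
    _ = extensionNorm (n + 1) lam p q := by
        rw [← mul_assoc, ← ENNReal.ofReal_mul (by positivity), inv_mul_cancel₀ (by positivity),
          ENNReal.ofReal_one, one_mul]

/-! ### Caps and cones over caps -/

/-- The spherical cap of angular radius `arctan ε` around the north pole. -/
def cap (n : ℕ) (ε : ℝ) : Set (USphere (n + 1)) :=
  {w | (Real.sqrt (1 + ε ^ 2))⁻¹ ≤ (w : Space (n + 1)) 0}

theorem measurableSet_cap (n : ℕ) (ε : ℝ) : MeasurableSet (cap n ε) :=
  measurableSet_le (f := fun _ : USphere (n + 1) => (Real.sqrt (1 + ε ^ 2))⁻¹)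
    (g := fun w : USphere (n + 1) => (w : Space (n + 1)) 0) measurable_const (by fun_prop)

theorem gnomonic_mem_cap {n : ℕ} {ε : ℝ} {v : Space n} (h : ‖v‖ ≤ ε) : gnomonic v ∈ cap n ε := by
  change (Real.sqrt (1 + ε ^ 2))⁻¹ ≤ (gnomonic v : Space (n + 1)) 0
  rw [gnomonic_zero_coord]
  gcongr

theorem cap_subset_upperHalf (n : ℕ) (ε : ℝ) : cap n ε ⊆ upperHalf n := by
  intro w hw
  have h1 : (Real.sqrt (1 + ε ^ 2))⁻¹ ≤ (w : Space (n + 1)) 0 := hw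
  have h2 : 0 < (Real.sqrt (1 + ε ^ 2))⁻¹ := by positivity
  exact h2.trans_le h1

theorem exists_cap_measure_ge (n : ℕ) : ∃ κ : ℝ, 0 < κ ∧ ∀ ε : ℝ, 0 < ε → ε ≤ 1 →
    κ * ε ^ n ≤ (sphereMeasure (n + 1)).real (cap n ε) := by
  have hv : 0 < (volume : Measure (Space n)).real (Metric.ball 0 1) :=
    ENNReal.toReal_pos (Metric.measure_ball_pos _ _ one_pos).ne' measure_ball_lt_top.ne
  refine ⟨(1 / 2) ^ (n + 1) * (volume : Measure (Space n)).real (Metric.ball 0 1), by positivity,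
    fun ε h0 h1 => ?_⟩
  rw [measureReal_def (sphereMeasure (n + 1)),
    ← ENNReal.ofReal_le_iff_le_toReal (measure_ne_top _ _), ← Measure.restrict_eq_self _ (cap_subset_upperHalf n ε),
    ← lintegral_indicator_one (measurableSet_cap n ε),
    setLIntegral_upperHalf _ (measurable_one.indicator (measurableSet_cap n ε))]
  calc ENNReal.ofReal ((1 / 2) ^ (n + 1) * (volume : Measure (Space n)).real (Metric.ball 0 1) *
        ε ^ n)
      = ENNReal.ofReal ((1 / 2) ^ (n + 1)) * volume (Metric.closedBall (0 : Space n) ε) := by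
        rw [Measure.addHaar_closedBall _ _ h0.le, finrank_euclideanSpace_fin,
          ← ofReal_measureReal measure_ball_lt_top.ne, ← ENNReal.ofReal_mul (by positivity),
          ← ENNReal.ofReal_mul (by positivity)]
        congr 1; ring
    _ = ∫⁻ v in Metric.closedBall (0 : Space n) ε, ENNReal.ofReal ((1 / 2) ^ (n + 1)) := by
        rw [setLIntegral_const]
    _ ≤ ∫⁻ v in Metric.closedBall (0 : Space n) ε,
          ENNReal.ofReal ((Real.sqrt (1 + ‖v‖ ^ 2))⁻¹ ^ (n + 1)) *
            (cap n ε).indicator 1 (gnomonic v) := by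
        refine setLIntegral_mono' Metric.isClosed_closedBall.measurableSet fun y hy => ?_
        have hy' : ‖y‖ ≤ ε := by simpa using hy
        rw [Set.indicator_of_mem (gnomonic_mem_cap hy'), Pi.one_apply, mul_one]
        refine ENNReal.ofReal_le_ofReal ?_
        rw [one_div]
        refine pow_le_pow_left₀ (by norm_num) (inv_anti₀ (by positivity) ?_) _
        rw [Real.sqrt_le_left (by norm_num)]
        nlinarith [norm_nonneg y]
    _ ≤ _ := setLIntegral_le_lintegral _ _

theorem norm_sub_usphere_sq {d : ℕ} (θ w : USphere d) :
    ‖(θ : Space d) - w‖ ^ 2 = 2 * (1 - inner ℝ (θ : Space d) (w : Space d)) := by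
  rw [norm_sub_sq_real, norm_usphere, norm_usphere]; ring

theorem inner_usphere_le_one {d : ℕ} (θ w : USphere d) :
    inner ℝ (θ : Space d) (w : Space d) ≤ 1 := by
  have := norm_sub_usphere_sq θ w
  nlinarith [sq_nonneg ‖(θ : Space d) - w‖]

theorem one_sub_inner_le_of_mem_cap {n : ℕ} {ε : ℝ} {θ w : USphere (n + 1)}
    (hθ : θ ∈ cap n ε) (hw : w ∈ cap n ε) :
    1 - inner ℝ (θ : Space (n + 1)) (w : Space (n + 1)) ≤ 2 * ε ^ 2 := by
  have hs : 1 - ε ^ 2 / 2 ≤ (Real.sqrt (1 + ε ^ 2))⁻¹ := by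
    have h1 : Real.sqrt (1 + ε ^ 2) ≤ 1 + ε ^ 2 / 2 := by
      rw [Real.sqrt_le_left (by positivity)]; nlinarith [sq_nonneg (ε ^ 2)]
    have h2 : (1 + ε ^ 2 / 2)⁻¹ ≤ (Real.sqrt (1 + ε ^ 2))⁻¹ := inv_anti₀ (by positivity) h1
    refine le_trans ?_ h2
    rw [← one_div, le_div_iff₀ (by positivity)]
    nlinarith [sq_nonneg (ε ^ 2)]
  have hbound : ∀ u : USphere (n + 1), u ∈ cap n ε →
      ‖(u : Space (n + 1)) - EuclideanSpace.single 0 1‖ ^ 2 ≤ ε ^ 2 := by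
    intro u hu
    have hu' : (Real.sqrt (1 + ε ^ 2))⁻¹ ≤ (u : Space (n + 1)) 0 := hu
    have h1 : inner ℝ (u : Space (n + 1)) (EuclideanSpace.single 0 1) = (u : Space (n + 1)) 0 := by
      simp [EuclideanSpace.inner_single_right]
    rw [norm_sub_sq_real, norm_usphere, h1, PiLp.norm_single]
    norm_num
    linarith
  have h1 := hbound θ hθ
  have h2 := hbound w hw
  have h3 := norm_sub_usphere_sq θ w
  have h4 : ‖(θ : Space (n + 1)) - w‖ ≤ ‖(θ : Space (n + 1)) - EuclideanSpace.single 0 1‖ +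
      ‖(w : Space (n + 1)) - EuclideanSpace.single 0 1‖ := by
    rw [norm_sub_rev (w : Space (n + 1))]
    exact norm_sub_le_norm_sub_add_norm_sub _ _ _
  have h5 := pow_le_pow_left₀ (norm_nonneg _) h4 2
  nlinarith [sq_nonneg (‖(θ : Space (n + 1)) - EuclideanSpace.single 0 1‖ -
    ‖(w : Space (n + 1)) - EuclideanSpace.single 0 1‖)]

theorem log_mink_polarPoint {d : ℕ} (r : ℝ) (θ w : USphere d) (hr : 0 ≤ r) :
    Real.log (mink (polarPoint r θ : Minkowski d) (lightRay w)) =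
      -r + Real.log (1 + (Real.exp (2 * r) - 1) / 2 *
        (1 - inner ℝ (θ : Space d) (w : Space d))) := by
  have hτ : 0 ≤ 1 - inner ℝ (θ : Space d) (w : Space d) := by
    linarith [inner_usphere_le_one θ w]
  have hm : 0 ≤ (Real.exp (2 * r) - 1) / 2 := by
    have := Real.one_le_exp (by linarith : 0 ≤ 2 * r)
    linarith
  have hne : 1 + (Real.exp (2 * r) - 1) / 2 * (1 - inner ℝ (θ : Space d) (w : Space d)) ≠ 0 := by
    positivity
  conv_rhs => rw [← Real.log_exp (-r), ← Real.log_mul (Real.exp_pos _).ne' hne]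
  rw [mink_polarPoint,
    Real.cosh_eq, Real.sinh_eq]
  congr 1
  have h2 : Real.exp (-r) * Real.exp (2 * r) = Real.exp r := by
    rw [← Real.exp_add]; congr 1; ring
  rw [← h2]
  ring

theorem exists_polarPoint {d : ℕ} (x : hyperboloid d) (hx : (x : Minkowski d).2 ≠ 0) :
    ∃ r : ℝ, 0 < r ∧ ∃ θ : USphere d, x = polarPoint r θ := by
  set y := (x : Minkowski d).2 with hy
  have hn : 0 < ‖y‖ := norm_pos_iff.2 hx
  refine ⟨Real.arsinh ‖y‖, Real.arsinh_pos_iff.2 hn, ⟨‖y‖⁻¹ • y, ?_⟩, ?_⟩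
  · rw [mem_sphere_zero_iff_norm, norm_smul, norm_inv, norm_norm, inv_mul_cancel₀ hn.ne']
  · rw [polarPoint, Real.sinh_arsinh, smul_smul, mul_inv_cancel₀ hn.ne', one_smul,
      toHyperboloid_snd]

/-- The points `polarPoint r θ` with `a ≤ r ≤ b` and `θ ∈ cap n ε` (for `0 < a`). -/
def capShell (n : ℕ) (ε a b : ℝ) : Set (hyperboloid (n + 1)) :=
  {x | Real.sinh a ≤ ‖(x : Minkowski (n + 1)).2‖ ∧ ‖(x : Minkowski (n + 1)).2‖ ≤ Real.sinh b ∧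
    (Real.sqrt (1 + ε ^ 2))⁻¹ * ‖(x : Minkowski (n + 1)).2‖ ≤ (x : Minkowski (n + 1)).2 0}

theorem measurableSet_capShell (n : ℕ) (ε a b : ℝ) : MeasurableSet (capShell n ε a b) := by
  refine (measurableSet_le (f := fun _ : hyperboloid (n + 1) => Real.sinh a)
    (g := fun x => ‖(x : Minkowski (n + 1)).2‖) measurable_const (by fun_prop)).inter
    ((measurableSet_le (f := fun x : hyperboloid (n + 1) => ‖(x : Minkowski (n + 1)).2‖)
    (g := fun x => Real.sinh b) (by fun_prop) measurable_const).inter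
    (measurableSet_le (f := fun x : hyperboloid (n + 1) =>
      (Real.sqrt (1 + ε ^ 2))⁻¹ * ‖(x : Minkowski (n + 1)).2‖)
    (g := fun x => (x : Minkowski (n + 1)).2 0) (by fun_prop) (by fun_prop)))

theorem polarPoint_mem_capShell_iff {n : ℕ} {ε a b r : ℝ} (hr : 0 < r) (θ : USphere (n + 1)) :
    polarPoint r θ ∈ capShell n ε a b ↔ a ≤ r ∧ r ≤ b ∧ θ ∈ cap n ε := by
  have hs : 0 < Real.sinh r := Real.sinh_pos_iff.2 hr
  have h : ‖Real.sinh r • (θ : Space (n + 1))‖ = Real.sinh r := by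
    rw [norm_smul, norm_usphere, mul_one, Real.norm_eq_abs, abs_of_pos hs]
  have h2 : (polarPoint r θ : Minkowski (n + 1)).2 = Real.sinh r • (θ : Space (n + 1)) := rfl
  have h3 : (Real.sqrt (1 + ε ^ 2))⁻¹ * Real.sinh r ≤ (Real.sinh r • (θ : Space (n + 1))) 0 ↔
      θ ∈ cap n ε := by
    rw [PiLp.smul_apply, smul_eq_mul, mul_comm]
    exact mul_le_mul_iff_right₀ hs
  change (_ ∧ _ ∧ _) ↔ _
  rw [h2, h, Real.sinh_le_sinh, Real.sinh_le_sinh, h3]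

theorem exp_div_four_le_sinh {r : ℝ} (hr : 1 ≤ r) : Real.exp r / 4 ≤ Real.sinh r := by
  rw [Real.sinh_eq]
  have h1 := Real.add_one_le_exp r
  have h2 : Real.exp (-r) ≤ 1 := Real.exp_le_one_iff.2 (by linarith)
  linarith

/-- The shell between the radii `R - 1` and `R` over a cap of radius `ε` has measure at least of size
`(e^R ε)^n`. -/
theorem exists_capShell_measure_ge (n : ℕ) : ∃ κ : ℝ, 0 < κ ∧ ∀ ε R : ℝ, 0 < ε → ε ≤ 1 → 2 ≤ R →
    ENNReal.ofReal (κ * (Real.exp R * ε) ^ n) ≤ hypMeasure (n + 1) (capShell n ε (R - 1) R) := by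
  obtain ⟨κ, hκ, hcap⟩ := exists_cap_measure_ge n
  refine ⟨κ * (Real.exp (-1) / 4) ^ n, by positivity, fun ε R h0 h1 hR => ?_⟩
  have hAm := measurableSet_capShell n ε (R - 1) R
  rw [← lintegral_indicator_one hAm, lintegral_hypMeasure_polar _ (measurable_one.indicator hAm)]
  calc ENNReal.ofReal (κ * (Real.exp (-1) / 4) ^ n * (Real.exp R * ε) ^ n)
      = ENNReal.ofReal ((Real.exp (R - 1) / 4) ^ n) * ENNReal.ofReal (κ * ε ^ n) := by
        rw [← ENNReal.ofReal_mul (by positivity), sub_eq_add_neg, Real.exp_add]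
        congr 1
        simp only [mul_pow, div_pow]
        ring
    _ ≤ ENNReal.ofReal ((Real.exp (R - 1) / 4) ^ n) * sphereMeasure (n + 1) (cap n ε) := by
        rw [← ofReal_measureReal (measure_ne_top _ _)]
        gcongr
        exact hcap ε h0 h1
    _ = ∫⁻ θ in cap n ε, (∫⁻ r in Set.Icc (R - 1) R, ENNReal.ofReal ((Real.exp (R - 1) / 4) ^ n))
          ∂(sphereMeasure (n + 1)) := by
        rw [setLIntegral_const, setLIntegral_const, Real.volume_Icc]
        simp
    _ ≤ ∫⁻ θ in cap n ε, (∫⁻ r in Set.Ioi (0 : ℝ), ENNReal.ofReal (Real.sinh r ^ n) *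
          (capShell n ε (R - 1) R).indicator 1 (polarPoint r θ)) ∂(sphereMeasure (n + 1)) := by
        refine setLIntegral_mono' (measurableSet_cap n ε) fun θ hθ => ?_
        refine le_trans (setLIntegral_mono' measurableSet_Icc fun r hr => ?_)
          (lintegral_mono_set (fun r hr => (by linarith [hr.1] : (0 : ℝ) < r) :
            Set.Icc (R - 1) R ⊆ Set.Ioi 0))
        have hr0 : 0 < r := by linarith [hr.1]
        rw [Set.indicator_of_mem ((polarPoint_mem_capShell_iff hr0 θ).2 ⟨hr.1, hr.2, hθ⟩),
          Pi.one_apply, mul_one]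
        refine ENNReal.ofReal_le_ofReal (pow_le_pow_left₀ (by positivity) ?_ _)
        refine le_trans ?_ (exp_div_four_le_sinh (by linarith [hr.1] : 1 ≤ r))
        gcongr
        exact hr.1
    _ ≤ _ := setLIntegral_le_lintegral _ _

/-- With `f` the indicator of a cap of radius comparable to `e^(-R)`, the integrand of `E_λ f` does
not oscillate on the shell `R - 1 ≤ r ≤ R` over the cap. -/
theorem le_norm_extension_indicator_cap {n : ℕ} {lam ε R : ℝ}
    (hsmall : ‖(n : ℂ) / 2 + Complex.I * lam‖ * (Real.exp (2 * R) * ε ^ 2) ≤ 1 / 4)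
    (hR : 2 ≤ R) {x : hyperboloid (n + 1)} (hx : x ∈ capShell n ε (R - 1) R) :
    ‖harishChandra (n + 1) lam‖⁻¹ * ((sphereMeasure (n + 1)).real Set.univ)⁻¹ *
      (Real.exp ((n : ℝ) / 2 * (R - 1)) * (1 / 2 * (sphereMeasure (n + 1)).real (cap n ε))) ≤
      ‖extension (n + 1) lam ((cap n ε).indicator fun _ => 1) x‖ := by
  have hx0 : (x : Minkowski (n + 1)).2 ≠ 0 := by
    intro h0
    have h1 : Real.sinh (R - 1) ≤ ‖(x : Minkowski (n + 1)).2‖ := hx.1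
    rw [h0, norm_zero] at h1
    exact absurd h1 (not_le.2 (Real.sinh_pos_iff.2 (by linarith)))
  obtain ⟨r, hr, θ, rfl⟩ := exists_polarPoint x hx0
  obtain ⟨hr1, hr2, hθ⟩ := (polarPoint_mem_capShell_iff hr θ).1 hx
  rw [norm_extension]
  refine mul_le_mul_of_nonneg_left ?_ (by positivity)
  set z : ℂ := (n : ℂ) / 2 + Complex.I * lam with hz
  set X : USphere (n + 1) → ℝ := fun w => (Real.exp (2 * r) - 1) / 2 *
        (1 - inner ℝ (θ : Space (n + 1)) (w : Space (n + 1))) with hX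
  have h1 : ∀ w, (cap n ε).indicator (fun _ => (1 : ℂ)) w * Complex.exp (-z *
      (Real.log (mink (polarPoint r θ : Minkowski (n + 1)) (lightRay w)) : ℝ)) =
      (cap n ε).indicator (fun w => Complex.exp (z * r) * Complex.exp (-z * (Real.log (1 + X w) : ℝ)))
        w := by
    intro w
    by_cases hw : w ∈ cap n ε
    · rw [Set.indicator_of_mem hw, Set.indicator_of_mem hw, one_mul, log_mink_polarPoint r θ w hr.le,
        ← Complex.exp_add]
      congr 1
      push_cast
      ring
    · rw [Set.indicator_of_notMem hw, Set.indicator_of_notMem hw, zero_mul]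
  simp only [h1]
  rw [integral_indicator (measurableSet_cap n ε), integral_const_mul, norm_mul, Complex.norm_exp]
  have hre : (z * r).re = (n : ℝ) / 2 * r := by simp [hz]
  rw [hre]
  have hXm : Measurable X := by fun_prop
  refine mul_le_mul (Real.exp_le_exp.2 (by gcongr)) ?_ (by positivity) (by positivity)
  refine half_measure_le_norm_setIntegral_cexp (measurableSet_cap n ε) (measure_ne_top _ _)
    (by fun_prop) fun w hw => ?_
  have hτ0 : 0 ≤ 1 - inner ℝ (θ : Space (n + 1)) (w : Space (n + 1)) := by
    linarith [inner_usphere_le_one θ w]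
  have hτ := one_sub_inner_le_of_mem_cap hθ hw
  have he1 : 1 ≤ Real.exp (2 * r) := Real.one_le_exp (by linarith)
  have he2 : Real.exp (2 * r) ≤ Real.exp (2 * R) := Real.exp_le_exp.2 (by linarith)
  have hX0 : 0 ≤ X w := mul_nonneg (by linarith) hτ0
  have hX1 : X w ≤ Real.exp (2 * R) * ε ^ 2 := by
    calc X w ≤ Real.exp (2 * R) / 2 * (2 * ε ^ 2) :=
          mul_le_mul (by linarith) hτ hτ0 (by positivity)
      _ = _ := by ring
  rw [norm_mul, norm_neg, Complex.norm_real, Real.norm_eq_abs,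
    abs_of_nonneg (Real.log_nonneg (by linarith))]
  have hlog : Real.log (1 + X w) ≤ Real.exp (2 * R) * ε ^ 2 :=
    (Real.log_le_sub_one_of_pos (by linarith)).trans (by linarith)
  exact (mul_le_mul_of_nonneg_left hlog (norm_nonneg _)).trans hsmall

/-! ### Unboundedness for `p < 2` -/

theorem one_div_toReal_le_one {p : ℝ≥0∞} (hp : 1 ≤ p) : 1 / p.toReal ≤ 1 := by
  rcases eq_or_ne p ⊤ with rfl | hp'
  · simp
  · have : (1 : ℝ) ≤ p.toReal := by simpa using ENNReal.toReal_mono hp' hp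
    rw [div_le_one (by linarith)]; exact this

/-- Indicator functions of caps of radius `δ e^(-R)` contradict boundedness as `R → ∞`. -/
theorem not_isBoundedExtension_of_lt_two {n : ℕ} (hn : 1 ≤ n) {lam : ℝ} (hlam : 0 < lam)
    {p q : ℝ≥0∞} (hp : 1 ≤ p) (hp2 : p < 2) (hq : 1 ≤ q) :
    ¬ IsBoundedExtension (n + 1) lam p q := by
  rintro ⟨C, hC⟩
  obtain ⟨κ₁, hκ₁, hcap⟩ := exists_cap_measure_ge n
  obtain ⟨κ₂, hκ₂, hshell⟩ := exists_capShell_measure_ge n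
  have hσ0 := sphereMeasure_univ_pos n
  have hc0 := norm_harishChandra_pos n hlam
  set σ := (sphereMeasure (n + 1)).real Set.univ with hσ
  set z : ℂ := (n : ℂ) / 2 + Complex.I * lam with hz
  set δ : ℝ := 1 / (4 * (‖z‖ + 1)) with hδ
  have hz0 := norm_nonneg z
  have hδ0 : 0 < δ := by positivity
  have hδ1 : δ ≤ 1 / 4 := by
    rw [hδ]; exact one_div_le_one_div_of_le (by norm_num) (by linarith)
  have hδz : ‖z‖ * δ ^ 2 ≤ 1 / 4 := by
    have h1 : (‖z‖ + 1) * δ = 1 / 4 := by rw [hδ]; field_simp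
    nlinarith
  have hptop : p ≠ ⊤ := fun h => by simp [h] at hp2
  have hp1 : (1 : ℝ) ≤ p.toReal := by simpa using ENNReal.toReal_mono hptop hp
  have hp2' : p.toReal < 2 := by
    have := (ENNReal.toReal_lt_toReal hptop (by norm_num : (2 : ℝ≥0∞) ≠ ⊤)).2 hp2
    simpa using this
  -- the exponential rate at which the quotient of the norms grows
  set α : ℝ := (n : ℝ) * (1 / p.toReal - 1 / 2) with hα
  have hn0 : (0 : ℝ) < n := by exact_mod_cast hn
  have hα0 : 0 < α := by
    refine mul_pos hn0 ?_
    have : (1 : ℝ) / 2 < 1 / p.toReal := one_div_lt_one_div_of_lt (by linarith) hp2'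
    linarith
  have he0 : 0 ≤ 1 - 1 / p.toReal := by linarith [one_div_toReal_le_one hp]
  set μ := min (κ₂ * δ ^ n) 1 with hμ
  have hμ0 : 0 < μ := lt_min (by positivity) one_pos
  set K : ℝ := ‖harishChandra (n + 1) lam‖⁻¹ * σ⁻¹ * Real.exp (-(n : ℝ) / 2) * (1 / 2) * μ *
    (κ₁ * δ ^ n) ^ (1 - 1 / p.toReal) with hK
  have hK0 : 0 < K := by positivity
  have hkey : ∀ R : ℝ, 2 ≤ R → K * Real.exp (α * R) ≤ C := by
    intro R hR
    set ε := δ * Real.exp (-R) with hε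
    have heR : Real.exp R * Real.exp (-R) = 1 := by rw [← Real.exp_add]; simp
    have hε0 : 0 < ε := by positivity
    have hε1 : ε ≤ 1 := by
      have : Real.exp (-R) ≤ 1 := Real.exp_le_one_iff.2 (by linarith)
      nlinarith
    have hsq : Real.exp (2 * R) * ε ^ 2 = δ ^ 2 := by
      rw [two_mul, Real.exp_add, hε]
      calc _ = (Real.exp R * Real.exp (-R)) ^ 2 * δ ^ 2 := by ring
        _ = _ := by rw [heR]; ring
    have hRε : Real.exp R * ε = δ := by
      rw [hε]
      calc _ = (Real.exp R * Real.exp (-R)) * δ := by ring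
        _ = _ := by rw [heR]; ring
    set s := (sphereMeasure (n + 1)).real (cap n ε) with hs
    have hs1 := hcap ε hε0 hε1
    have hs0 : 0 < s := lt_of_lt_of_le (by positivity) hs1
    have hA := hshell ε R hε0 hε1 hR
    rw [hRε] at hA
    have hAne : hypMeasure (n + 1) (capShell n ε (R - 1) R) ≠ 0 := by
      refine (lt_of_lt_of_le ?_ hA).ne'
      rw [ENNReal.ofReal_pos]; positivity
    have hmain := le_eLpNorm_of_le_on (μ := hypMeasure (n + 1)) (q := q)
      (by rintro rfl; simp at hq) (measurableSet_capShell n ε (R - 1) R) hAne (by positivity)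
      (fun x hx => le_norm_extension_indicator_cap (lam := lam) (by rw [hsq]; exact hδz) hR hx)
    have hpow : ENNReal.ofReal μ ≤ hypMeasure (n + 1) (capShell n ε (R - 1) R) ^ (1 / q.toReal) := by
      refine (ofReal_le_ofReal_rpow hμ0 (min_le_right _ _) hq).trans ?_
      gcongr
      exact (ENNReal.ofReal_le_ofReal (min_le_left _ _)).trans hA
    have hfp : eLpNorm ((cap n ε).indicator fun _ => (1 : ℂ)) p (sphereMeasure (n + 1)) =
        ENNReal.ofReal (s ^ (1 / p.toReal)) := by
      rw [eLpNorm_indicator_const (measurableSet_cap n ε) (by rintro rfl; simp at hp) hptop,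
        enorm_one, one_mul, ← ofReal_measureReal (measure_ne_top _ _),
        ENNReal.ofReal_rpow_of_pos hs0]
    have hf : MemLp ((cap n ε).indicator fun _ => (1 : ℂ)) p (sphereMeasure (n + 1)) :=
      (memLp_const 1).indicator (measurableSet_cap n ε)
    have h1 := hC _ hf
    rw [hfp] at h1
    have h2 := ((mul_le_mul_right hpow _).trans hmain).trans h1
    rw [← ENNReal.ofReal_mul (by positivity), ← ENNReal.ofReal_coe_nnreal,
      ← ENNReal.ofReal_mul (by positivity), ENNReal.ofReal_le_ofReal_iff (by positivity)] at h2
    have h3 : (κ₁ * δ ^ n) ^ (1 - 1 / p.toReal) * Real.exp (-((n : ℝ) * (1 - 1 / p.toReal) * R)) ≤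
        s ^ (1 - 1 / p.toReal) := by
      have h4 : κ₁ * ε ^ n = (κ₁ * δ ^ n) * Real.exp (-(n * R)) := by
        rw [hε, mul_pow, ← Real.exp_nat_mul]
        ring_nf
      calc _ = (κ₁ * ε ^ n) ^ (1 - 1 / p.toReal) := by
            rw [h4, Real.mul_rpow (by positivity) (Real.exp_pos _).le, ← Real.exp_mul]
            congr 2; ring
        _ ≤ _ := Real.rpow_le_rpow (by positivity) hs1 he0
    have h5 : s = s ^ (1 - 1 / p.toReal) * s ^ (1 / p.toReal) := by
      rw [← Real.rpow_add hs0]; simp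
    have hsp : 0 < s ^ (1 / p.toReal) := by positivity
    refine le_of_mul_le_mul_right ?_ hsp
    refine le_trans ?_ h2
    have h6 : Real.exp (α * R) = Real.exp ((n : ℝ) / 2 * R) *
        Real.exp (-((n : ℝ) * (1 - 1 / p.toReal) * R)) := by
      rw [← Real.exp_add, hα]; congr 1; ring
    have h7 : Real.exp ((n : ℝ) / 2 * (R - 1)) = Real.exp ((n : ℝ) / 2 * R) *
        Real.exp (-(n : ℝ) / 2) := by
      rw [← Real.exp_add]; congr 1; ring
    calc K * Real.exp (α * R) * s ^ (1 / p.toReal)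
        = ‖harishChandra (n + 1) lam‖⁻¹ * σ⁻¹ * (Real.exp ((n : ℝ) / 2 * (R - 1)) * (1 / 2 *
          (((κ₁ * δ ^ n) ^ (1 - 1 / p.toReal) * Real.exp (-((n : ℝ) * (1 - 1 / p.toReal) * R))) *
            s ^ (1 / p.toReal)))) * μ := by
          rw [h6, h7, hK]; ring
      _ ≤ ‖harishChandra (n + 1) lam‖⁻¹ * σ⁻¹ * (Real.exp ((n : ℝ) / 2 * (R - 1)) * (1 / 2 *
          (s ^ (1 - 1 / p.toReal) * s ^ (1 / p.toReal)))) * μ := by gcongr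
      _ = _ := by rw [← h5]
  -- a radius beyond which the exponential exceeds `C / K`
  have h1 := hkey (2 + C / (K * α)) (by have := C.2; have : (0 : ℝ) ≤ C / (K * α) := by positivity
                                        linarith)
  have h2 := Real.add_one_le_exp (α * (2 + C / (K * α)))
  have h3 : K * (α * (2 + C / (K * α)) + 1) ≤ C := (mul_le_mul_of_nonneg_left h2 hK0.le).trans h1
  have h4 : K * (α * (2 + C / (K * α)) + 1) = 2 * K * α + C + K := by field_simp
  have : 0 < K * α := mul_pos hK0 hα0
  linarith

/-! ### Wave packets -/

theorem inner_gnomonic {n : ℕ} (u v : Space n) :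
    inner ℝ (gnomonic u : Space (n + 1)) (gnomonic v : Space (n + 1)) =
      (1 + inner ℝ u v) / (Real.sqrt (1 + ‖u‖ ^ 2) * Real.sqrt (1 + ‖v‖ ^ 2)) := by
  rw [gnomonic_coe, gnomonic_coe, inner_smul_left, inner_smul_right, inner_consVec]
  simp only [conj_trivial, mul_one]
  field_simp

theorem exists_gnomonic {n : ℕ} {θ : USphere (n + 1)} (hθ : θ ∈ upperHalf n) :
    ∃ u : Space n, θ = gnomonic u := by
  have h0 : 0 < (θ : Space (n + 1)) 0 := hθ
  set a := (θ : Space (n + 1)) 0 with ha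
  set u : Space n := WithLp.toLp 2 fun i => a⁻¹ * (θ : Space (n + 1)) i.succ with hu
  have h1 : (θ : Space (n + 1)) = a • consVec 1 u := by
    ext i
    refine Fin.cases ?_ (fun j => ?_) i
    · simp [consVec, ha]
    · simp [consVec, hu, mul_inv_cancel_left₀ h0.ne']
  have h2 : 1 = a * Real.sqrt (1 + ‖u‖ ^ 2) := by
    have := norm_usphere θ
    rw [h1, norm_smul, norm_consVec, one_pow, Real.norm_eq_abs, abs_of_pos h0] at this
    exact this.symm
  refine ⟨u, Subtype.ext ?_⟩
  rw [gnomonic_coe, h1, eq_inv_of_mul_eq_one_left h2.symm]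

theorem norm_le_of_gnomonic_mem_cap {n : ℕ} {ε : ℝ} (hε : 0 ≤ ε) {u : Space n}
    (h : gnomonic u ∈ cap n ε) : ‖u‖ ≤ ε := by
  have h1 : (Real.sqrt (1 + ε ^ 2))⁻¹ ≤ (gnomonic u : Space (n + 1)) 0 := h
  rw [gnomonic_zero_coord, inv_le_inv₀ (by positivity) (by positivity),
    Real.sqrt_le_sqrt_iff (by positivity)] at h1
  exact (abs_le_of_sq_le_sq' (by linarith) hε).2

/-- In the gnomonic chart `1 - ⟪ω(u), ω(v)⟫` is `|u - v|² / 2` up to fourth order terms. -/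
theorem one_sub_inner_gnomonic_bounds {n : ℕ} (u v : Space n) :
    1 - inner ℝ (gnomonic u : Space (n + 1)) (gnomonic v : Space (n + 1)) ≤ ‖u - v‖ ^ 2 / 2 ∧
    ‖u - v‖ ^ 2 / 2 - (‖u‖ ^ 2 + ‖v‖ ^ 2) ^ 2 ≤
      1 - inner ℝ (gnomonic u : Space (n + 1)) (gnomonic v : Space (n + 1)) := by
  rw [inner_gnomonic, norm_sub_sq_real]
  have hi := abs_le.1 (abs_real_inner_le_norm u v)
  set x := inner ℝ u v
  set A := ‖u‖ ^ 2 with hA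
  set B := ‖v‖ ^ 2 with hB
  set P := Real.sqrt (1 + A) * Real.sqrt (1 + B) with hP
  have hA0 : 0 ≤ A := sq_nonneg _
  have hB0 : 0 ≤ B := sq_nonneg _
  have hPsq : P ^ 2 = (1 + A) * (1 + B) := by
    rw [hP, mul_pow, Real.sq_sqrt (by linarith), Real.sq_sqrt (by linarith)]
  have hP0 : 0 < P := by positivity
  have hP1 : 1 ≤ P := by nlinarith [mul_nonneg hA0 hB0]
  have hP2 : P ≤ 1 + (A + B) / 2 := by
    refine le_of_sq_le_sq ?_ (by positivity)
    rw [hPsq]; nlinarith [sq_nonneg (A - B)]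
  have hP3 : 1 + (A + B) / 2 - (A + B) ^ 2 / 8 ≤ P := by
    by_cases h : 1 + (A + B) / 2 - (A + B) ^ 2 / 8 ≤ 0
    · linarith
    · refine le_of_sq_le_sq ?_ hP0.le
      push Not at h
      rw [hPsq]
      nlinarith [mul_nonneg hA0 hB0, mul_nonneg (sq_nonneg (A + B)) (add_nonneg hA0 hB0),
        sq_nonneg (A + B), mul_pos h h, mul_nonneg (sq_nonneg (A + B)) h.le]
  have hx : |x| ≤ (A + B) / 2 := by
    have : ‖u‖ * ‖v‖ ≤ (A + B) / 2 := by nlinarith [sq_nonneg (‖u‖ - ‖v‖)]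
    exact abs_le.2 ⟨by linarith [hi.1], by linarith [hi.2]⟩
  obtain ⟨hx1, hx2⟩ := abs_le.1 hx
  have hsub : 1 - (1 + x) / P = (P - 1 - x) / P := by field_simp; ring
  rw [hsub]
  have hZ0 : 0 ≤ (A - 2 * x + B) / 2 := by linarith
  constructor
  · rw [div_le_iff₀ hP0]
    nlinarith
  · rw [le_div_iff₀ hP0]
    set w := A + B with hw
    have hw0 : 0 ≤ w := by linarith
    have e1 : (A - 2 * x + B) / 2 * (P - 1) ≤ w * (w / 2) :=
      mul_le_mul (by linarith) (by linarith) (by linarith) hw0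
    nlinarith [mul_nonneg (sq_nonneg w) (sub_nonneg.2 hP1)]

/-- The function on the sphere that is `exp(-λ|v|²) (1 + |v|²)^((n+1)/2)` in the gnomonic chart of
the upper half sphere, and `0` on the lower half sphere. The second factor compensates the density
of the surface measure. -/
noncomputable def wavePacket (n : ℕ) (lam : ℝ) : USphere (n + 1) → ℂ :=
  (upperHalf n).indicator fun w =>
    ((Real.exp (-lam * (((w : Space (n + 1)) 0)⁻¹ ^ 2 - 1)) *
      ((w : Space (n + 1)) 0)⁻¹ ^ (n + 1) : ℝ) : ℂ)

theorem measurable_wavePacket (n : ℕ) (lam : ℝ) : Measurable (wavePacket n lam) :=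
  Measurable.indicator (by fun_prop) (measurableSet_upperHalf n)

theorem wavePacket_gnomonic {n : ℕ} (lam : ℝ) (v : Space n) :
    wavePacket n lam (gnomonic v) =
      ((Real.exp (-lam * ‖v‖ ^ 2) * Real.sqrt (1 + ‖v‖ ^ 2) ^ (n + 1) : ℝ) : ℂ) := by
  rw [wavePacket, Set.indicator_of_mem (gnomonic_mem_upperHalf v), gnomonic_zero_coord, inv_inv,
    Real.sq_sqrt (by positivity), add_sub_cancel_left]

/-- The Gaussian absorbs the power of `1 + |v|²` as soon as `λ ≥ n + 1`. -/
theorem exp_mul_sqrt_pow_le_one {n : ℕ} {lam : ℝ} (hlam : (n : ℝ) + 1 ≤ lam) (v : Space n) :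
    Real.exp (-lam * ‖v‖ ^ 2) * Real.sqrt (1 + ‖v‖ ^ 2) ^ (n + 1) ≤ 1 := by
  have h1 : Real.sqrt (1 + ‖v‖ ^ 2) ≤ Real.exp (‖v‖ ^ 2) := by
    have h2 := Real.add_one_le_exp (‖v‖ ^ 2)
    refine le_trans ?_ h2
    rw [Real.sqrt_le_left (by positivity)]
    nlinarith [sq_nonneg ‖v‖]
  calc _ ≤ Real.exp (-lam * ‖v‖ ^ 2) * Real.exp (‖v‖ ^ 2) ^ (n + 1) := by gcongr
    _ = Real.exp (-(lam - (n + 1)) * ‖v‖ ^ 2) := by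
        rw [← Real.exp_nat_mul, ← Real.exp_add]; congr 1; push_cast; ring
    _ ≤ 1 := Real.exp_le_one_iff.2 (by
        have := mul_nonneg (by linarith : 0 ≤ lam - (n + 1)) (sq_nonneg ‖v‖); linarith)

theorem norm_wavePacket_gnomonic {n : ℕ} (lam : ℝ) (v : Space n) :
    ‖wavePacket n lam (gnomonic v)‖ =
      Real.exp (-lam * ‖v‖ ^ 2) * Real.sqrt (1 + ‖v‖ ^ 2) ^ (n + 1) := by
  rw [wavePacket_gnomonic, Complex.norm_real, Real.norm_eq_abs, abs_of_nonneg (by positivity)]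

theorem norm_wavePacket_le_one {n : ℕ} {lam : ℝ} (hlam : (n : ℝ) + 1 ≤ lam)
    (w : USphere (n + 1)) : ‖wavePacket n lam w‖ ≤ 1 := by
  by_cases hw : w ∈ upperHalf n
  · obtain ⟨u, rfl⟩ := exists_gnomonic hw
    rw [norm_wavePacket_gnomonic]
    exact exp_mul_sqrt_pow_le_one hlam u
  · rw [wavePacket, Set.indicator_of_notMem hw, norm_zero]
    exact zero_le_one

theorem integrable_exp_neg_mul_sq_norm {n : ℕ} {b : ℝ} (hb : 0 < b) :
    Integrable fun v : Space n => Real.exp (-b * ‖v‖ ^ 2) := by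
  have h := GaussianFourier.integrable_cexp_neg_mul_sq_norm_add (V := Space n) (b := (b : ℂ))
    (by simpa using hb) 0 0
  have h2 := h.norm
  refine h2.congr (Filter.Eventually.of_forall fun v => ?_)
  simp only [Complex.norm_exp]
  congr 1
  simp [← Complex.ofReal_pow]

theorem lintegral_exp_neg_mul_sq_norm {n : ℕ} {b : ℝ} (hb : 0 < b) :
    ∫⁻ v : Space n, ENNReal.ofReal (Real.exp (-b * ‖v‖ ^ 2)) =
      ENNReal.ofReal ((Real.pi / b) ^ ((n : ℝ) / 2)) := by
  rw [← ofReal_integral_eq_lintegral_ofReal (integrable_exp_neg_mul_sq_norm hb)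
    (Filter.Eventually.of_forall fun v => (Real.exp_pos _).le),
    GaussianFourier.integral_rexp_neg_mul_sq_norm hb, finrank_euclideanSpace_fin]

/-- As `|f| ≤ 1` and `p ≥ 2`, it suffices to integrate `|f|²`. One of the two factors absorbs the
power of `1 + |v|²`. -/
theorem eLpNorm_wavePacket_le {n : ℕ} {lam : ℝ} (hlam : (n : ℝ) + 1 ≤ lam) {p : ℝ≥0∞}
    (hp : 2 ≤ p) : eLpNorm (wavePacket n lam) p (sphereMeasure (n + 1)) ≤
      ENNReal.ofReal (Real.pi ^ ((n : ℝ) / 2) * lam ^ (-((n : ℝ) / 2 * (p⁻¹).toReal))) := by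
  have hn0 : (0 : ℝ) ≤ n := n.cast_nonneg
  have hlam0 : 0 < lam := by linarith
  have hpi : 1 ≤ Real.pi ^ ((n : ℝ) / 2) :=
    Real.one_le_rpow (by linarith [Real.pi_gt_three]) (by positivity)
  rcases eq_or_ne p ⊤ with rfl | hptop
  · rw [eLpNorm_exponent_top]
    refine (eLpNormEssSup_le_of_ae_bound (C := 1)
      (Filter.Eventually.of_forall (norm_wavePacket_le_one hlam))).trans ?_
    refine ENNReal.ofReal_le_ofReal ?_
    simpa using hpi
  · have hp0 : p ≠ 0 := by rintro rfl; simp at hp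
    have hp2 : (2 : ℝ) ≤ p.toReal := by simpa using ENNReal.toReal_mono hptop hp
    rw [eLpNorm_eq_lintegral_rpow_enorm_toReal hp0 hptop]
    have h1 : ∫⁻ w, ‖wavePacket n lam w‖ₑ ^ p.toReal ∂(sphereMeasure (n + 1)) ≤
        ENNReal.ofReal ((Real.pi / lam) ^ ((n : ℝ) / 2)) := by
      calc _ ≤ ∫⁻ w, ‖wavePacket n lam w‖ₑ ^ (2 : ℕ) ∂(sphereMeasure (n + 1)) := by
            refine lintegral_mono fun w => ?_
            rw [← ENNReal.rpow_natCast]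
            refine ENNReal.rpow_le_rpow_of_exponent_ge ?_ (by exact_mod_cast hp2)
            rw [← ofReal_norm]
            exact ENNReal.ofReal_le_one.2 (norm_wavePacket_le_one hlam w)
        _ = ∫⁻ w in upperHalf n, ‖wavePacket n lam w‖ₑ ^ (2 : ℕ) ∂(sphereMeasure (n + 1)) := by
            rw [setLIntegral_eq_of_support_subset]
            intro w hw
            by_contra h
            exact hw (by simp [wavePacket, Set.indicator_of_notMem h])
        _ = ∫⁻ v : Space n, ENNReal.ofReal ((Real.sqrt (1 + ‖v‖ ^ 2))⁻¹ ^ (n + 1)) *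
              ‖wavePacket n lam (gnomonic v)‖ₑ ^ (2 : ℕ) :=
            setLIntegral_upperHalf _ ((measurable_wavePacket n lam).enorm.pow_const _)
        _ ≤ ∫⁻ v : Space n, ENNReal.ofReal (Real.exp (-lam * ‖v‖ ^ 2)) := by
            refine lintegral_mono fun v => ?_
            rw [← ofReal_norm, norm_wavePacket_gnomonic, ← ENNReal.ofReal_pow (by positivity),
              ← ENNReal.ofReal_mul (by positivity)]
            refine ENNReal.ofReal_le_ofReal ?_
            have hs : 0 < Real.sqrt (1 + ‖v‖ ^ 2) := by positivity
            have h3 := exp_mul_sqrt_pow_le_one hlam v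
            calc _ = Real.exp (-lam * ‖v‖ ^ 2) *
                  (Real.exp (-lam * ‖v‖ ^ 2) * Real.sqrt (1 + ‖v‖ ^ 2) ^ (n + 1)) := by
                  rw [inv_pow]; field_simp
              _ ≤ Real.exp (-lam * ‖v‖ ^ 2) * 1 := by gcongr
              _ = _ := mul_one _
        _ = _ := lintegral_exp_neg_mul_sq_norm hlam0
    calc _ ≤ ENNReal.ofReal ((Real.pi / lam) ^ ((n : ℝ) / 2)) ^ (1 / p.toReal) := by gcongr
      _ = ENNReal.ofReal ((Real.pi ^ ((n : ℝ) / 2)) ^ (1 / p.toReal) *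
            lam ^ (-((n : ℝ) / 2 * (p⁻¹).toReal))) := by
          rw [ENNReal.ofReal_rpow_of_pos (by positivity), Real.div_rpow Real.pi_pos.le hlam0.le,
            Real.div_rpow (by positivity) (by positivity), ← Real.rpow_mul hlam0.le,
            Real.rpow_neg hlam0.le, ENNReal.toReal_inv, one_div]
          exact congrArg ENNReal.ofReal (div_eq_mul_inv _ _)
      _ ≤ _ := by
          refine ENNReal.ofReal_le_ofReal ?_
          gcongr
          have : 1 / p.toReal ≤ 1 := by rw [div_le_one (by linarith)]; linarith
          calc _ ≤ (Real.pi ^ ((n : ℝ) / 2)) ^ (1 : ℝ) := Real.rpow_le_rpow_of_exponent_le hpi this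
            _ = _ := Real.rpow_one _

/-! ### Comparison of the kernel with a Gaussian phase -/

/-- The kernel `(1 + X)^(-ρ - iλ)` is close to the phase `e^(-iλY)` if `X` is small and `Y` is close
to `X`. -/
theorem norm_cexp_mul_log_sub_cexp_le {ρ lam X Y : ℝ} (hρ : 0 ≤ ρ) (hlam : 0 ≤ lam) (hX : 0 ≤ X) :
    ‖Complex.exp (-((ρ : ℂ) + Complex.I * lam) * (Real.log (1 + X) : ℝ)) -
      Complex.exp (Complex.I * ((-(lam * Y) : ℝ) : ℂ))‖ ≤
      ρ * X + lam * (X ^ 2 + |X - Y|) := by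
  set L := Real.log (1 + X) with hL
  have hL0 : 0 ≤ L := Real.log_nonneg (by linarith)
  have hLX : L ≤ X := by
    have := Real.log_le_sub_one_of_pos (by linarith : 0 < 1 + X)
    linarith
  have hLX2 : X - X ^ 2 ≤ L := by
    have h1 := Real.one_sub_inv_le_log_of_pos (by linarith : 0 < 1 + X)
    have h2 : X - X ^ 2 ≤ 1 - (1 + X)⁻¹ := by
      have h3 : 1 - (1 + X)⁻¹ = X / (1 + X) := by field_simp; ring
      rw [h3, le_div_iff₀ (by linarith)]
      nlinarith [pow_nonneg hX 3]
    linarith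
  have hLY : |L - Y| ≤ X ^ 2 + |X - Y| := by
    have h1 : |L - X| ≤ X ^ 2 := abs_le.2 ⟨by linarith, by nlinarith⟩
    exact (abs_sub_le L X Y).trans (by linarith)
  have h1 : Complex.exp (-((ρ : ℂ) + Complex.I * lam) * (L : ℝ)) =
      Complex.exp (Complex.I * ((-(lam * L) : ℝ) : ℂ)) * (Real.exp (-(ρ * L)) : ℝ) := by
    rw [Complex.ofReal_exp, ← Complex.exp_add]
    congr 1
    push_cast
    ring
  have h2 : Complex.exp (Complex.I * ((-(lam * L) : ℝ) : ℂ)) =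
      Complex.exp (Complex.I * ((-(lam * Y) : ℝ) : ℂ)) *
        Complex.exp (Complex.I * ((-(lam * (L - Y)) : ℝ) : ℂ)) := by
    rw [← Complex.exp_add]
    congr 1
    push_cast
    ring
  have hu : ∀ x : ℝ, ‖Complex.exp (Complex.I * (x : ℂ))‖ = 1 := fun x => by
    rw [mul_comm]; exact Complex.norm_exp_ofReal_mul_I x
  have e1 : ‖Complex.exp (Complex.I * ((-(lam * L) : ℝ) : ℂ)) * (Real.exp (-(ρ * L)) : ℝ) -
      Complex.exp (Complex.I * ((-(lam * L) : ℝ) : ℂ))‖ ≤ ρ * L := by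
    rw [← mul_sub_one, norm_mul, hu, one_mul, ← Complex.ofReal_one, ← Complex.ofReal_sub,
      Complex.norm_real, Real.norm_eq_abs, abs_le]
    have := Real.add_one_le_exp (-(ρ * L))
    have h3 : Real.exp (-(ρ * L)) ≤ 1 := Real.exp_le_one_iff.2 (by have := mul_nonneg hρ hL0; linarith)
    exact ⟨by linarith, by have := mul_nonneg hρ hL0; linarith⟩
  have e2 : ‖Complex.exp (Complex.I * ((-(lam * L) : ℝ) : ℂ)) -
      Complex.exp (Complex.I * ((-(lam * Y) : ℝ) : ℂ))‖ ≤ lam * |L - Y| := by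
    rw [h2, ← mul_sub_one, norm_mul, hu, one_mul]
    refine (Real.norm_exp_I_mul_ofReal_sub_one_le).trans ?_
    rw [Real.norm_eq_abs, abs_neg, abs_mul, abs_of_nonneg hlam]
  rw [h1]
  refine (norm_sub_le_norm_sub_add_norm_sub _
    (Complex.exp (Complex.I * ((-(lam * L) : ℝ) : ℂ))) _).trans ?_
  exact add_le_add (e1.trans (mul_le_mul_of_nonneg_left hLX hρ))
    (e2.trans (mul_le_mul_of_nonneg_left hLY hlam))

theorem cexp_gaussian_phase_eq {n : ℕ} (lam m : ℝ) (u v : Space n) :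
    ((Real.exp (-lam * ‖v‖ ^ 2) : ℝ) : ℂ) *
        Complex.exp (Complex.I * ((-(lam * (m * ‖u - v‖ ^ 2)) : ℝ) : ℂ)) =
      Complex.exp (Complex.I * ((-(lam * m * ‖u‖ ^ 2) : ℝ) : ℂ)) *
        Complex.exp (-((lam : ℂ) * (1 + Complex.I * m)) * ‖v‖ ^ 2 +
          (2 * Complex.I * lam * m) * ((inner ℝ u v : ℝ) : ℂ)) := by
  rw [Complex.ofReal_exp, ← Complex.exp_add, ← Complex.exp_add, norm_sub_sq_real]
  congr 1
  push_cast
  ring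

/-- The Gaussian integral with the quadratic phase `-λ m |u - v|²`. Completing the square costs a
factor whose modulus is at least `e^(-λ|u|²)`. -/
theorem le_norm_integral_gaussian_phase {n : ℕ} {lam m : ℝ} (hlam : 0 < lam) (hm : 0 ≤ m)
    {u : Space n} (hu : lam * ‖u‖ ^ 2 ≤ 1) :
    Real.exp (-1) * (Real.pi / (lam * (1 + m))) ^ ((n : ℝ) / 2) ≤
      ‖∫ v : Space n, ((Real.exp (-lam * ‖v‖ ^ 2) : ℝ) : ℂ) *
        Complex.exp (Complex.I * ((-(lam * (m * ‖u - v‖ ^ 2)) : ℝ) : ℂ))‖ := by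
  simp only [cexp_gaussian_phase_eq]
  have hb : 0 < ((lam : ℂ) * (1 + Complex.I * m)).re := by simpa using hlam
  rw [integral_const_mul, GaussianFourier.integral_cexp_neg_mul_sq_norm_add hb, norm_mul, norm_mul,
    mul_comm Complex.I, Complex.norm_exp_ofReal_mul_I, one_mul, finrank_euclideanSpace_fin,
    Complex.norm_exp]
  have hnorm : ‖(1 : ℂ) + Complex.I * m‖ ≤ 1 + m := by
    refine (norm_add_le _ _).trans ?_
    simp [abs_of_nonneg hm]
  have hne : (1 : ℂ) + Complex.I * m ≠ 0 := by
    intro h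
    have := congrArg Complex.re h
    simp at this
  have hpow : (Real.pi / (lam * (1 + m))) ^ ((n : ℝ) / 2) ≤
      ‖((Real.pi : ℂ) / ((lam : ℂ) * (1 + Complex.I * m))) ^ ((n : ℂ) / 2)‖ := by
    rw [show ((n : ℂ) / 2) = (((n : ℝ) / 2 : ℝ) : ℂ) by push_cast; rfl, Complex.norm_cpow_real,
      norm_div, norm_mul, Complex.norm_real, Complex.norm_real, Real.norm_eq_abs, Real.norm_eq_abs,
      abs_of_pos Real.pi_pos, abs_of_pos hlam]
    have := norm_pos_iff.2 hne
    have := Real.pi_pos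
    gcongr
  have hexp : -1 ≤ ((2 * Complex.I * lam * m) ^ 2 * ‖u‖ ^ 2 /
      (4 * ((lam : ℂ) * (1 + Complex.I * m)))).re := by
    have hlamc : (lam : ℂ) ≠ 0 := by exact_mod_cast hlam.ne'
    have hden : (1 : ℝ) + m ^ 2 ≠ 0 := by positivity
    have hdenc : (1 : ℂ) + (m : ℂ) ^ 2 ≠ 0 := by exact_mod_cast hden
    have h1 : (2 * Complex.I * lam * m) ^ 2 * ‖u‖ ^ 2 / (4 * ((lam : ℂ) * (1 + Complex.I * m))) =
        ((-(lam * ‖u‖ ^ 2 * (m ^ 2 / (1 + m ^ 2))) : ℝ) : ℂ) +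
          ((lam * ‖u‖ ^ 2 * (m ^ 2 / (1 + m ^ 2)) * m : ℝ) : ℂ) * Complex.I := by
      push_cast
      rw [div_eq_iff (mul_ne_zero (by norm_num) (mul_ne_zero hlamc hne))]
      field_simp
      ring_nf
      simp only [Complex.I_sq]
      ring
    rw [h1]
    simp only [Complex.add_re, Complex.ofReal_re, Complex.re_ofReal_mul, Complex.I_re, mul_zero,
      add_zero]
    have h2 : m ^ 2 / (1 + m ^ 2) ≤ 1 := by rw [div_le_one (by positivity)]; linarith
    have h3 : 0 ≤ m ^ 2 / (1 + m ^ 2) := by positivity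
    have h4 : 0 ≤ lam * ‖u‖ ^ 2 := by positivity
    nlinarith
  rw [mul_comm]
  exact mul_le_mul hpow (Real.exp_le_exp.2 hexp) (Real.exp_pos _).le (norm_nonneg _)

theorem one_add_sq_le_exp {V : ℝ} (hV : 0 ≤ V) : (1 + V) ^ 2 ≤ 16 * Real.exp (V / 2) := by
  have h1 := Real.add_one_le_exp (V / 4)
  have h2 : Real.exp (V / 2) = Real.exp (V / 4) ^ 2 := by
    rw [← Real.exp_nat_mul]; congr 1; push_cast; ring
  rw [h2]
  have h3 := pow_le_pow_left₀ (by linarith) h1 2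
  nlinarith

/-- For `λ|u|² ≤ 1` and `|v|² ∼ 1 / λ`, the kernel differs from the Gaussian phase by
`O((1 + M)² / λ)`. -/
theorem norm_kernel_sub_gaussian_le {n : ℕ} {lam M : ℝ} (hlam : 0 < lam) (hM : 0 ≤ M)
    {u : Space n} (hu : lam * ‖u‖ ^ 2 ≤ 1) (v : Space n) :
    ‖Complex.exp (-((n : ℂ) / 2 + Complex.I * lam) * (Real.log (1 + M *
        (1 - inner ℝ (gnomonic u : Space (n + 1)) (gnomonic v : Space (n + 1)))) : ℝ)) -
      Complex.exp (Complex.I * ((-(lam * (M / 2 * ‖u - v‖ ^ 2)) : ℝ) : ℂ))‖ ≤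
      16 * ((n : ℝ) / 2 + 1) * (1 + M) ^ 2 / lam * Real.exp (lam * ‖v‖ ^ 2 / 2) := by
  have hn0 : (0 : ℝ) ≤ n := n.cast_nonneg
  obtain ⟨h1, h2⟩ := one_sub_inner_gnomonic_bounds u v
  have h0 : 0 ≤ 1 - inner ℝ (gnomonic u : Space (n + 1)) (gnomonic v : Space (n + 1)) := by
    linarith [inner_usphere_le_one (gnomonic u) (gnomonic v)]
  set τ := 1 - inner ℝ (gnomonic u : Space (n + 1)) (gnomonic v : Space (n + 1)) with hτ
  set w := ‖u‖ ^ 2 + ‖v‖ ^ 2 with hw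
  have hw0 : 0 ≤ w := by positivity
  have hZ : ‖u - v‖ ^ 2 / 2 ≤ w := by
    have h3 := norm_sub_le u v
    have h4 := pow_le_pow_left₀ (norm_nonneg _) h3 2
    nlinarith [sq_nonneg (‖u‖ - ‖v‖)]
  have h := norm_cexp_mul_log_sub_cexp_le (ρ := (n : ℝ) / 2) (lam := lam) (X := M * τ)
    (Y := M / 2 * ‖u - v‖ ^ 2) (by positivity) hlam.le (by positivity)
  push_cast at h ⊢
  refine h.trans ?_
  have hX : M * τ ≤ M * w := mul_le_mul_of_nonneg_left (h1.trans hZ) hM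
  have hX0 : 0 ≤ M * τ := by positivity
  have hXY : |M * τ - M / 2 * ‖u - v‖ ^ 2| ≤ M * w ^ 2 := by
    rw [show M * τ - M / 2 * ‖u - v‖ ^ 2 = -(M * (‖u - v‖ ^ 2 / 2 - τ)) by ring, abs_neg,
      abs_of_nonneg (mul_nonneg hM (by linarith))]
    exact mul_le_mul_of_nonneg_left (by linarith) hM
  set V := lam * ‖v‖ ^ 2 with hV
  have hV0 : 0 ≤ V := by positivity
  have hwV : lam * w ≤ 1 + V := by rw [hw, mul_add]; linarith
  have hexp := one_add_sq_le_exp hV0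
  have hstep : lam * ((n : ℝ) / 2 * (M * τ) + lam * ((M * τ) ^ 2 +
      |M * τ - M / 2 * ‖u - v‖ ^ 2|)) ≤ ((n : ℝ) / 2 + 1) * (1 + M) ^ 2 * (1 + V) ^ 2 := by
    have hlw0 : 0 ≤ lam * w := by positivity
    have e1 : (lam * w) ^ 2 ≤ (1 + V) ^ 2 := pow_le_pow_left₀ hlw0 hwV 2
    have e2 : lam * w ≤ (1 + V) ^ 2 := by nlinarith
    have e3 : (M * τ) ^ 2 ≤ (M * w) ^ 2 := pow_le_pow_left₀ hX0 hX 2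
    calc lam * ((n : ℝ) / 2 * (M * τ) + lam * ((M * τ) ^ 2 + |M * τ - M / 2 * ‖u - v‖ ^ 2|))
        ≤ lam * ((n : ℝ) / 2 * (M * w) + lam * ((M * w) ^ 2 + M * w ^ 2)) := by gcongr
      _ = (n : ℝ) / 2 * M * (lam * w) + (M ^ 2 + M) * (lam * w) ^ 2 := by ring
      _ ≤ (n : ℝ) / 2 * (1 + M) ^ 2 * (1 + V) ^ 2 + (1 + M) ^ 2 * (1 + V) ^ 2 := by
          have e4 : M ≤ (1 + M) ^ 2 := by nlinarith
          have e5 : M ^ 2 + M ≤ (1 + M) ^ 2 := by nlinarith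
          gcongr
      _ = _ := by ring
  have hfin : lam * ((n : ℝ) / 2 * (M * τ) + lam * ((M * τ) ^ 2 +
      |M * τ - M / 2 * ‖u - v‖ ^ 2|)) ≤
      ((n : ℝ) / 2 + 1) * (1 + M) ^ 2 * (16 * Real.exp (V / 2)) :=
    hstep.trans (by gcongr)
  refine le_of_mul_le_mul_left (hfin.trans_eq ?_) hlam
  field_simp

/-! ### The extension of a wave packet -/

/-- The second factor of the wave packet cancels the density of the surface measure. -/
theorem integral_wavePacket_mul {n : ℕ} (lam : ℝ) (g : USphere (n + 1) → ℂ) (hg : Measurable g) :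
    ∫ w, wavePacket n lam w * g w ∂(sphereMeasure (n + 1)) =
      ∫ v : Space n, ((Real.exp (-lam * ‖v‖ ^ 2) : ℝ) : ℂ) * g (gnomonic v) := by
  have h1 : ∫ w, wavePacket n lam w * g w ∂(sphereMeasure (n + 1)) =
      ∫ w in upperHalf n, wavePacket n lam w * g w ∂(sphereMeasure (n + 1)) := by
    rw [setIntegral_eq_integral_of_forall_compl_eq_zero]
    intro w hw
    rw [wavePacket, Set.indicator_of_notMem hw, zero_mul]
  rw [h1]
  refine (setIntegral_upperHalf (fun w => wavePacket n lam w * g w)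
    ((measurable_wavePacket n lam).mul hg)).trans ?_
  refine integral_congr_ae (Filter.Eventually.of_forall fun v => ?_)
  have hs : Real.sqrt (1 + ‖v‖ ^ 2) ≠ 0 := by positivity
  simp only [wavePacket_gnomonic]
  rw [← mul_assoc, ← Complex.ofReal_mul]
  congr 2
  rw [inv_pow]
  field_simp

/-- The quantity that `λ` has to exceed, up to a power of `e^r`, for the Gaussian approximation of
the wave packet to be accurate. -/
noncomputable def packetThreshold (n : ℕ) : ℝ :=
  32 * Real.exp 1 * ((n : ℝ) / 2 + 1) * 2 ^ ((n : ℝ) / 2) + ((n : ℝ) + 1)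

theorem packetThreshold_pos (n : ℕ) : 0 < packetThreshold n := by
  unfold packetThreshold; positivity

/-- With `M = (e^(2r) - 1) / 2`, the kernel is `e^(s r) (1 + M (1 - ⟪θ, ω⟫))^(-s)`. The Gaussian
integral that approximates the integral has a size `(λ (1 + M / 2))^(-ρ)`, where
`1 + M / 2 ≤ e^(2r)`. -/
theorem le_norm_integral_wavePacket {n : ℕ} {lam r : ℝ} (hr : 0 ≤ r)
    (hlam : packetThreshold n * Real.exp (((n : ℝ) + 4) * r) ≤ lam) {u : Space n}
    (hu : lam * ‖u‖ ^ 2 ≤ 1) :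
    Real.exp (-1) / 2 * (Real.pi / lam) ^ ((n : ℝ) / 2) * Real.exp (-((n : ℝ) / 2 * r)) ≤
      ‖∫ w, wavePacket n lam w * Complex.exp (-((n : ℂ) / 2 + Complex.I * lam) *
          (Real.log (mink (polarPoint r (gnomonic u) : Minkowski (n + 1)) (lightRay w)) : ℝ))
            ∂(sphereMeasure (n + 1))‖ := by
  have hn0 : (0 : ℝ) ≤ n := n.cast_nonneg
  have hlam0 : 0 < lam := lt_of_lt_of_le (by have := packetThreshold_pos n; positivity) hlam
  set z : ℂ := (n : ℂ) / 2 + Complex.I * lam with hz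
  set M := (Real.exp (2 * r) - 1) / 2 with hM
  have he1 : 1 ≤ Real.exp (2 * r) := Real.one_le_exp (by linarith)
  have hM0 : 0 ≤ M := by linarith
  have hM1 : 1 + M ≤ Real.exp (2 * r) := by linarith
  set K : Space n → ℂ := fun v => Complex.exp (-z * (Real.log (1 + M *
        (1 - inner ℝ (gnomonic u : Space (n + 1)) (gnomonic v : Space (n + 1)))) : ℝ)) with hK
  set G : Space n → ℂ := fun v =>
    Complex.exp (Complex.I * ((-(lam * (M / 2 * ‖u - v‖ ^ 2)) : ℝ) : ℂ)) with hG
  rw [integral_wavePacket_mul lam (fun w => Complex.exp (-z * (Real.log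
    (mink (polarPoint r (gnomonic u) : Minkowski (n + 1)) (lightRay w)) : ℝ)))
    (by have := measurable_log_mink (polarPoint r (gnomonic u)); fun_prop)]
  have hint : ∀ v : Space n, ((Real.exp (-lam * ‖v‖ ^ 2) : ℝ) : ℂ) * Complex.exp (-z * (Real.log
      (mink (polarPoint r (gnomonic u) : Minkowski (n + 1)) (lightRay (gnomonic v))) : ℝ)) =
      Complex.exp (z * r) * (((Real.exp (-lam * ‖v‖ ^ 2) : ℝ) : ℂ) * K v) := by
    intro v
    rw [log_mink_polarPoint r _ _ hr, hK, mul_left_comm, ← Complex.exp_add]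
    congr 2
    push_cast
    ring
  simp only [hint]
  rw [integral_const_mul, norm_mul, Complex.norm_exp]
  have hre : (z * r).re = (n : ℝ) / 2 * r := by simp [hz]
  rw [hre]
  have hmain := le_norm_integral_gaussian_phase (m := M / 2) hlam0 (by positivity) hu
  have hgi := integrable_exp_neg_mul_sq_norm (n := n) hlam0
  have hKm : Measurable K := by
    have h1 : Measurable fun v : Space n => inner ℝ (gnomonic u : Space (n + 1))
        (gnomonic v : Space (n + 1)) :=
      (by fun_prop : Measurable fun w : USphere (n + 1) =>
        inner ℝ (gnomonic u : Space (n + 1)) (w : Space (n + 1))).comp measurable_gnomonic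
    fun_prop
  have hlog : ∀ v : Space n, 0 ≤ Real.log (1 + M *
        (1 - inner ℝ (gnomonic u : Space (n + 1)) (gnomonic v : Space (n + 1)))) := fun v =>
    Real.log_nonneg (by
      have := mul_nonneg hM0 (sub_nonneg.2 (inner_usphere_le_one (gnomonic u) (gnomonic v)))
      linarith)
  have hKi : Integrable fun v : Space n => ((Real.exp (-lam * ‖v‖ ^ 2) : ℝ) : ℂ) * K v := by
    refine hgi.mono' (by fun_prop) (Filter.Eventually.of_forall fun v => ?_)
    rw [norm_mul, Complex.norm_real, Real.norm_eq_abs, abs_of_pos (Real.exp_pos _),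
      Complex.norm_exp]
    refine mul_le_of_le_one_right (Real.exp_pos _).le (Real.exp_le_one_iff.2 ?_)
    have h2 : (-z * (Real.log (1 + M *
        (1 - inner ℝ (gnomonic u : Space (n + 1)) (gnomonic v : Space (n + 1)))) : ℝ)).re =
        -((n : ℝ) / 2 * Real.log (1 + M *
        (1 - inner ℝ (gnomonic u : Space (n + 1)) (gnomonic v : Space (n + 1))))) := by
      rw [Complex.re_mul_ofReal]
      simp [hz]
    rw [h2]
    have := mul_nonneg (by positivity : 0 ≤ (n : ℝ) / 2) (hlog v)
    linarith
  have hGi : Integrable fun v : Space n => ((Real.exp (-lam * ‖v‖ ^ 2) : ℝ) : ℂ) * G v := by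
    refine hgi.mono' (by fun_prop) (Filter.Eventually.of_forall fun v => ?_)
    rw [norm_mul, Complex.norm_real, Real.norm_eq_abs, abs_of_pos (Real.exp_pos _)]
    simp only [hG]
    rw [mul_comm Complex.I, Complex.norm_exp_ofReal_mul_I, mul_one]
  have herr : ‖(∫ v : Space n, ((Real.exp (-lam * ‖v‖ ^ 2) : ℝ) : ℂ) * K v) -
      ∫ v : Space n, ((Real.exp (-lam * ‖v‖ ^ 2) : ℝ) : ℂ) * G v‖ ≤
      16 * ((n : ℝ) / 2 + 1) * (1 + M) ^ 2 / lam * (Real.pi / (lam / 2)) ^ ((n : ℝ) / 2) := by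
    rw [← integral_sub hKi hGi]
    have hgi2 := integrable_exp_neg_mul_sq_norm (n := n) (by positivity : 0 < lam / 2)
    refine (norm_integral_le_of_norm_le (hgi2.const_mul
      (16 * ((n : ℝ) / 2 + 1) * (1 + M) ^ 2 / lam)) (Filter.Eventually.of_forall fun v => ?_)).trans ?_
    · rw [← mul_sub, norm_mul, Complex.norm_real, Real.norm_eq_abs, abs_of_pos (Real.exp_pos _)]
      have h3 := norm_kernel_sub_gaussian_le hlam0 hM0 hu v
      calc _ ≤ Real.exp (-lam * ‖v‖ ^ 2) * (16 * ((n : ℝ) / 2 + 1) * (1 + M) ^ 2 / lam *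
            Real.exp (lam * ‖v‖ ^ 2 / 2)) := by gcongr
        _ = 16 * ((n : ℝ) / 2 + 1) * (1 + M) ^ 2 / lam * (Real.exp (-lam * ‖v‖ ^ 2) *
            Real.exp (lam * ‖v‖ ^ 2 / 2)) := by ring
        _ = _ := by
            rw [← Real.exp_add]; congr 2; ring
    · rw [integral_const_mul, GaussianFourier.integral_rexp_neg_mul_sq_norm (by positivity),
        finrank_euclideanSpace_fin]
  set ρ := (n : ℝ) / 2 with hρ
  have hρ0 : 0 ≤ ρ := by positivity
  set Q := (Real.pi / lam) ^ ρ with hQ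
  have hQ0 : 0 < Q := by have := Real.pi_pos; positivity
  have hpiM : Real.exp (-(2 * ρ * r)) * Q ≤ (Real.pi / (lam * (1 + M / 2))) ^ ρ := by
    have h4 : Real.pi / (lam * (1 + M / 2)) = (1 + M / 2)⁻¹ * (Real.pi / lam) := by field_simp
    rw [h4, Real.mul_rpow (by positivity) (by have := Real.pi_pos; positivity)]
    refine mul_le_mul_of_nonneg_right ?_ hQ0.le
    have h5 : Real.exp (-(2 * r)) ≤ (1 + M / 2)⁻¹ := by
      rw [Real.exp_neg]
      exact inv_anti₀ (by positivity) (by linarith)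
    calc Real.exp (-(2 * ρ * r)) = Real.exp (-(2 * r)) ^ ρ := by
          rw [← Real.exp_mul]; congr 1; ring
      _ ≤ _ := Real.rpow_le_rpow (Real.exp_pos _).le h5 hρ0
  have hpi2 : (Real.pi / (lam / 2)) ^ ρ = 2 ^ ρ * Q := by
    rw [hQ, ← Real.mul_rpow (by norm_num) (by have := Real.pi_pos; positivity)]
    congr 1
    field_simp
  -- the threshold makes the error at most half of the main term
  have hsmall : 16 * (ρ + 1) * (1 + M) ^ 2 / lam * (2 ^ ρ * Q) ≤
      Real.exp (-1) / 2 * (Real.exp (-(2 * ρ * r)) * Q) := by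
    have h6 : 32 * Real.exp 1 * (ρ + 1) * 2 ^ ρ * Real.exp ((2 * ρ + 4) * r) ≤ lam := by
      refine le_trans ?_ hlam
      have h7 : ((n : ℝ) + 4) = 2 * ρ + 4 := by rw [hρ]; ring
      rw [h7]
      refine mul_le_mul_of_nonneg_right ?_ (Real.exp_pos _).le
      unfold packetThreshold
      rw [← hρ]
      linarith
    have h8 : (1 + M) ^ 2 ≤ Real.exp (4 * r) := by
      calc (1 + M) ^ 2 ≤ Real.exp (2 * r) ^ 2 := pow_le_pow_left₀ (by linarith) hM1 2
        _ = _ := by rw [← Real.exp_nat_mul]; congr 1; push_cast; ring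
    have h9 : Real.exp ((2 * ρ + 4) * r) = Real.exp (4 * r) * Real.exp (2 * ρ * r) := by
      rw [← Real.exp_add]; congr 1; ring
    rw [div_mul_eq_mul_div, div_le_iff₀ hlam0]
    calc 16 * (ρ + 1) * (1 + M) ^ 2 * (2 ^ ρ * Q)
        ≤ 16 * (ρ + 1) * Real.exp (4 * r) * (2 ^ ρ * Q) := by gcongr
      _ = Real.exp (-1) / 2 * (Real.exp (-(2 * ρ * r)) * Q) *
          (32 * Real.exp 1 * (ρ + 1) * 2 ^ ρ * Real.exp ((2 * ρ + 4) * r)) := by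
          rw [h9, Real.exp_neg, Real.exp_neg]
          field_simp
          ring
      _ ≤ _ := by gcongr
  rw [hpi2] at herr
  have htri := norm_sub_norm_le (∫ v : Space n, ((Real.exp (-lam * ‖v‖ ^ 2) : ℝ) : ℂ) * G v)
    (∫ v : Space n, ((Real.exp (-lam * ‖v‖ ^ 2) : ℝ) : ℂ) * K v)
  rw [norm_sub_rev] at htri
  have hlow : Real.exp (-1) / 2 * (Real.exp (-(2 * ρ * r)) * Q) ≤
      ‖∫ v : Space n, ((Real.exp (-lam * ‖v‖ ^ 2) : ℝ) : ℂ) * K v‖ := by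
    have h10 := mul_le_mul_of_nonneg_left hpiM (Real.exp_pos (-1)).le
    linarith
  calc _ = Real.exp (ρ * r) * (Real.exp (-1) / 2 * (Real.exp (-(2 * ρ * r)) * Q)) := by
        have : Real.exp (-(ρ * r)) = Real.exp (ρ * r) * Real.exp (-(2 * ρ * r)) := by
          rw [← Real.exp_add]; congr 1; ring
        rw [this]; ring
    _ ≤ _ := by gcongr

/-- A wave packet is carried by a cone over a cap of radius `λ^(-1/2)`, where it decays no faster
than `e^(-ρ r)`. -/
theorem exists_le_norm_extension_wavePacket (n : ℕ) : ∃ c : ℝ, 0 < c ∧ ∀ lam r : ℝ, 1 ≤ lam →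
    0 ≤ r → packetThreshold n * Real.exp (((n : ℝ) + 4) * r) ≤ lam →
    ∀ θ ∈ cap n (lam ^ (-(1 / 2) : ℝ)), c * Real.exp (-((n : ℝ) / 2 * r)) ≤
      ‖extension (n + 1) lam (wavePacket n lam) (polarPoint r θ)‖ := by
  obtain ⟨a, b, ha, hb, hc⟩ := exists_harishChandra_bounds n
  have hσ0 := sphereMeasure_univ_pos n
  set σ := (sphereMeasure (n + 1)).real Set.univ with hσ
  have hpi := Real.pi_pos
  refine ⟨a * σ⁻¹ * (Real.exp (-1) / 2 * Real.pi ^ ((n : ℝ) / 2)), by positivity,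
    fun lam r hlam hr hthr θ hθ => ?_⟩
  have hlam0 : 0 < lam := by linarith
  obtain ⟨u, rfl⟩ := exists_gnomonic (cap_subset_upperHalf _ _ hθ)
  have hu := norm_le_of_gnomonic_mem_cap (by positivity) hθ
  have hu2 : lam * ‖u‖ ^ 2 ≤ 1 := by
    have h1 := pow_le_pow_left₀ (norm_nonneg u) hu 2
    rw [← Real.rpow_natCast (lam ^ _), ← Real.rpow_mul hlam0.le] at h1
    norm_num at h1
    rw [Real.rpow_neg_one] at h1
    calc _ ≤ lam * lam⁻¹ := by gcongr
      _ = 1 := mul_inv_cancel₀ hlam0.ne'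
  have h2 := le_norm_integral_wavePacket hr hthr hu2
  rw [norm_extension]
  have h3 := (hc lam hlam).1
  calc _ = a * lam ^ ((n : ℝ) / 2) * σ⁻¹ * (Real.exp (-1) / 2 * (Real.pi / lam) ^ ((n : ℝ) / 2) *
        Real.exp (-((n : ℝ) / 2 * r))) := by
        rw [Real.div_rpow hpi.le hlam0.le]
        field_simp
    _ ≤ _ := by gcongr

/-! ### The lower bound from wave packets -/

/-- A function bounded below by `c e^(-ρ r)` on a set of polar coordinates: the `q`-th power of its
norm is bounded below by the integral of `e^(-ρ (q-2) r)`, since the density is of size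
`e^(2 ρ r)`. -/
theorem le_lintegral_enorm_rpow_of_le_polarPoint {n : ℕ} {G : hyperboloid (n + 1) → ℂ}
    (hG : Measurable G) {A : Set (USphere (n + 1))} (hA : MeasurableSet A) {T : Set ℝ}
    (hT : MeasurableSet T) (hT1 : ∀ r ∈ T, 1 ≤ r) {c t : ℝ} (hc : 0 ≤ c) (ht : 0 ≤ t)
    (h : ∀ θ ∈ A, ∀ r ∈ T, c * Real.exp (-((n : ℝ) / 2 * r)) ≤ ‖G (polarPoint r θ)‖) :
    ENNReal.ofReal ((1 / 4) ^ n * c ^ t) *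
        (∫⁻ r in T, ENNReal.ofReal (Real.exp (-((n : ℝ) / 2 * (t - 2) * r)))) *
          sphereMeasure (n + 1) A ≤
      ∫⁻ x, ‖G x‖ₑ ^ t ∂(hypMeasure (n + 1)) := by
  rw [lintegral_hypMeasure_polar _ (hG.enorm.pow_const t), ← setLIntegral_const]
  refine (setLIntegral_mono' hA fun θ hθ => ?_).trans (setLIntegral_le_lintegral A _)
  rw [← lintegral_const_mul _ (by fun_prop)]
  have hTI : T ⊆ Set.Ioi 0 := fun r hr => lt_of_lt_of_le one_pos (hT1 r hr)
  refine le_trans (setLIntegral_mono' hT fun r hr => ?_) (lintegral_mono_set hTI)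
  have h1 := h θ hθ r hr
  have h2 := pow_le_pow_left₀ (by positivity) (exp_div_four_le_sinh (hT1 r hr)) n
  rw [← ofReal_norm, ENNReal.ofReal_rpow_of_nonneg (norm_nonneg _) ht,
    ← ENNReal.ofReal_mul (le_trans (by positivity : (0 : ℝ) ≤ (Real.exp r / 4) ^ n) h2),
    ← ENNReal.ofReal_mul (by positivity : 0 ≤ (1 / 4) ^ n * c ^ t)]
  refine ENNReal.ofReal_le_ofReal ?_
  calc (1 / 4) ^ n * c ^ t * Real.exp (-((n : ℝ) / 2 * (t - 2) * r))
      = (Real.exp r / 4) ^ n * (c * Real.exp (-((n : ℝ) / 2 * r))) ^ t := by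
        rw [Real.mul_rpow hc (Real.exp_pos _).le, ← Real.exp_mul, div_eq_mul_one_div (Real.exp r),
          mul_pow, ← Real.exp_nat_mul]
        rw [show -((n : ℝ) / 2 * (t - 2) * r) = n * r + -((n : ℝ) / 2 * r) * t by ring,
          Real.exp_add]
        ring
    _ ≤ _ := mul_le_mul h2 (Real.rpow_le_rpow (by positivity) h1 ht) (by positivity)
        (le_trans (by positivity) h2)

/-- A lower bound for `κ^(1/t)` that does not depend on `t`. -/
theorem min_one_le_rpow_one_div {κ t : ℝ} (hκ : 0 < κ) (ht : 1 ≤ t) : min κ 1 ≤ κ ^ (1 / t) := by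
  have h0 : 0 < min κ 1 := lt_min hκ one_pos
  calc min κ 1 = min κ 1 ^ (1 : ℝ) := (Real.rpow_one _).symm
    _ ≤ min κ 1 ^ (1 / t) := Real.rpow_le_rpow_of_exponent_ge h0 (min_le_right _ _)
        (by rw [div_le_one (by linarith)]; exact ht)
    _ ≤ _ := Real.rpow_le_rpow h0.le (min_le_left _ _) (by positivity)

theorem ofReal_le_eLpNorm_of_le_lintegral {α : Type*} [MeasurableSpace α] {μ : Measure α}
    {g : α → ℂ} {q : ℝ≥0∞} (hq0 : q ≠ 0) (hq : q ≠ ⊤) {a : ℝ} (ha : 0 ≤ a)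
    (h : ENNReal.ofReal (a ^ q.toReal) ≤ ∫⁻ x, ‖g x‖ₑ ^ q.toReal ∂μ) :
    ENNReal.ofReal a ≤ eLpNorm g q μ := by
  have ht : 0 < q.toReal := ENNReal.toReal_pos hq0 hq
  rw [eLpNorm_eq_lintegral_rpow_enorm_toReal hq0 hq]
  calc ENNReal.ofReal a = ENNReal.ofReal (a ^ q.toReal) ^ (1 / q.toReal) := by
        rw [ENNReal.ofReal_rpow_of_nonneg (by positivity) (by positivity), ← Real.rpow_mul ha,
          mul_one_div_cancel ht.ne', Real.rpow_one]
    _ ≤ _ := by gcongr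

theorem two_lt_toReal {q : ℝ≥0∞} (hq2 : 2 < q) (hq : q ≠ ⊤) : 2 < q.toReal := by
  simpa using (ENNReal.toReal_lt_toReal (by norm_num : (2 : ℝ≥0∞) ≠ ⊤) hq).2 hq2

/-- The lower bound for the norm given by wave packets, if `λ` is large compared to
`e^(C / (q - 2))`: the packet has to survive up to the radius `1 + 1 / (q - 2)`. -/
theorem exists_le_extensionNorm_wavePacket (n : ℕ) : ∃ c : ℝ, 0 < c ∧ ∀ lam : ℝ, 1 ≤ lam →
    ∀ p q : ℝ≥0∞, 2 ≤ p → 2 < q → q ≠ ⊤ →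
    packetThreshold n * Real.exp (((n : ℝ) + 4) * (1 + 1 / (q.toReal - 2))) ≤ lam →
    ENNReal.ofReal (c * ((q.toReal - 2) ^ (-(1 / q.toReal)) *
      lam ^ ((n : ℝ) / 2 * (p⁻¹).toReal - (n : ℝ) / 2 * (q⁻¹).toReal))) ≤
        extensionNorm (n + 1) lam p q := by
  obtain ⟨c, hc, hE⟩ := exists_le_norm_extension_wavePacket n
  obtain ⟨κ, hκ, hcap⟩ := exists_cap_measure_ge n
  have hpi := Real.pi_pos
  set m := min ((1 / 4) ^ n * κ) 1 with hm
  have hm0 : 0 < m := lt_min (by positivity) one_pos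
  refine ⟨m * c * Real.exp (-((n : ℝ) / 2)) / Real.pi ^ ((n : ℝ) / 2), by positivity,
    fun lam hlam p q hp hq2 hq hthr => ?_⟩
  have hlam0 : 0 < lam := by linarith
  have ht := two_lt_toReal hq2 hq
  have hqi : (q⁻¹).toReal = 1 / q.toReal := by rw [ENNReal.toReal_inv, one_div]
  rw [hqi]
  set t := q.toReal with htdef
  have ht2 : 0 < t - 2 := by linarith
  have ht0 : 0 < t := by linarith
  set ρ := (n : ℝ) / 2 with hρ
  have hρ0 : 0 ≤ ρ := by positivity
  -- on `[1, R]`, an interval of length `1 / (t - 2)`, `e^(-ρ (t - 2) r)` is at least `e^(-ρ (t - 1))`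
  set R := 1 + 1 / (t - 2) with hR
  have hR1 : 1 ≤ R := by have : 0 < 1 / (t - 2) := by positivity
                         linarith
  have hthr1 : (n : ℝ) + 1 ≤ lam := by
    have h1 : packetThreshold n * 1 ≤ packetThreshold n * Real.exp (((n : ℝ) + 4) * R) := by
      have := (packetThreshold_pos n).le
      gcongr
      exact Real.one_le_exp (by positivity)
    have h2 : (n : ℝ) + 1 ≤ packetThreshold n := by
      unfold packetThreshold
      have : (0 : ℝ) ≤ 32 * Real.exp 1 * ((n : ℝ) / 2 + 1) * 2 ^ ((n : ℝ) / 2) := by positivity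
      linarith
    linarith
  have hε0 : 0 < lam ^ (-(1 / 2) : ℝ) := by positivity
  have hε1 : lam ^ (-(1 / 2) : ℝ) ≤ 1 := Real.rpow_le_one_of_one_le_of_nonpos hlam (by norm_num)
  have hεn : (lam ^ (-(1 / 2) : ℝ)) ^ n = lam ^ (-ρ) := by
    rw [← Real.rpow_natCast, ← Real.rpow_mul hlam0.le]; congr 1; rw [hρ]; ring
  have hσ := hcap _ hε0 hε1
  rw [hεn] at hσ
  have hlow := le_lintegral_enorm_rpow_of_le_polarPoint (t := t)
    (measurable_extension (n + 1) lam _ (measurable_wavePacket n lam))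
    (measurableSet_cap n (lam ^ (-(1 / 2) : ℝ))) (measurableSet_Icc (a := 1) (b := R))
    (fun r hr => hr.1) hc.le ht0.le (fun θ hθ r hr => hE lam r hlam (by linarith [hr.1]) (by
      refine le_trans ?_ hthr
      have := (packetThreshold_pos n).le
      gcongr
      exact hr.2) θ hθ)
  rw [← hρ] at hlow
  have hint : ENNReal.ofReal (Real.exp (-(ρ * (t - 1))) * (t - 2)⁻¹) ≤
      ∫⁻ r in Set.Icc 1 R, ENNReal.ofReal (Real.exp (-(ρ * (t - 2) * r))) := by
    calc _ = ∫⁻ r in Set.Icc 1 R, ENNReal.ofReal (Real.exp (-(ρ * (t - 1)))) := by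
          rw [setLIntegral_const, Real.volume_Icc, ENNReal.ofReal_mul (Real.exp_pos _).le]
          congr 2
          rw [hR]; ring
      _ ≤ _ := by
          refine setLIntegral_mono' measurableSet_Icc fun r hr => ENNReal.ofReal_le_ofReal ?_
          rw [Real.exp_le_exp]
          have h3 : ρ * (t - 2) * r ≤ ρ * (t - 2) * R := by
            have := hr.2
            gcongr
          have h4 : ρ * (t - 2) * R = ρ * (t - 1) := by rw [hR]; field_simp; ring
          linarith
  have hcapE : ENNReal.ofReal (κ * lam ^ (-ρ)) ≤
      sphereMeasure (n + 1) (cap n (lam ^ (-(1 / 2) : ℝ))) := by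
    rw [← ofReal_measureReal (measure_ne_top _ _)]
    exact ENNReal.ofReal_le_ofReal hσ
  have hE1 : ENNReal.ofReal (m * c * Real.exp (-ρ) * (t - 2) ^ (-(1 / t)) * lam ^ (-(ρ * (1 / t)))) ≤
      eLpNorm (extension (n + 1) lam (wavePacket n lam)) q (hypMeasure (n + 1)) := by
    refine ofReal_le_eLpNorm_of_le_lintegral (by rintro rfl; simp at hq2) hq (by positivity) ?_
    rw [← htdef]
    refine le_trans ?_ hlow
    refine le_trans ?_ (mul_le_mul' (mul_le_mul_right hint _) hcapE)
    rw [← ENNReal.ofReal_mul (by positivity), ← ENNReal.ofReal_mul (by positivity)]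
    refine ENNReal.ofReal_le_ofReal ?_
    have h5 : m ^ t ≤ (1 / 4) ^ n * κ := by
      have h6 := Real.rpow_le_rpow hm0.le (min_one_le_rpow_one_div (t := t)
        (by positivity : 0 < (1 / 4) ^ n * κ) (by linarith)) ht0.le
      rwa [← Real.rpow_mul (by positivity), one_div_mul_cancel ht0.ne', Real.rpow_one] at h6
    have h7 : Real.exp (-ρ) ^ t ≤ Real.exp (-(ρ * (t - 1))) := by
      rw [← Real.exp_mul, Real.exp_le_exp]; nlinarith
    have h8 : ((t - 2) ^ (-(1 / t))) ^ t = (t - 2)⁻¹ := by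
      rw [← Real.rpow_mul ht2.le, neg_mul, one_div_mul_cancel ht0.ne', Real.rpow_neg_one]
    have h9 : (lam ^ (-(ρ * (1 / t)))) ^ t = lam ^ (-ρ) := by
      rw [← Real.rpow_mul hlam0.le]; congr 1; field_simp
    rw [Real.mul_rpow (by positivity) (by positivity), Real.mul_rpow (by positivity) (by positivity),
      Real.mul_rpow (by positivity) (by positivity), Real.mul_rpow (by positivity) (by positivity),
      h8, h9]
    calc m ^ t * c ^ t * Real.exp (-ρ) ^ t * (t - 2)⁻¹ * lam ^ (-ρ)
        ≤ ((1 / 4) ^ n * κ) * c ^ t * Real.exp (-(ρ * (t - 1))) * (t - 2)⁻¹ * lam ^ (-ρ) := by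
          gcongr
      _ = _ := by ring
  set P := (p⁻¹).toReal with hP
  have hfp := eLpNorm_wavePacket_le hthr1 hp
  rw [← hρ, ← hP] at hfp
  have hf : MemLp (wavePacket n lam) p (sphereMeasure (n + 1)) :=
    ⟨(measurable_wavePacket n lam).aestronglyMeasurable, hfp.trans_lt ENNReal.ofReal_lt_top⟩
  have hN : 0 < Real.pi ^ ρ * lam ^ (-(ρ * P)) := by positivity
  have hup := hE1.trans (eLpNorm_extension_le (n + 1) lam p q _ hf hN hfp)
  have hN' : ENNReal.ofReal (Real.pi ^ ρ * lam ^ (-(ρ * P))) ≠ 0 := by simpa using hN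
  rw [← ENNReal.mul_le_mul_iff_right hN' ENNReal.ofReal_ne_top]
  refine le_trans (le_of_eq ?_) hup
  rw [← ENNReal.ofReal_mul hN.le]
  congr 1
  have h10 : lam ^ (-(ρ * P)) * lam ^ (ρ * P - ρ * (1 / t)) = lam ^ (-(ρ * (1 / t))) := by
    rw [← Real.rpow_add hlam0]; congr 1; ring
  have h11 : Real.pi ^ ρ ≠ 0 := by positivity
  calc _ = (lam ^ (-(ρ * P)) * lam ^ (ρ * P - ρ * (1 / t))) * (m * c * Real.exp (-ρ) *
        (t - 2) ^ (-(1 / t))) * (Real.pi ^ ρ / Real.pi ^ ρ) := by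
        generalize lam ^ (ρ * P - ρ * (1 / t)) = y
        ring
    _ = _ := by rw [h10, div_self h11]; ring

/-! ### The spherical function as an integral over the polar angle -/

/-- The convex combination `(1 - c) / 2 + e^(-2r) (1 + c) / 2`. If `c` is the cosine of the angle
between `θ` and `ω`, it is `e^(-r)` times the Minkowski product of `(1, ω)` with the point of polar
coordinates `(r, θ)`. -/
noncomputable def horoFactor (r c : ℝ) : ℝ :=
  (1 - c) / 2 + Real.exp (-(2 * r)) * ((1 + c) / 2)

theorem exp_neg_le_horoFactor {c : ℝ} (h1 : -1 ≤ c) (h2 : c ≤ 1) (r : ℝ) :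
    Real.exp (-(2 * |r|)) ≤ horoFactor r c := by
  unfold horoFactor
  have e1 : Real.exp (-(2 * |r|)) ≤ 1 := Real.exp_le_one_iff.2 (by have := abs_nonneg r; linarith)
  have e2 : Real.exp (-(2 * |r|)) ≤ Real.exp (-(2 * r)) :=
    Real.exp_le_exp.2 (by have := le_abs_self r; linarith)
  nlinarith

theorem horoFactor_pos {c : ℝ} (h1 : -1 ≤ c) (h2 : c ≤ 1) (r : ℝ) : 0 < horoFactor r c :=
  (Real.exp_pos _).trans_le (exp_neg_le_horoFactor h1 h2 r)

theorem mink_polarPoint_eq_exp_mul {d : ℕ} (r : ℝ) (θ w : USphere d) :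
    mink (polarPoint r θ : Minkowski d) (lightRay w) =
      Real.exp r * horoFactor r (inner ℝ (θ : Space d) (w : Space d)) := by
  rw [mink_polarPoint, horoFactor, Real.cosh_eq, Real.sinh_eq, mul_add, ← mul_assoc, ← Real.exp_add,
    show r + -(2 * r) = -r by ring]
  ring

theorem neg_one_le_inner_usphere {d : ℕ} (θ w : USphere d) :
    -1 ≤ inner ℝ (θ : Space d) (w : Space d) := by
  have h := neg_le_of_abs_le (abs_real_inner_le_norm (θ : Space d) (w : Space d))
  simpa [norm_usphere] using h

/-- The integrand of `zonalIntegral`. -/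
noncomputable def zonalIntegrand (k : ℕ) (lam r φ : ℝ) : ℂ :=
  ((Real.sin φ ^ k : ℝ) : ℂ) * Complex.exp (-((k + 1 : ℕ) / 2 + Complex.I * lam) *
    (Real.log (horoFactor r (Real.cos φ)) : ℝ))

/-- The spherical function of the hyperbolic space of dimension `k + 2`, as an integral over the
polar angle, without the factor `e^(-(ρ + iλ) r)` and without the normalization. -/
noncomputable def zonalIntegral (k : ℕ) (lam r : ℝ) : ℂ :=
  ∫ φ in Set.Ioo 0 Real.pi, zonalIntegrand k lam r φ

/-- The modulus of `E_λ 1` is radial. -/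
theorem norm_extension_one_polarPoint (k : ℕ) (lam r : ℝ) (θ : USphere (k + 2)) :
    ‖extension (k + 2) lam (fun _ => 1) (polarPoint r θ)‖ =
      ‖harishChandra (k + 2) lam‖⁻¹ * ((sphereMeasure (k + 2)).real Set.univ)⁻¹ *
        (Real.exp (-(((k + 1 : ℕ) : ℝ) / 2 * r)) *
          ((sphereMeasure (k + 1)).real Set.univ * ‖zonalIntegral k lam r‖)) := by
  rw [norm_extension (n := k + 1)]
  congr 1
  have h1 : ∀ w : USphere (k + 2), (1 : ℂ) * Complex.exp (-(((k + 1 : ℕ) : ℂ) / 2 + Complex.I * lam) *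
      (Real.log (mink (polarPoint r θ : Minkowski (k + 2)) (lightRay w)) : ℝ)) =
      Complex.exp (-(((k + 1 : ℕ) : ℂ) / 2 + Complex.I * lam) * r) *
        Complex.exp (-(((k + 1 : ℕ) : ℂ) / 2 + Complex.I * lam) *
          (Real.log (horoFactor r (inner ℝ (θ : Space (k + 2)) (w : Space (k + 2)))) : ℝ)) := by
    intro w
    rw [mink_polarPoint_eq_exp_mul, Real.log_mul (Real.exp_pos _).ne'
      (horoFactor_pos (neg_one_le_inner_usphere θ w) (inner_usphere_le_one θ w) r).ne', Real.log_exp,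
      one_mul, ← Complex.exp_add]
    congr 1
    push_cast
    ring
  simp only [h1]
  rw [integral_const_mul, integral_zonal θ (fun c => Complex.exp (-(((k + 1 : ℕ) : ℂ) / 2 +
    Complex.I * lam) * (Real.log (horoFactor r c) : ℝ))) (by unfold horoFactor; fun_prop),
    norm_mul, norm_mul, Complex.norm_exp, Complex.norm_real, Real.norm_eq_abs,
    abs_of_pos (sphereMeasure_univ_pos k)]
  congr 2
  simp

/-- A bound which is locally uniform in `r`, for the differentiation under the integral sign. -/
theorem norm_zonalIntegrand_le (k : ℕ) (lam r φ : ℝ) :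
    ‖zonalIntegrand k lam r φ‖ ≤ Real.exp ((k + 1 : ℕ) * |r|) := by
  have hD := exp_neg_le_horoFactor (Real.neg_one_le_cos φ) (Real.cos_le_one φ) r
  have hL : -(2 * |r|) ≤ Real.log (horoFactor r (Real.cos φ)) := by
    rw [Real.le_log_iff_exp_le (horoFactor_pos (Real.neg_one_le_cos φ) (Real.cos_le_one φ) r)]
    exact hD
  have h1 : |Real.sin φ ^ k| ≤ 1 := by
    rw [abs_pow]; exact pow_le_one₀ (abs_nonneg _) (Real.abs_sin_le_one φ)
  have h2 : ‖Complex.exp (-((k + 1 : ℕ) / 2 + Complex.I * lam) *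
      (Real.log (horoFactor r (Real.cos φ)) : ℝ))‖ ≤ Real.exp ((k + 1 : ℕ) * |r|) := by
    rw [Complex.norm_exp, Real.exp_le_exp, Complex.re_mul_ofReal]
    have h3 : (-(((k + 1 : ℕ) : ℂ) / 2 + Complex.I * lam)).re = -(((k + 1 : ℕ) : ℝ) / 2) := by simp
    rw [h3]
    have : (0 : ℝ) ≤ (k + 1 : ℕ) := Nat.cast_nonneg _
    nlinarith
  rw [zonalIntegrand, norm_mul, Complex.norm_real, Real.norm_eq_abs]
  calc _ ≤ 1 * Real.exp ((k + 1 : ℕ) * |r|) := by gcongr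
    _ = _ := one_mul _

theorem measurable_zonalIntegrand (k : ℕ) (lam r : ℝ) : Measurable (zonalIntegrand k lam r) := by
  unfold zonalIntegrand horoFactor
  fun_prop

theorem hasDerivAt_zonalIntegrand (k : ℕ) (lam r φ : ℝ) :
    HasDerivAt (fun r => zonalIntegrand k lam r φ)
      (((k + 1 : ℕ) / 2 + Complex.I * lam) * ((Real.exp (-(2 * r)) * (1 + Real.cos φ) /
        horoFactor r (Real.cos φ) : ℝ) : ℂ) * zonalIntegrand k lam r φ) r := by
  have hD := horoFactor_pos (Real.neg_one_le_cos φ) (Real.cos_le_one φ) r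
  have h1 : HasDerivAt (fun r => horoFactor r (Real.cos φ))
      (-(Real.exp (-(2 * r)) * (1 + Real.cos φ))) r := by
    unfold horoFactor
    have h2 : HasDerivAt (fun r : ℝ => -(2 * r)) (-(2 * 1)) r :=
      ((hasDerivAt_id' r).const_mul 2).fun_neg
    have h3 := (h2.exp.mul_const ((1 + Real.cos φ) / 2)).const_add ((1 - Real.cos φ) / 2)
    refine h3.congr_deriv ?_
    ring
  have h4 := ((h1.log hD.ne').ofReal_comp.const_mul (-(((k + 1 : ℕ) : ℂ) / 2 + Complex.I * lam))).cexp
  have h5 := h4.const_mul ((Real.sin φ ^ k : ℝ) : ℂ)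
  unfold zonalIntegrand
  refine h5.congr_deriv ?_
  push_cast
  ring

theorem hasDerivAt_zonalIntegral (k : ℕ) (lam r : ℝ) :
    HasDerivAt (zonalIntegral k lam)
      (∫ φ in Set.Ioo 0 Real.pi, ((k + 1 : ℕ) / 2 + Complex.I * lam) *
        ((Real.exp (-(2 * r)) * (1 + Real.cos φ) / horoFactor r (Real.cos φ) : ℝ) : ℂ) *
          zonalIntegrand k lam r φ) r := by
  have hfin : IsFiniteMeasure ((volume : Measure ℝ).restrict (Set.Ioo 0 Real.pi)) :=
    ⟨by simp⟩
  refine (hasDerivAt_integral_of_dominated_loc_of_deriv_le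
    (μ := (volume : Measure ℝ).restrict (Set.Ioo 0 Real.pi)) (F := fun r φ => zonalIntegrand k lam r φ)
    (F' := fun r φ => ((k + 1 : ℕ) / 2 + Complex.I * lam) *
      ((Real.exp (-(2 * r)) * (1 + Real.cos φ) / horoFactor r (Real.cos φ) : ℝ) : ℂ) *
        zonalIntegrand k lam r φ)
    (bound := fun _ => ‖((k + 1 : ℕ) / 2 + Complex.I * lam : ℂ)‖ * 2 *
      Real.exp ((k + 1 : ℕ) * (|r| + 1))) (Metric.ball_mem_nhds r one_pos)
    (Filter.Eventually.of_forall fun x => (measurable_zonalIntegrand k lam x).aestronglyMeasurable)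
    ?_ ?_ ?_ (integrable_const _) ?_).2
  · exact (integrable_const (Real.exp ((k + 1 : ℕ) * |r|))).mono'
      (measurable_zonalIntegrand k lam r).aestronglyMeasurable
      (Filter.Eventually.of_forall fun φ => norm_zonalIntegrand_le k lam r φ)
  · have := measurable_zonalIntegrand k lam r
    unfold horoFactor
    fun_prop
  · refine Filter.Eventually.of_forall fun φ x hx => ?_
    have hD := horoFactor_pos (Real.neg_one_le_cos φ) (Real.cos_le_one φ) x
    have h1 : |Real.exp (-(2 * x)) * (1 + Real.cos φ) / horoFactor x (Real.cos φ)| ≤ 2 := by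
      have h2 : 0 ≤ Real.exp (-(2 * x)) * (1 + Real.cos φ) :=
        mul_nonneg (Real.exp_pos _).le (by linarith [Real.neg_one_le_cos φ])
      rw [abs_of_nonneg (by positivity), div_le_iff₀ hD]
      unfold horoFactor
      linarith [Real.cos_le_one φ]
    have h3 : |x| ≤ |r| + 1 := by
      have h4 := abs_sub_abs_le_abs_sub x r
      rw [Metric.mem_ball, Real.dist_eq] at hx
      linarith
    rw [norm_mul, norm_mul, Complex.norm_real, Real.norm_eq_abs]
    have h5 := norm_zonalIntegrand_le k lam x φ
    gcongr
    refine h5.trans ?_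
    gcongr
  · exact Filter.Eventually.of_forall fun φ x _ => hasDerivAt_zonalIntegrand k lam x φ

/-! ### The derivative of the spherical function at large radius -/

/-- The substitution `tan (φ / 2) = ε v`. -/
theorem integral_Ioo_eq_integral_two_arctan {ε : ℝ} (hε : 0 < ε) (g : ℝ → ℂ) :
    ∫ φ in Set.Ioo 0 Real.pi, g φ =
      ∫ v in Set.Ioi (0 : ℝ), ((2 * ε / (1 + (ε * v) ^ 2) : ℝ) : ℂ) *
        g (2 * Real.arctan (ε * v)) := by
  have himg : (fun v : ℝ => 2 * Real.arctan (ε * v)) '' Set.Ioi 0 = Set.Ioo 0 Real.pi := by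
    ext φ
    constructor
    · rintro ⟨v, hv, rfl⟩
      have hv : 0 < v := hv
      have h1 : 0 < Real.arctan (ε * v) := Real.arctan_pos.2 (by positivity)
      have h2 := Real.arctan_lt_pi_div_two (ε * v)
      exact ⟨by positivity, by dsimp only; linarith⟩
    · rintro ⟨h0, h1⟩
      have h2 : 0 < Real.tan (φ / 2) := Real.tan_pos_of_pos_of_lt_pi_div_two (by linarith) (by linarith)
      refine ⟨ε⁻¹ * Real.tan (φ / 2), Set.mem_Ioi.2 (by positivity), ?_⟩
      dsimp only
      rw [mul_inv_cancel_left₀ hε.ne', Real.arctan_tan (by linarith) (by linarith)]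
      ring
  rw [← himg, integral_image_eq_integral_abs_deriv_smul (f' := fun v => 2 * ε / (1 + (ε * v) ^ 2))
    measurableSet_Ioi]
  · refine setIntegral_congr_fun measurableSet_Ioi fun v _ => ?_
    have : 0 ≤ 2 * ε / (1 + (ε * v) ^ 2) := by positivity
    simp only [abs_of_nonneg this, Complex.real_smul]
  · intro v _
    have h1 : HasDerivAt (fun v : ℝ => ε * v) (ε * 1) v := (hasDerivAt_id' v).const_mul ε
    refine (((h1.arctan).const_mul 2).congr_deriv ?_).hasDerivWithinAt
    field_simp
  · intro v _ w _ h
    have h1 : Real.arctan (ε * v) = Real.arctan (ε * w) := by simpa using h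
    exact mul_left_cancel₀ hε.ne' (Real.arctan_injective h1)

theorem cos_two_mul_arctan (u : ℝ) :
    Real.cos (2 * Real.arctan u) = (1 - u ^ 2) / (1 + u ^ 2) := by
  rw [Real.cos_two_mul, Real.cos_sq_arctan]
  field_simp
  ring

theorem sin_two_mul_arctan (u : ℝ) :
    Real.sin (2 * Real.arctan u) = 2 * u / (1 + u ^ 2) := by
  rw [Real.sin_two_mul, Real.sin_arctan, Real.cos_arctan]
  have h : Real.sqrt (1 + u ^ 2) ^ 2 = 1 + u ^ 2 := Real.sq_sqrt (by positivity)
  calc _ = 2 * u / Real.sqrt (1 + u ^ 2) ^ 2 := by ring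
    _ = _ := by rw [h]

/-- The density `v^k (1 + v²)^(-s-1)` with `s = (k+1)/2 + iλ`. The power is written as an exponential,
with one factor `(1 + v²)⁻¹` split off. -/
noncomputable def betaDensity (k : ℕ) (lam v : ℝ) : ℂ :=
  ((v ^ k / (1 + v ^ 2) : ℝ) : ℂ) * Complex.exp (-((k + 1 : ℕ) / 2 + Complex.I * lam) *
    (Real.log (1 + v ^ 2) : ℝ))

/-- The derivative of `zonalIntegral` after the substitution `tan (φ / 2) = e^(-r) v`. The last factor
tends to `1` as `r → ∞`. -/
theorem zonal_deriv_eq_integral_betaDensity (k : ℕ) (lam r : ℝ) :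
    ∫ φ in Set.Ioo 0 Real.pi, ((k + 1 : ℕ) / 2 + Complex.I * lam) *
        ((Real.exp (-(2 * r)) * (1 + Real.cos φ) / horoFactor r (Real.cos φ) : ℝ) : ℂ) *
          zonalIntegrand k lam r φ =
      ((k + 1 : ℕ) / 2 + Complex.I * lam) * 2 ^ (k + 2) * Complex.exp (2 * Complex.I * lam * r) *
        ∫ v in Set.Ioi (0 : ℝ), betaDensity k lam v *
          Complex.exp (-((k + 1 : ℕ) / 2 - Complex.I * lam) *
            (Real.log (1 + (Real.exp (-r) * v) ^ 2) : ℝ)) := by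
  rw [integral_Ioo_eq_integral_two_arctan (Real.exp_pos (-r)), ← integral_const_mul]
  refine setIntegral_congr_fun measurableSet_Ioi fun v hv => ?_
  have hv : 0 < v := hv
  set ε := Real.exp (-r) with hε
  have hε0 : 0 < ε := Real.exp_pos _
  have hε2 : Real.exp (-(2 * r)) = ε ^ 2 := by
    rw [hε, ← Real.exp_nat_mul]; congr 1; push_cast; ring
  set B := 1 + (ε * v) ^ 2 with hB
  have hB0 : 0 < B := by positivity
  have hA0 : 0 < 1 + v ^ 2 := by positivity
  have hD : horoFactor r (Real.cos (2 * Real.arctan (ε * v))) = ε ^ 2 * (1 + v ^ 2) / B := by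
    rw [horoFactor, cos_two_mul_arctan, hε2, hB]
    field_simp
    ring
  have hq : Real.exp (-(2 * r)) * (1 + Real.cos (2 * Real.arctan (ε * v))) /
      horoFactor r (Real.cos (2 * Real.arctan (ε * v))) = 2 / (1 + v ^ 2) := by
    rw [hD, hε2, cos_two_mul_arctan, ← hB]
    have h1 : 1 + (1 - (ε * v) ^ 2) / B = 2 / B := by rw [hB]; field_simp; ring
    rw [h1]
    field_simp
  have hlog : Real.log (ε ^ 2 * (1 + v ^ 2) / B) = -(2 * r) + Real.log (1 + v ^ 2) - Real.log B := by
    rw [Real.log_div (by positivity) hB0.ne', Real.log_mul (by positivity) hA0.ne', ← hε2,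
      Real.log_exp]
  simp only [zonalIntegrand, betaDensity]
  rw [hq, hD, hlog, sin_two_mul_arctan, ← hB]
  have hpow : 2 * ε / B * (2 / (1 + v ^ 2)) * (2 * (ε * v) / B) ^ k =
      2 ^ (k + 2) * (v ^ k / (1 + v ^ 2)) *
        (Real.exp (-((k + 1 : ℕ) * r)) * Real.exp (-((k + 1 : ℕ) * Real.log B))) := by
    have h1 : Real.exp (-((k + 1 : ℕ) * r)) = ε ^ (k + 1) := by
      rw [hε, ← Real.exp_nat_mul]; congr 1; ring
    have h2 : Real.exp (-((k + 1 : ℕ) * Real.log B)) = (B ^ (k + 1))⁻¹ := by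
      rw [Real.exp_neg, Real.exp_nat_mul, Real.exp_log hB0]
    rw [h1, h2, div_pow]
    field_simp
    ring
  set s : ℂ := ((k + 1 : ℕ) : ℂ) / 2 + Complex.I * lam with hs
  calc _ = s * ((2 * ε / B * (2 / (1 + v ^ 2)) * (2 * (ε * v) / B) ^ k : ℝ) : ℂ) *
        Complex.exp (-s * ((-(2 * r) + Real.log (1 + v ^ 2) - Real.log B : ℝ) : ℂ)) := by
        push_cast; ring
    _ = s * 2 ^ (k + 2) * ((v ^ k / (1 + v ^ 2) : ℝ) : ℂ) *
        (Complex.exp ((-((k + 1 : ℕ) * r) : ℝ) : ℂ) *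
          Complex.exp ((-((k + 1 : ℕ) * Real.log B) : ℝ) : ℂ) *
        Complex.exp (-s * ((-(2 * r) + Real.log (1 + v ^ 2) - Real.log B : ℝ) : ℂ))) := by
        rw [hpow]; push_cast; ring
    _ = s * 2 ^ (k + 2) * ((v ^ k / (1 + v ^ 2) : ℝ) : ℂ) *
        (Complex.exp (2 * Complex.I * lam * r) * Complex.exp (-s * (Real.log (1 + v ^ 2) : ℝ)) *
          Complex.exp (-((k + 1 : ℕ) / 2 - Complex.I * lam) * (Real.log B : ℝ))) := by
        congr 1
        rw [← Complex.exp_add, ← Complex.exp_add, ← Complex.exp_add, ← Complex.exp_add]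
        congr 1
        rw [hs]
        push_cast
        ring
    _ = _ := by ring

theorem measurable_betaDensity (k : ℕ) (lam : ℝ) : Measurable (betaDensity k lam) := by
  unfold betaDensity; fun_prop

theorem norm_betaDensity_eq (k : ℕ) (lam : ℝ) {v : ℝ} (hv : 0 < v) :
    ‖betaDensity k lam v‖ = v ^ k / Real.sqrt (1 + v ^ 2) ^ (k + 1) * (1 + v ^ 2)⁻¹ := by
  have hA0 : 0 < 1 + v ^ 2 := by positivity
  have h1 : (-(((k + 1 : ℕ) : ℂ) / 2 + Complex.I * lam) * (Real.log (1 + v ^ 2) : ℝ)).re =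
      -((k + 1 : ℕ) * (Real.log (1 + v ^ 2) / 2)) := by
    rw [Complex.re_mul_ofReal]
    simp
    ring
  rw [betaDensity, norm_mul, Complex.norm_real, Real.norm_eq_abs, abs_of_pos (by positivity),
    Complex.norm_exp, h1, Real.exp_neg, Real.exp_nat_mul, ← Real.log_sqrt hA0.le,
    Real.exp_log (Real.sqrt_pos.2 hA0)]
  ring

theorem norm_betaDensity_le (k : ℕ) (lam : ℝ) {v : ℝ} (hv : 0 < v) :
    ‖betaDensity k lam v‖ ≤ (1 + v ^ 2)⁻¹ ∧ ‖betaDensity k lam v‖ * v ≤ (1 + v ^ 2)⁻¹ := by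
  rw [norm_betaDensity_eq k lam hv]
  have hq1 : 1 ≤ Real.sqrt (1 + v ^ 2) := Real.one_le_sqrt.2 (by nlinarith)
  have hqv : v ≤ Real.sqrt (1 + v ^ 2) := Real.le_sqrt_of_sq_le (by linarith)
  set Q := Real.sqrt (1 + v ^ 2) with hQ
  have h1 : v ^ k / Q ^ (k + 1) ≤ 1 := by
    rw [div_le_one (by positivity)]
    calc v ^ k ≤ Q ^ k := by gcongr
      _ ≤ Q ^ (k + 1) := pow_le_pow_right₀ hq1 (Nat.le_succ k)
  have h2 : v ^ k / Q ^ (k + 1) * v ≤ 1 := by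
    rw [div_mul_eq_mul_div, ← pow_succ, div_le_one (by positivity)]
    gcongr
  have h3 : 0 ≤ (1 + v ^ 2)⁻¹ := by positivity
  refine ⟨mul_le_of_le_one_left h3 h1, ?_⟩
  rw [mul_right_comm]
  exact mul_le_of_le_one_left h3 h2

theorem norm_cexp_sub_one_le_of_re_nonpos {w : ℂ} (hw : w.re ≤ 0) : ‖Complex.exp w - 1‖ ≤ ‖w‖ := by
  have h := (convex_halfSpace_re_le 0).norm_image_sub_le_of_norm_hasDerivWithin_le
    (f := Complex.exp) (f' := Complex.exp) (C := 1) (x := 0) (y := w)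
    (fun x _ => (Complex.hasDerivAt_exp x).hasDerivWithinAt)
    (fun x hx => by rw [Complex.norm_exp]; exact Real.exp_le_one_iff.2 hx) (by simp) hw
  simpa using h

theorem log_one_add_sq_le {x : ℝ} (hx : 0 ≤ x) : Real.log (1 + x ^ 2) ≤ 2 * x := by
  have h1 : 1 + x ^ 2 ≤ (1 + x) ^ 2 := by nlinarith
  calc Real.log (1 + x ^ 2) ≤ Real.log ((1 + x) ^ 2) := Real.log_le_log (by positivity) h1
    _ = 2 * Real.log (1 + x) := by rw [Real.log_pow]; norm_num
    _ ≤ 2 * x := by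
      have := Real.log_le_sub_one_of_pos (by linarith : 0 < 1 + x)
      linarith

/-- Up to an exponentially small error, the derivative of `zonalIntegral` is a plane wave. -/
theorem norm_zonal_deriv_sub_le (k : ℕ) (lam r : ℝ) :
    ‖(∫ φ in Set.Ioo 0 Real.pi, ((k + 1 : ℕ) / 2 + Complex.I * lam) *
        ((Real.exp (-(2 * r)) * (1 + Real.cos φ) / horoFactor r (Real.cos φ) : ℝ) : ℂ) *
          zonalIntegrand k lam r φ) -
      ((k + 1 : ℕ) / 2 + Complex.I * lam) * 2 ^ (k + 2) * Complex.exp (2 * Complex.I * lam * r) *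
        ∫ v in Set.Ioi (0 : ℝ), betaDensity k lam v‖ ≤
      2 ^ (k + 2) * Real.pi * ‖((k + 1 : ℕ) / 2 + Complex.I * lam : ℂ)‖ ^ 2 * Real.exp (-r) := by
  rw [zonal_deriv_eq_integral_betaDensity, ← mul_sub, norm_mul]
  set s : ℂ := ((k + 1 : ℕ) : ℂ) / 2 + Complex.I * lam with hs
  set s' : ℂ := ((k + 1 : ℕ) : ℂ) / 2 - Complex.I * lam with hs'
  have hss : ‖s'‖ = ‖s‖ := by
    have : s' = (starRingEnd ℂ) s := by
      rw [hs, hs', map_add, map_div₀, map_natCast, map_ofNat, map_mul, Complex.conj_I,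
        Complex.conj_ofReal]
      ring
    rw [this, Complex.norm_conj]
  set ε := Real.exp (-r) with hε
  have hε0 : 0 < ε := Real.exp_pos _
  have hcoef : ‖s * 2 ^ (k + 2) * Complex.exp (2 * Complex.I * lam * r)‖ = ‖s‖ * 2 ^ (k + 2) := by
    rw [norm_mul, norm_mul, norm_pow, Complex.norm_exp]
    simp
  have hre : ∀ v : ℝ, (-s' * (Real.log (1 + (ε * v) ^ 2) : ℝ)).re ≤ 0 := by
    intro v
    rw [Complex.re_mul_ofReal]
    have h1 : (-s').re = -(((k + 1 : ℕ) : ℝ) / 2) := by simp [hs']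
    rw [h1]
    have h2 : 0 ≤ Real.log (1 + (ε * v) ^ 2) := Real.log_nonneg (by nlinarith [sq_nonneg (ε * v)])
    have : (0 : ℝ) ≤ ((k + 1 : ℕ) : ℝ) / 2 := by positivity
    nlinarith
  have hm := measurable_betaDensity k lam
  have hi := integrable_inv_one_add_sq.integrableOn (s := Set.Ioi (0 : ℝ))
  have hi1 : IntegrableOn (betaDensity k lam) (Set.Ioi 0) :=
    hi.mono' hm.aestronglyMeasurable ((ae_restrict_iff' measurableSet_Ioi).2
      (Filter.Eventually.of_forall fun v hv => (norm_betaDensity_le k lam hv).1))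
  have hi2 : IntegrableOn (fun v => betaDensity k lam v *
      Complex.exp (-s' * (Real.log (1 + (ε * v) ^ 2) : ℝ))) (Set.Ioi 0) := by
    refine hi.mono' (by fun_prop) ((ae_restrict_iff' measurableSet_Ioi).2
      (Filter.Eventually.of_forall fun v hv => ?_))
    rw [norm_mul, Complex.norm_exp]
    exact (mul_le_of_le_one_right (norm_nonneg _) (Real.exp_le_one_iff.2 (hre v))).trans
      (norm_betaDensity_le k lam hv).1
  have hdiff : ‖(∫ v in Set.Ioi (0 : ℝ), betaDensity k lam v *
      Complex.exp (-s' * (Real.log (1 + (ε * v) ^ 2) : ℝ))) -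
      ∫ v in Set.Ioi (0 : ℝ), betaDensity k lam v‖ ≤ ‖s‖ * (2 * ε) * (Real.pi / 2) := by
    rw [← integral_sub hi2 hi1]
    have hπ : ∫ v in Set.Ioi (0 : ℝ), ‖s‖ * (2 * ε) * (1 + v ^ 2)⁻¹ =
        ‖s‖ * (2 * ε) * (Real.pi / 2) := by
      rw [integral_const_mul, integral_Ioi_inv_one_add_sq]
      simp
    rw [← hπ]
    refine norm_integral_le_of_norm_le (hi.const_mul _) ((ae_restrict_iff' measurableSet_Ioi).2
      (Filter.Eventually.of_forall fun v hv => ?_))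
    have hv' : 0 < v := hv
    obtain ⟨_, hb⟩ := norm_betaDensity_le k lam hv'
    rw [← mul_sub_one, norm_mul]
    have h4 : ‖Complex.exp (-s' * (Real.log (1 + (ε * v) ^ 2) : ℝ)) - 1‖ ≤ ‖s‖ * (2 * (ε * v)) := by
      refine (norm_cexp_sub_one_le_of_re_nonpos (hre v)).trans ?_
      rw [norm_mul, norm_neg, hss, Complex.norm_real, Real.norm_eq_abs, abs_of_nonneg
        (Real.log_nonneg (by nlinarith [sq_nonneg (ε * v)]))]
      have := log_one_add_sq_le (by positivity : 0 ≤ ε * v)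
      gcongr
    calc _ ≤ ‖betaDensity k lam v‖ * (‖s‖ * (2 * (ε * v))) := by gcongr
      _ = ‖s‖ * (2 * ε) * (‖betaDensity k lam v‖ * v) := by ring
      _ ≤ _ := by gcongr
  rw [hcoef]
  calc _ ≤ ‖s‖ * 2 ^ (k + 2) * (‖s‖ * (2 * ε) * (Real.pi / 2)) := by gcongr
    _ = _ := by ring

/-! ### The amplitude of the spherical function -/

/-- The substitution `x = v² / (1 + v²)` turns the limit integral into a beta integral. -/
theorem integral_betaDensity (k : ℕ) (lam : ℝ) :
    2 * ∫ v in Set.Ioi (0 : ℝ), betaDensity k lam v =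
      Complex.betaIntegral (((k + 1 : ℕ) : ℂ) / 2) (1 + Complex.I * lam) := by
  have himg : (fun v : ℝ => 1 - (1 + v ^ 2)⁻¹) '' Set.Ioi 0 = Set.Ioo 0 1 := by
    ext x
    constructor
    · rintro ⟨v, hv, rfl⟩
      have hv : 0 < v := hv
      have h1 : 0 < (1 + v ^ 2)⁻¹ := by positivity
      have h2 : (1 + v ^ 2)⁻¹ < 1 := inv_lt_one_of_one_lt₀ (by nlinarith)
      exact ⟨by dsimp only; linarith, by dsimp only; linarith⟩
    · rintro ⟨h0, h1⟩
      have h2 : 0 < 1 - x := by linarith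
      refine ⟨Real.sqrt (x / (1 - x)), Set.mem_Ioi.2 (Real.sqrt_pos.2 (by positivity)), ?_⟩
      dsimp only
      rw [Real.sq_sqrt (by positivity)]
      field_simp
      ring
  rw [Complex.betaIntegral, intervalIntegral.integral_of_le zero_le_one,
    integral_Ioc_eq_integral_Ioo, ← himg, integral_image_eq_integral_abs_deriv_smul
      (f' := fun v => 2 * v / (1 + v ^ 2) ^ 2) measurableSet_Ioi, ← integral_const_mul]
  · refine setIntegral_congr_fun measurableSet_Ioi fun v hv => ?_
    have hv : 0 < v := hv
    have hA : 0 < 1 + v ^ 2 := by positivity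
    have hx0 : 0 < 1 - (1 + v ^ 2)⁻¹ := by
      have h2 : (1 + v ^ 2)⁻¹ < 1 := inv_lt_one_of_one_lt₀ (by nlinarith)
      linarith
    have hpos : 0 ≤ 2 * v / (1 + v ^ 2) ^ 2 := by positivity
    have hx : 1 - (1 + v ^ 2)⁻¹ = v ^ 2 / (1 + v ^ 2) := by field_simp; ring
    have hl1 : Real.log (1 - (1 + v ^ 2)⁻¹) = 2 * Real.log v - Real.log (1 + v ^ 2) := by
      rw [hx, Real.log_div (by positivity) hA.ne', Real.log_pow]; norm_num
    have h1 : ((1 - (1 + v ^ 2)⁻¹ : ℝ) : ℂ) ^ (((k + 1 : ℕ) : ℂ) / 2 - 1) =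
        Complex.exp (((2 * Real.log v - Real.log (1 + v ^ 2) : ℝ) : ℂ) *
          (((k + 1 : ℕ) : ℂ) / 2 - 1)) := by
      rw [Complex.cpow_def_of_ne_zero (by exact_mod_cast hx0.ne'), ← Complex.ofReal_log hx0.le, hl1]
    have h2 : (1 - ((1 - (1 + v ^ 2)⁻¹ : ℝ) : ℂ)) ^ (1 + Complex.I * lam - 1) =
        Complex.exp (((-Real.log (1 + v ^ 2) : ℝ) : ℂ) * (Complex.I * lam)) := by
      have h3 : (1 - ((1 - (1 + v ^ 2)⁻¹ : ℝ) : ℂ)) = (((1 + v ^ 2)⁻¹ : ℝ) : ℂ) := by push_cast; ring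
      rw [h3, Complex.cpow_def_of_ne_zero (by exact_mod_cast (inv_pos.2 hA).ne'),
        ← Complex.ofReal_log (inv_pos.2 hA).le, Real.log_inv, add_sub_cancel_left]
    have h4 : 2 * v / (1 + v ^ 2) ^ 2 = 2 * Real.exp (Real.log v - 2 * Real.log (1 + v ^ 2)) := by
      rw [Real.exp_sub, Real.exp_log hv, two_mul (Real.log _), Real.exp_add, Real.exp_log hA]
      ring
    have h5 : v ^ k / (1 + v ^ 2) = Real.exp (k * Real.log v - Real.log (1 + v ^ 2)) := by
      rw [Real.exp_sub, Real.exp_nat_mul, Real.exp_log hv, Real.exp_log hA]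
    simp only [betaDensity]
    rw [abs_of_nonneg hpos, h1, h2, Complex.real_smul, h4, h5, Complex.ofReal_mul,
      Complex.ofReal_exp, Complex.ofReal_exp, ← Complex.exp_add, ← Complex.exp_add, mul_assoc,
      ← Complex.exp_add, Complex.ofReal_ofNat]
    congr 2
    push_cast
    ring
  · intro v _
    have hA : 1 + v ^ 2 ≠ 0 := by positivity
    have h1 : HasDerivAt (fun v : ℝ => 1 + v ^ 2) (2 * v) v := by
      simpa using (hasDerivAt_pow 2 v).const_add 1
    refine (((h1.fun_inv hA).const_sub 1).congr_deriv ?_).hasDerivWithinAt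
    ring
  · intro v hv w hw h
    have hv : 0 < v := hv
    have hw : 0 < w := hw
    have h1 : (1 + v ^ 2)⁻¹ = (1 + w ^ 2)⁻¹ := by simpa using h
    have h2 : v ^ 2 = w ^ 2 := by have := inv_injective h1; linarith
    exact (pow_left_inj₀ hv.le hw.le two_ne_zero).1 h2

/-- The constant relating the amplitude of `zonalIntegral` to the Harish-Chandra function. -/
noncomputable def amplitudeConst (k : ℕ) : ℝ :=
  2 ^ k * Real.Gamma (((k + 1 : ℕ) : ℝ) / 2) / harishChandraConst (k + 2)

theorem amplitudeConst_pos (k : ℕ) : 0 < amplitudeConst k := by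
  have := harishChandraConst_pos (k + 1)
  have : 0 < Real.Gamma (((k + 1 : ℕ) : ℝ) / 2) := Real.Gamma_pos_of_pos (by positivity)
  unfold amplitudeConst
  positivity

/-- The beta integral gives the quotient of Gamma functions of the Harish-Chandra function. -/
theorem norm_amplitude_eq (k : ℕ) {lam : ℝ} (hlam : 0 < lam) :
    ‖((k + 1 : ℕ) / 2 + Complex.I * lam : ℂ) * 2 ^ (k + 2) *
      ∫ v in Set.Ioi (0 : ℝ), betaDensity k lam v‖ =
      2 * lam * (amplitudeConst k * ‖harishChandra (k + 2) lam‖) := by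
  set s : ℂ := ((k + 1 : ℕ) : ℂ) / 2 + Complex.I * lam with hs
  have hs0 : s ≠ 0 := fun h => by
    have := congrArg Complex.im h
    simp [hs, hlam.ne'] at this
  have hIl : Complex.I * lam ≠ 0 := by simp [hlam.ne']
  have hG := Complex.Gamma_mul_Gamma_eq_betaIntegral (s := ((k + 1 : ℕ) : ℂ) / 2)
    (t := 1 + Complex.I * lam) (by simp; positivity) (by simp)
  rw [← integral_betaDensity, show ((k + 1 : ℕ) : ℂ) / 2 + (1 + Complex.I * lam) = s + 1 by
    rw [hs]; ring, Complex.Gamma_add_one s hs0, add_comm 1, Complex.Gamma_add_one _ hIl] at hG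
  have hGs : Complex.Gamma s ≠ 0 := Gamma_rho_ne_zero (k + 1) hlam
  have hc := norm_harishChandra (k + 1) lam
  have hK := harishChandraConst_pos (k + 1)
  have hρ : ‖Complex.Gamma (((k + 1 : ℕ) : ℂ) / 2)‖ = Real.Gamma (((k + 1 : ℕ) : ℝ) / 2) := by
    have : (((k + 1 : ℕ) : ℂ) / 2) = ((((k + 1 : ℕ) : ℝ) / 2 : ℝ) : ℂ) := by push_cast; ring
    rw [this, Complex.Gamma_ofReal, Complex.norm_real, Real.norm_eq_abs,
      abs_of_pos (Real.Gamma_pos_of_pos (by positivity))]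
  have hn := congrArg norm hG
  simp only [norm_mul] at hn
  rw [hρ, Complex.norm_I, Complex.norm_real, Real.norm_eq_abs, abs_of_pos hlam,
    Complex.norm_ofNat] at hn
  have hGs' := norm_pos_iff.2 hGs
  rw [norm_mul, norm_mul, norm_pow, Complex.norm_ofNat]
  unfold amplitudeConst
  rw [hc, ← hs]
  field_simp
  rw [pow_add]
  linear_combination (-(2 : ℝ) * 2 ^ k) * hn

/-- The values of `zonalIntegral` at radii differing by `π / (2λ)`, half a period of the plane
wave, are not both small. -/
theorem le_norm_zonalIntegral_sub (k : ℕ) {lam r : ℝ} (hlam : 0 < lam)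
    (hr : 2 ^ (k + 1) * Real.pi ^ 2 * ‖((k + 1 : ℕ) / 2 + Complex.I * lam : ℂ)‖ ^ 2 / lam *
      Real.exp (-r) ≤ amplitudeConst k * ‖harishChandra (k + 2) lam‖) :
    amplitudeConst k * ‖harishChandra (k + 2) lam‖ ≤
      ‖zonalIntegral k lam (r + Real.pi / (2 * lam)) - zonalIntegral k lam r‖ := by
  have hpi := Real.pi_pos
  set τ := Real.pi / (2 * lam) with hτ
  have hτ0 : 0 < τ := by positivity
  set s : ℂ := ((k + 1 : ℕ) : ℂ) / 2 + Complex.I * lam with hs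
  set N : ℂ := s * 2 ^ (k + 2) * ∫ v in Set.Ioi (0 : ℝ), betaDensity k lam v with hN
  have hNn : ‖N‖ = 2 * lam * (amplitudeConst k * ‖harishChandra (k + 2) lam‖) :=
    norm_amplitude_eq k hlam
  set α : ℂ := 2 * Complex.I * lam with hα
  have hα0 : α ≠ 0 := by simp [hα, hlam.ne']
  have hexp : ∀ x : ℝ, HasDerivAt (fun x : ℝ => N / α * Complex.exp (α * x))
      (N * Complex.exp (α * x)) x := by
    intro x
    have h1 : HasDerivAt (fun x : ℝ => α * (x : ℂ)) (α * 1) x :=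
      (hasDerivAt_id' x).ofReal_comp.const_mul α
    refine (h1.cexp.const_mul (N / α)).congr_deriv ?_
    field_simp
  have hmv := norm_image_sub_le_of_norm_deriv_le_segment' (a := r) (b := r + τ)
    (f := fun x => zonalIntegral k lam x - N / α * Complex.exp (α * x))
    (C := 2 ^ (k + 2) * Real.pi * ‖s‖ ^ 2 * Real.exp (-r))
    (fun x _ => ((hasDerivAt_zonalIntegral k lam x).sub (hexp x)).hasDerivWithinAt) (by
      intro x hx
      have h2 := norm_zonal_deriv_sub_le k lam x
      rw [← hs] at h2
      have h3 : N * Complex.exp (α * x) = s * 2 ^ (k + 2) * Complex.exp (2 * Complex.I * lam * x) *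
          ∫ v in Set.Ioi (0 : ℝ), betaDensity k lam v := by rw [hN, hα]; ring
      rw [h3]
      refine h2.trans ?_
      have : Real.exp (-x) ≤ Real.exp (-r) := Real.exp_le_exp.2 (by linarith [hx.1])
      gcongr) (r + τ) ⟨by linarith, le_rfl⟩
  -- the plane wave changes its sign
  have hflip : Complex.exp (α * ((r + τ : ℝ) : ℂ)) = -Complex.exp (α * r) := by
    have h4 : α * ((r + τ : ℝ) : ℂ) = α * r + Real.pi * Complex.I := by
      rw [hα, hτ]
      push_cast
      have : (lam : ℂ) ≠ 0 := by exact_mod_cast hlam.ne'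
      field_simp
    rw [h4, Complex.exp_add, Complex.exp_pi_mul_I]
    ring
  simp only [hflip] at hmv
  rw [add_sub_cancel_left] at hmv
  set Δ := zonalIntegral k lam (r + τ) - zonalIntegral k lam r with hΔ
  have h5 : zonalIntegral k lam (r + τ) - N / α * -Complex.exp (α * r) -
      (zonalIntegral k lam r - N / α * Complex.exp (α * r)) =
      Δ + 2 * (N / α * Complex.exp (α * r)) := by rw [hΔ]; ring
  rw [h5] at hmv
  have h6 : ‖2 * (N / α * Complex.exp (α * r))‖ =
      2 * (amplitudeConst k * ‖harishChandra (k + 2) lam‖) := by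
    rw [norm_mul, norm_mul, norm_div, hNn, Complex.norm_exp]
    have h7 : (α * r).re = 0 := by simp [hα]
    have h8 : ‖α‖ = 2 * lam := by simp [hα, abs_of_pos hlam]
    rw [h7, h8, Complex.norm_ofNat, Real.exp_zero]
    field_simp
  have h9 : ‖2 * (N / α * Complex.exp (α * r))‖ ≤
      ‖Δ + 2 * (N / α * Complex.exp (α * r))‖ + ‖Δ‖ := by
    have := norm_sub_le (Δ + 2 * (N / α * Complex.exp (α * r))) Δ
    simpa using this
  have h10 : 2 ^ (k + 2) * Real.pi * ‖s‖ ^ 2 * Real.exp (-r) * τ =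
      2 ^ (k + 1) * Real.pi ^ 2 * ‖s‖ ^ 2 / lam * Real.exp (-r) := by
    rw [hτ]; field_simp; ring
  linarith

/-! ### The constant function at large radius -/

/-- A set of radii which meets every pair `r, r + τ` carries half of the mass of `e^(-a r)`, up to
the oscillation of the exponential over a distance `τ`. -/
theorem lintegral_Ioi_exp_le_of_mem_or_add_mem {T : Set ℝ} (hT : MeasurableSet T) {R τ a : ℝ}
    (hτ : 0 ≤ τ) (h : ∀ r, R ≤ r → r ∈ T ∨ r + τ ∈ T) :
    ENNReal.ofReal (Real.exp (-(|a| * τ))) *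
        (∫⁻ r in Set.Ioi R, ENNReal.ofReal (Real.exp (-(a * r)))) ≤
      2 * ∫⁻ r in T, ENNReal.ofReal (Real.exp (-(a * r))) := by
  set F : ℝ → ℝ≥0∞ := T.indicator fun r => ENNReal.ofReal (Real.exp (-(a * r))) with hF
  have hFm : Measurable F := Measurable.indicator (by fun_prop) hT
  have h1 : ∫⁻ r in T, ENNReal.ofReal (Real.exp (-(a * r))) = ∫⁻ r, F r :=
    (lintegral_indicator hT _).symm
  have h2 : ∫⁻ r, F (r + τ) = ∫⁻ r, F r := lintegral_add_right_eq_self F τ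
  rw [h1, two_mul]
  nth_rewrite 2 [← h2]
  rw [← lintegral_add_left hFm, ← lintegral_const_mul _ (by fun_prop)]
  refine (setLIntegral_mono' measurableSet_Ioi fun r hr => ?_).trans (setLIntegral_le_lintegral _ _)
  rw [← ENNReal.ofReal_mul (Real.exp_pos _).le, ← Real.exp_add]
  have ha : 0 ≤ |a| * τ := by positivity
  rcases h r (le_of_lt hr) with h3 | h3
  · refine le_trans ?_ le_self_add
    rw [hF, Set.indicator_of_mem h3]
    exact ENNReal.ofReal_le_ofReal (Real.exp_le_exp.2 (by linarith))
  · refine le_trans ?_ le_add_self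
    rw [hF, Set.indicator_of_mem h3]
    refine ENNReal.ofReal_le_ofReal (Real.exp_le_exp.2 ?_)
    have := mul_le_mul_of_nonneg_right (le_abs_self a) hτ
    linarith

theorem lintegral_Ioi_exp_neg_mul {a : ℝ} (ha : 0 < a) (R : ℝ) :
    ∫⁻ r in Set.Ioi R, ENNReal.ofReal (Real.exp (-(a * r))) =
      ENNReal.ofReal (Real.exp (-(a * R)) / a) := by
  have h1 := integrableOn_exp_mul_Ioi (neg_lt_zero.2 ha) R
  have h2 := integral_exp_mul_Ioi (neg_lt_zero.2 ha) R
  simp only [neg_mul] at h1 h2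
  rw [← ofReal_integral_eq_lintegral_ofReal h1 (Filter.Eventually.of_forall fun r =>
    (Real.exp_pos _).le), h2]
  congr 1
  field_simp

theorem lintegral_Ioi_exp_neg_mul_eq_top {a : ℝ} (ha : a ≤ 0) {R : ℝ} (hR : 0 ≤ R) :
    ∫⁻ r in Set.Ioi R, ENNReal.ofReal (Real.exp (-(a * r))) = ⊤ := by
  refine top_unique ?_
  calc (⊤ : ℝ≥0∞) = ∫⁻ _ in Set.Ioi R, 1 := by simp
    _ ≤ _ := setLIntegral_mono' measurableSet_Ioi fun r hr => by
        rw [ENNReal.one_le_ofReal, Real.one_le_exp_iff]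
        have : R < r := hr
        nlinarith

theorem continuous_zonalIntegral (k : ℕ) (lam : ℝ) : Continuous (zonalIntegral k lam) :=
  continuous_iff_continuousAt.2 fun r => (hasDerivAt_zonalIntegral k lam r).continuousAt

/-- A lower bound for the `t`-th moment of `E_λ 1`, for any `t`: beyond the radius `R`, `E_λ 1` is
of size `e^(-ρ r)` at one at least of any two points at distance `π / (2λ)` on a ray. -/
theorem exists_le_lintegral_extension_one (k : ℕ) : ∃ B : ℝ, 0 < B ∧ ∀ lam R t : ℝ, 0 < lam →
    1 ≤ R → 0 ≤ t →
    2 ^ (k + 1) * Real.pi ^ 2 * ‖((k + 1 : ℕ) / 2 + Complex.I * lam : ℂ)‖ ^ 2 / lam *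
      Real.exp (-R) ≤ amplitudeConst k * ‖harishChandra (k + 2) lam‖ →
    ENNReal.ofReal ((1 / 4) ^ (k + 1) * B ^ t) *
      (ENNReal.ofReal (Real.exp (-(|((k + 1 : ℕ) : ℝ) / 2 * (t - 2)| * (Real.pi / (2 * lam))))) *
        (∫⁻ r in Set.Ioi R, ENNReal.ofReal (Real.exp (-(((k + 1 : ℕ) : ℝ) / 2 * (t - 2) * r))))) *
        sphereMeasure (k + 2) Set.univ ≤
      2 * ∫⁻ x, ‖extension (k + 2) lam (fun _ => 1) x‖ₑ ^ t ∂(hypMeasure (k + 2)) := by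
  have hσ0 := sphereMeasure_univ_pos (k + 1)
  have hσ1 := sphereMeasure_univ_pos k
  have hA := amplitudeConst_pos k
  set B := ((sphereMeasure (k + 2)).real Set.univ)⁻¹ * (sphereMeasure (k + 1)).real Set.univ *
    amplitudeConst k / 2 with hB
  refine ⟨B, by positivity, fun lam R t hlam hR ht hthr => ?_⟩
  have hB0 : 0 < B := by positivity
  have hc := norm_harishChandra_pos (k + 1) hlam
  have hpi := Real.pi_pos
  set m := amplitudeConst k * ‖harishChandra (k + 2) lam‖ with hm
  set T : Set ℝ := {r | R ≤ r ∧ m / 2 ≤ ‖zonalIntegral k lam r‖} with hTdef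
  have hT : MeasurableSet T :=
    (measurableSet_le measurable_const measurable_id).inter
      (measurableSet_le measurable_const (continuous_zonalIntegral k lam).norm.measurable)
  have hpair : ∀ r, R ≤ r → r ∈ T ∨ r + Real.pi / (2 * lam) ∈ T := by
    intro r hr
    have h1 : Real.exp (-r) ≤ Real.exp (-R) := Real.exp_le_exp.2 (by linarith)
    have h2 := le_norm_zonalIntegral_sub k (r := r) hlam (le_trans (by gcongr) hthr)
    have h3 := norm_sub_le (zonalIntegral k lam (r + Real.pi / (2 * lam))) (zonalIntegral k lam r)
    have hτ : 0 < Real.pi / (2 * lam) := by positivity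
    rcases le_or_gt (m / 2) ‖zonalIntegral k lam r‖ with h4 | h4
    · exact Or.inl ⟨hr, h4⟩
    · exact Or.inr ⟨by linarith, by linarith⟩
  have hpt : ∀ θ ∈ (Set.univ : Set (USphere (k + 2))), ∀ r ∈ T,
      B * Real.exp (-(((k + 1 : ℕ) : ℝ) / 2 * r)) ≤
        ‖extension (k + 2) lam (fun _ => 1) (polarPoint r θ)‖ := by
    intro θ _ r hr
    rw [norm_extension_one_polarPoint]
    have h5 := hr.2
    calc _ = ‖harishChandra (k + 2) lam‖⁻¹ * ((sphereMeasure (k + 2)).real Set.univ)⁻¹ *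
          (Real.exp (-(((k + 1 : ℕ) : ℝ) / 2 * r)) *
            ((sphereMeasure (k + 1)).real Set.univ * (m / 2))) := by
          rw [hB, hm]; field_simp
      _ ≤ _ := by gcongr
  have h6 := le_lintegral_enorm_rpow_of_le_polarPoint
    (measurable_extension (k + 2) lam (fun _ => 1) measurable_const) MeasurableSet.univ hT
    (fun r hr => hR.trans hr.1) hB0.le ht hpt
  have h7 := lintegral_Ioi_exp_le_of_mem_or_add_mem (a := ((k + 1 : ℕ) : ℝ) / 2 * (t - 2)) hT
    (by positivity : 0 ≤ Real.pi / (2 * lam)) hpair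
  refine le_trans ?_ (mul_le_mul_right h6 2)
  rw [← mul_assoc 2, mul_left_comm 2]
  gcongr

theorem exists_mul_exp_neg_le (C : ℝ) {m : ℝ} (hm : 0 < m) : ∃ R : ℝ, 1 ≤ R ∧ C * Real.exp (-R) ≤ m := by
  have h : Filter.Tendsto (fun R : ℝ => C * Real.exp (-R)) Filter.atTop (nhds (C * 0)) :=
    (Real.tendsto_exp_neg_atTop_nhds_zero).const_mul C
  rw [mul_zero] at h
  obtain ⟨R, h1, h2⟩ := ((Filter.eventually_ge_atTop 1).and (h.eventually (gt_mem_nhds hm))).exists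
  exact ⟨R, h1, h2.le⟩

/-- `E_λ` maps the constant function `1` to a function which is in no `L^q` with `q ≤ 2`. -/
theorem not_isBoundedExtension_of_le_two (k : ℕ) {lam : ℝ} (hlam : 0 < lam) {p q : ℝ≥0∞}
    (hq1 : 1 ≤ q) (hq2 : q ≤ 2) : ¬ IsBoundedExtension (k + 2) lam p q := by
  rintro ⟨C, hC⟩
  obtain ⟨B, hB, h⟩ := exists_le_lintegral_extension_one k
  have hc := norm_harishChandra_pos (k + 1) hlam
  have hA := amplitudeConst_pos k
  obtain ⟨R, hR, hthr⟩ := exists_mul_exp_neg_le (2 ^ (k + 1) * Real.pi ^ 2 *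
    ‖((k + 1 : ℕ) / 2 + Complex.I * lam : ℂ)‖ ^ 2 / lam) (mul_pos hA hc)
  have hqt : q ≠ ⊤ := fun h => by simp [h] at hq2
  have hq0 : q ≠ 0 := fun h => by simp [h] at hq1
  have ht2 : q.toReal ≤ 2 := by simpa using ENNReal.toReal_mono (by norm_num) hq2
  have h1 := h lam R q.toReal hlam hR ENNReal.toReal_nonneg hthr
  have ha : ((k + 1 : ℕ) : ℝ) / 2 * (q.toReal - 2) ≤ 0 :=
    mul_nonpos_of_nonneg_of_nonpos (by positivity) (by linarith)
  have hσ : sphereMeasure (k + 2) Set.univ ≠ 0 := by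
    intro h0
    have := sphereMeasure_univ_pos (k + 1)
    rw [measureReal_def, h0] at this
    simp at this
  have hpos : ENNReal.ofReal ((1 / 4) ^ (k + 1) * B ^ q.toReal) ≠ 0 := by
    rw [Ne, ENNReal.ofReal_eq_zero, not_le]; positivity
  have hpos' : ENNReal.ofReal (Real.exp (-(|((k + 1 : ℕ) : ℝ) / 2 * (q.toReal - 2)| *
      (Real.pi / (2 * lam))))) ≠ 0 := by
    rw [Ne, ENNReal.ofReal_eq_zero, not_le]; positivity
  rw [lintegral_Ioi_exp_neg_mul_eq_top ha (by linarith), ENNReal.mul_top hpos',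
    ENNReal.mul_top hpos, ENNReal.top_mul hσ, top_le_iff] at h1
  have h2 : ∫⁻ x, ‖extension (k + 2) lam (fun _ => 1) x‖ₑ ^ q.toReal ∂(hypMeasure (k + 2)) = ⊤ := by
    by_contra h3
    exact ENNReal.mul_ne_top (by norm_num) h3 h1
  have h4 : eLpNorm (extension (k + 2) lam fun _ => 1) q (hypMeasure (k + 2)) = ⊤ := by
    rw [eLpNorm_eq_lintegral_rpow_enorm_toReal hq0 hqt, h2, ENNReal.top_rpow_of_pos]
    have := ENNReal.toReal_pos hq0 hqt
    positivity
  have h5 := hC _ (memLp_const_sphere (k + 2) p)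
  rw [h4, top_le_iff] at h5
  exact ENNReal.mul_ne_top ENNReal.coe_ne_top (memLp_const_sphere (k + 2) p).2.ne h5

/-- The lower bound for the norm given by the constant function `1`. It serves for those `λ` which
are at most of size `e^(K / (q - 2))`. -/
theorem exists_le_extensionNorm_one (k : ℕ) {K : ℝ} (hK : 0 ≤ K) : ∃ c : ℝ, 0 < c ∧ ∀ lam : ℝ,
    1 ≤ lam → ∀ p q : ℝ≥0∞, 2 ≤ p → 2 < q → q ≠ ⊤ →
    Real.log lam ≤ K * (1 + 1 / (q.toReal - 2)) →
    ENNReal.ofReal (c * ((q.toReal - 2) ^ (-(1 / q.toReal)) *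
      lam ^ (((k + 1 : ℕ) : ℝ) / 2 * (p⁻¹).toReal - ((k + 1 : ℕ) : ℝ) / 2 * (q⁻¹).toReal))) ≤
        extensionNorm (k + 2) lam p q := by
  obtain ⟨B, hB, h⟩ := exists_le_lintegral_extension_one k
  obtain ⟨_, b, _, hb, hcb⟩ := exists_harishChandra_bounds (k + 1)
  have hA := amplitudeConst_pos k
  have hσ0 := sphereMeasure_univ_pos (k + 1)
  have hpi := Real.pi_pos
  set ρ : ℝ := ((k + 1 : ℕ) : ℝ) / 2 with hρ
  have hρ0 : 0 < ρ := by positivity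
  set σ := (sphereMeasure (k + 2)).real Set.univ with hσ
  obtain ⟨C₀, hC₀, hC⟩ := exists_mul_exp_neg_le (2 ^ (k + 1) * Real.pi ^ 2 * (ρ + 1) ^ 2)
    (by positivity : 0 < amplitudeConst k / b)
  set m := min ((1 / 4) ^ (k + 1) * σ / (2 * ρ)) 1 with hm
  have hm0 : 0 < m := lt_min (by positivity) one_pos
  set Q := ρ * (C₀ + 2) + ρ * (ρ + 1) * K with hQ
  refine ⟨m * B * Real.exp (-Q) * Real.exp (-(ρ * K)) / (1 + σ), by positivity,
    fun lam hlam p q hp hq2 hq hlog => ?_⟩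
  have hlam0 : 0 < lam := by linarith
  have hlog0 : 0 ≤ Real.log lam := Real.log_nonneg hlam
  have ht := two_lt_toReal hq2 hq
  have hqi : (q⁻¹).toReal = 1 / q.toReal := by rw [ENNReal.toReal_inv, one_div]
  rw [hqi]
  set t := q.toReal with htdef
  have ht2 : 0 < t - 2 := by linarith
  have ht0 : 0 < t := by linarith
  have hlogt : (t - 2) * Real.log lam ≤ K * t := by
    calc (t - 2) * Real.log lam ≤ (t - 2) * (K * (1 + 1 / (t - 2))) := by gcongr
      _ = K * (t - 1) := by field_simp; ring
      _ ≤ K * t := by gcongr; linarith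
  -- the error `λ e^(-r)` of the asymptotics falls below the amplitude, of size `λ^(-ρ)`, at this
  -- radius
  set R := C₀ + (ρ + 1) * Real.log lam with hR
  have hR1 : 1 ≤ R := by have : 0 ≤ (ρ + 1) * Real.log lam := by positivity
                         linarith
  have hthr : 2 ^ (k + 1) * Real.pi ^ 2 * ‖((k + 1 : ℕ) / 2 + Complex.I * lam : ℂ)‖ ^ 2 / lam *
      Real.exp (-R) ≤ amplitudeConst k * ‖harishChandra (k + 2) lam‖ := by
    have h1 := norm_half_add_I_mul_le (k + 1) hlam
    rw [← hρ] at h1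
    have hc0 := norm_harishChandra_pos (k + 1) hlam0
    have h2 : 1 / b * lam ^ (-ρ) ≤ ‖harishChandra (k + 2) lam‖ := by
      have h3 := (hcb lam hlam).2
      rw [inv_le_comm₀ hc0 (by positivity)] at h3
      refine le_trans (le_of_eq ?_) h3
      rw [Real.rpow_neg hlam0.le, mul_inv, one_div]
    have h4 : Real.exp (-R) = Real.exp (-C₀) * (lam ^ (-ρ) * lam⁻¹) := by
      rw [← Real.rpow_neg_one lam, ← Real.rpow_add hlam0, Real.rpow_def_of_pos hlam0,
        ← Real.exp_add, hR]
      congr 1; ring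
    calc _ ≤ 2 ^ (k + 1) * Real.pi ^ 2 * ((ρ + 1) * lam) ^ 2 / lam * Real.exp (-R) := by gcongr
      _ = 2 ^ (k + 1) * Real.pi ^ 2 * (ρ + 1) ^ 2 * Real.exp (-C₀) * lam ^ (-ρ) := by
          rw [h4]; field_simp
      _ ≤ amplitudeConst k / b * lam ^ (-ρ) := by gcongr
      _ = amplitudeConst k * (1 / b * lam ^ (-ρ)) := by ring
      _ ≤ _ := by gcongr
  set a := ρ * (t - 2) with ha
  have ha0 : 0 < a := by positivity
  have hmom := h lam R t hlam0 hR1 ht0.le hthr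
  rw [lintegral_Ioi_exp_neg_mul ha0, abs_of_pos ha0,
    ← ofReal_measureReal (measure_ne_top _ _), ← ENNReal.ofReal_mul (Real.exp_pos _).le,
    ← ENNReal.ofReal_mul (by positivity), ← ENNReal.ofReal_mul (by positivity)] at hmom
  set τ := Real.pi / (2 * lam) with hτ
  have hτ2 : τ ≤ 2 := by
    rw [hτ, div_le_iff₀ (by positivity)]
    nlinarith [Real.pi_le_four]
  have hτ0 : 0 ≤ τ := by positivity
  -- the loss up to the radius `R + τ` is bounded, as `(t - 2) log λ` is at most `K t`
  have haR : a * τ + a * R ≤ Q * t := by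
    have h5 : a * τ + a * R ≤ ρ * (t - 2) * (C₀ + 2) + ρ * (ρ + 1) * ((t - 2) * Real.log lam) := by
      have : a * τ ≤ a * 2 := by gcongr
      rw [hR]
      rw [ha] at this ⊢
      nlinarith
    have h6 : ρ * (ρ + 1) * ((t - 2) * Real.log lam) ≤ ρ * (ρ + 1) * (K * t) := by gcongr
    have h7 : ρ * (t - 2) * (C₀ + 2) ≤ ρ * t * (C₀ + 2) := by gcongr; linarith
    rw [hQ]
    linarith
  have hE1 : ENNReal.ofReal (m * B * Real.exp (-Q) * (t - 2) ^ (-(1 / t))) ≤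
      eLpNorm (extension (k + 2) lam fun _ => 1) q (hypMeasure (k + 2)) := by
    refine ofReal_le_eLpNorm_of_le_lintegral (by rintro rfl; simp at hq2) hq (by positivity) ?_
    rw [← htdef]
    rw [← ENNReal.mul_le_mul_iff_right (two_ne_zero) (ENNReal.ofNat_ne_top)]
    refine le_trans ?_ hmom
    refine le_trans (le_of_eq ?_) (ENNReal.ofReal_le_ofReal (p := 2 *
      (m * B * Real.exp (-Q) * (t - 2) ^ (-(1 / t))) ^ t) ?_)
    · rw [ENNReal.ofReal_mul zero_le_two, ENNReal.ofReal_ofNat]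
    have h5 : m ^ t ≤ (1 / 4) ^ (k + 1) * σ / (2 * ρ) := by
      have h6 := Real.rpow_le_rpow hm0.le (min_one_le_rpow_one_div (t := t)
        (by positivity : 0 < (1 / 4) ^ (k + 1) * σ / (2 * ρ)) (by linarith)) ht0.le
      rwa [← Real.rpow_mul (by positivity), one_div_mul_cancel ht0.ne', Real.rpow_one] at h6
    have h7 : Real.exp (-Q) ^ t ≤ Real.exp (-(a * τ)) * Real.exp (-(a * R)) := by
      rw [← Real.exp_mul, ← Real.exp_add, Real.exp_le_exp]; linarith
    have h8 : ((t - 2) ^ (-(1 / t))) ^ t = (t - 2)⁻¹ := by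
      rw [← Real.rpow_mul ht2.le, neg_mul, one_div_mul_cancel ht0.ne', Real.rpow_neg_one]
    rw [Real.mul_rpow (by positivity) (by positivity), Real.mul_rpow (by positivity) (by positivity),
      Real.mul_rpow (by positivity) (by positivity), h8]
    calc 2 * (m ^ t * B ^ t * Real.exp (-Q) ^ t * (t - 2)⁻¹)
        ≤ 2 * ((1 / 4) ^ (k + 1) * σ / (2 * ρ) * B ^ t *
          (Real.exp (-(a * τ)) * Real.exp (-(a * R))) * (t - 2)⁻¹) := by gcongr
      _ = _ := by rw [ha, hσ]; field_simp
  have hup := hE1.trans (eLpNorm_extension_le (k + 2) lam p q _ (memLp_const_sphere (k + 2) p)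
    (by positivity : 0 < 1 + σ) (eLpNorm_le_of_norm_le_one (fun _ => by simp)
      (le_trans (by norm_num) hp)))
  have hN' : ENNReal.ofReal (1 + σ) ≠ 0 := by
    rw [Ne, ENNReal.ofReal_eq_zero, not_le]; positivity
  rw [← ENNReal.mul_le_mul_iff_right hN' ENNReal.ofReal_ne_top]
  refine le_trans ?_ hup
  rw [← ENNReal.ofReal_mul (by positivity)]
  refine ENNReal.ofReal_le_ofReal ?_
  have hP : (p⁻¹).toReal ≤ 1 / 2 := by
    have := ENNReal.toReal_mono (by norm_num) (ENNReal.inv_le_inv.2 hp)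
    simpa using this
  have hpow : lam ^ (ρ * (p⁻¹).toReal - ρ * (1 / t)) ≤ Real.exp (ρ * K) := by
    rw [Real.rpow_def_of_pos hlam0, Real.exp_le_exp]
    have h9 : ρ * (p⁻¹).toReal - ρ * (1 / t) ≤ ρ * (1 / 2) - ρ * (1 / t) := by gcongr
    have h10 : Real.log lam * (ρ * (1 / 2) - ρ * (1 / t)) =
        ρ / (2 * t) * ((t - 2) * Real.log lam) := by field_simp
    calc _ ≤ Real.log lam * (ρ * (1 / 2) - ρ * (1 / t)) := by gcongr
      _ = _ := h10
      _ ≤ ρ / (2 * t) * (K * t) := by gcongr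
      _ = ρ * K / 2 := by field_simp
      _ ≤ ρ * K := by have : 0 ≤ ρ * K := by positivity
                      linarith
  have h11 : Real.exp (-(ρ * K)) * Real.exp (ρ * K) = 1 := by rw [← Real.exp_add]; simp
  calc _ = m * B * Real.exp (-Q) * (t - 2) ^ (-(1 / t)) * (Real.exp (-(ρ * K)) *
        lam ^ (ρ * (p⁻¹).toReal - ρ * (1 / t))) := by field_simp
    _ ≤ m * B * Real.exp (-Q) * (t - 2) ^ (-(1 / t)) * (Real.exp (-(ρ * K)) *
        Real.exp (ρ * K)) := by gcongr
    _ = _ := by rw [h11, mul_one]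

/-! ### The two regimes combined -/

/-- The factors `(t - 2)^(-1/t)` and `(t - 2)^(-1/2)` are comparable near `t = 2`, where both blow
up, and the first one is the larger one for large `t`. -/
theorem exp_neg_one_mul_rpow_le {x : ℝ} (hx : 0 < x) :
    Real.exp (-1) * x ^ (-(1 / 2) : ℝ) ≤ x ^ (-(1 / (x + 2))) := by
  have h1 : -1 ≤ x * Real.log x := by
    have h2 := mul_le_mul_of_nonneg_left (Real.one_sub_inv_le_log_of_pos hx) hx.le
    have h3 : x * (1 - x⁻¹) = x - 1 := by field_simp
    linarith
  rw [Real.rpow_def_of_pos hx, Real.rpow_def_of_pos hx, ← Real.exp_add, Real.exp_le_exp]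
  have h4 : Real.log x * -(1 / (x + 2)) - Real.log x * (-(1 / 2)) =
      x * Real.log x / (2 * (x + 2)) := by field_simp; ring
  have h5 : -1 ≤ x * Real.log x / (2 * (x + 2)) := by
    rw [le_div_iff₀ (by positivity)]; linarith
  linarith

/-- The first term of the lower bound for the norm. Wave packets and the constant function `1`
together cover all `λ > 1`. -/
theorem exists_le_extensionNorm_of_two_lt (k : ℕ) : ∃ c : ℝ, 0 < c ∧ ∀ lam : ℝ, 1 ≤ lam →
    ∀ p q : ℝ≥0∞, 2 ≤ p → 2 < q →
    ENNReal.ofReal c * ((q - 2) ^ (-(1 / 2) : ℝ) * ENNReal.ofReal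
      (lam ^ (((k + 1 : ℕ) : ℝ) / 2 * (p⁻¹).toReal - ((k + 1 : ℕ) : ℝ) / 2 * (q⁻¹).toReal))) ≤
        extensionNorm (k + 2) lam p q := by
  obtain ⟨c₁, hc₁, h₁⟩ := exists_le_extensionNorm_wavePacket (k + 1)
  have hthr := packetThreshold_pos (k + 1)
  obtain ⟨c₂, hc₂, h₂⟩ := exists_le_extensionNorm_one k
    (by positivity : 0 ≤ |Real.log (packetThreshold (k + 1))| + (((k + 1 : ℕ) : ℝ) + 4))
  have hc : 0 < min c₁ c₂ := lt_min hc₁ hc₂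
  refine ⟨min c₁ c₂ * Real.exp (-1), by positivity, fun lam hlam p q hp hq2 => ?_⟩
  have hlam0 : 0 < lam := by linarith
  -- for `q = ∞` the left-hand side vanishes
  rcases eq_or_ne q ⊤ with rfl | hq
  · rw [ENNReal.top_sub (by norm_num), ENNReal.top_rpow_of_neg (by norm_num), zero_mul, mul_zero]
    exact zero_le
  have ht := two_lt_toReal hq2 hq
  have hx : 0 < q.toReal - 2 := by linarith
  have hq2' : q - 2 = ENNReal.ofReal (q.toReal - 2) := by
    rw [ENNReal.ofReal_sub _ zero_le_two, ENNReal.ofReal_toReal hq, ENNReal.ofReal_ofNat]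
  set y := lam ^ (((k + 1 : ℕ) : ℝ) / 2 * (p⁻¹).toReal - ((k + 1 : ℕ) : ℝ) / 2 * (q⁻¹).toReal)
    with hy
  have hy0 : 0 < y := by positivity
  have hcmp := exp_neg_one_mul_rpow_le hx
  rw [sub_add_cancel] at hcmp
  have hmain : ENNReal.ofReal (min c₁ c₂ * ((q.toReal - 2) ^ (-(1 / q.toReal)) * y)) ≤
      extensionNorm (k + 2) lam p q := by
    rcases le_or_gt (packetThreshold (k + 1) *
      Real.exp ((((k + 1 : ℕ) : ℝ) + 4) * (1 + 1 / (q.toReal - 2)))) lam with h | h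
    · refine le_trans (ENNReal.ofReal_le_ofReal ?_) (h₁ lam hlam p q hp hq2 hq h)
      gcongr
      exact min_le_left _ _
    · refine le_trans (ENNReal.ofReal_le_ofReal ?_) (h₂ lam hlam p q hp hq2 hq ?_)
      · gcongr
        exact min_le_right _ _
      · have h3 := (Real.log_le_log hlam0 h.le)
        rw [Real.log_mul hthr.ne' (Real.exp_pos _).ne', Real.log_exp] at h3
        have h4 := le_abs_self (Real.log (packetThreshold (k + 1)))
        have h5 : 0 ≤ |Real.log (packetThreshold (k + 1))| * (1 / (q.toReal - 2)) := by positivity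
        linarith
  refine le_trans ?_ hmain
  rw [hq2', ENNReal.ofReal_rpow_of_pos hx, ← ENNReal.ofReal_mul (by positivity),
    ← ENNReal.ofReal_mul (by positivity)]
  refine ENNReal.ofReal_le_ofReal ?_
  calc _ = min c₁ c₂ * ((Real.exp (-1) * (q.toReal - 2) ^ (-(1 / 2) : ℝ)) * y) := by ring
    _ ≤ _ := by gcongr

end HyperbolicExtension

theorem proposition1p3 (d : ℕ) (hd : 2 ≤ d) :
    (∀ lam : ℝ, 0 < lam → ∀ p q : ℝ≥0∞, 1 ≤ p → 1 ≤ q → (p < 2 ∨ q ≤ 2) →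
      ¬ HyperbolicExtension.IsBoundedExtension d lam p q) ∧
    (∃ c : ℝ, 0 < c ∧ ∀ lam : ℝ, 1 < lam → ∀ p q : ℝ≥0∞, 2 ≤ p → 2 < q →
      ENNReal.ofReal c *
          ((q - 2) ^ (-(1 / 2) : ℝ) *
              ENNReal.ofReal (lam ^ (HyperbolicExtension.rho d * (p⁻¹).toReal
                - HyperbolicExtension.rho d * (q⁻¹).toReal)) +
            ENNReal.ofReal (lam ^ (HyperbolicExtension.rho d - (d : ℝ) * (q⁻¹).toReal)))
        ≤ HyperbolicExtension.extensionNorm d lam p q) := by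
  obtain ⟨k, rfl⟩ := Nat.exists_eq_add_of_le' hd
  refine ⟨fun lam hlam p q hp hq h => ?_, ?_⟩
  · rcases h with h | h
    · exact HyperbolicExtension.not_isBoundedExtension_of_lt_two (n := k + 1) (by omega) hlam hp h hq
    · exact HyperbolicExtension.not_isBoundedExtension_of_le_two k hlam hq h
  · obtain ⟨c₁, hc₁, h₁⟩ := HyperbolicExtension.exists_le_extensionNorm_of_two_lt k
    obtain ⟨c₂, hc₂, h₂⟩ := HyperbolicExtension.exists_le_extensionNorm_ball (k + 1)
    have hc : 0 < min c₁ c₂ := lt_min hc₁ hc₂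
    refine ⟨min c₁ c₂ / 2, by positivity, fun lam hlam p q hp hq => ?_⟩
    have hρ : HyperbolicExtension.rho (k + 2) = ((k + 1 : ℕ) : ℝ) / 2 :=
      HyperbolicExtension.rho_succ (k + 1)
    have e1 := h₁ lam hlam.le p q hp hq
    have e2 := h₂ lam hlam.le p q (le_trans (by norm_num) hp) (le_trans (by norm_num) hq.le)
    rw [ENNReal.ofReal_mul hc₂.le] at e2
    rw [← ENNReal.mul_le_mul_iff_right two_ne_zero ENNReal.ofNat_ne_top, ← mul_assoc]
    have e3 : 2 * ENNReal.ofReal (min c₁ c₂ / 2) = ENNReal.ofReal (min c₁ c₂) := by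
      rw [← ENNReal.ofReal_ofNat 2, ← ENNReal.ofReal_mul zero_le_two]
      congr 1
      ring
    have e4 : ((k + 2 : ℕ) : ℝ) = ((k + 1 : ℕ) : ℝ) + 1 := by push_cast; ring
    rw [e3, mul_add, two_mul, hρ, e4]
    refine add_le_add (le_trans ?_ e1) (le_trans ?_ e2)
    · gcongr
      exact min_le_left _ _
    · gcongr
      exact min_le_right _ _
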